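/- Let $\mathbb T=\mathbb R/2\pi\mathbb Z$; all functions are complex valued. A periodic distribution $u=\sum_{k\in\mathbb Z}u_ke^{ikx}$ is identified with the sequence of its Fourier coefficients, and $H^s=H^s(\mathbb T)$, $s\in\mathbb R$, consists of those with $\sum_k(1+k^2)^s|u_k|^2<\infty$, with the topology of the corresponding norm. For $N\in\mathbb N$ let $\Pi_N u=\sum_{|k|\le N}u_ke^{ikx}$, and let $\Phi_N(t)$ be the flow of the truncated complex mKdV equation $$\partial_tu+\partial_x^3u-6\,\Pi_N\big(|\Pi_Nu|^2\,\partial_x\Pi_Nu\big)=0,\qquad u(0)=u_0,$$ understood Fourier mode by Fourier mode. For smooth $u:\mathbb T\to\mathbb C$ put $w_1[u]=u$, $w_{m+1}[u]=-i\partial_xw_m[u]+\bar u\sum_{k=1}^{m-1}w_k[u]\,w_{m-k}[u]$, $E_m(u)=\mathrm{Re}\int_{\mathbb T}\bar u\,w_m[u]\,dx$, and $R_n(u)=E_{2n+1}(u)-\|\partial_x^nu\|_{L^2(\mathbb T)}^2$. Let $n\ge2$ be an integer and let $\mu_n$ be the law of $\sum_{j\in\mathbb Z}\frac{g_j}{\sqrt{2\pi(1+j^{2n})}}e^{ijx}$,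 where the $g_j$ are i.i.d. standard complex Gaussian random variables (density $\pi^{-1}e^{-|z|^2}$). Let $\chi\in C_0^\infty(\mathbb R,\mathbb R)$ with $\chi(x)=1$ for $|x|<1$, and for $R>0$ let $$F_{n,R}(u)=\prod_{l=0}^{n-1}\chi\big(E_{2l+1}(u)/R\big)\,e^{-R_n(u)},\qquad d\rho_{n,R,N}(u)=F_{n,R}(\Pi_Nu)\,d\mu_n(u).$$ Proposition. For every $N$ and every $u_0$ the truncated equation has exactly one global solution (so that $\Phi_N(t)$ is well defined), $F_{n,R}(\Pi_N\,\cdot)$ is $\mu_n$-integrable (so that $\rho_{n,R,N}$ is a well-defined finite, possibly signed, measure), and for all $R,T>0$ $$\sup_{\substack{t\in[0,T],\ \sigma<\frac{2n-1}2\\ A\subset H^\sigma\ \text{Borel}}}\big|\rho_{n,R,N}(\Phi_N(t)A)-\rho_{n,R,N}(A)\big|\longrightarrow0\qquad(N\to\infty).$$ -/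

import Mathlib

open scoped ContDiff Topology ENNReal

noncomputable section

namespace CmKdV

open MeasureTheory ProbabilityTheory

/- A `2π`-periodic distribution `∑ u_k e^{ikx}` is represented by the sequence `u : ℤ → ℂ` of its
Fourier coefficients, `u_k = (2π)⁻¹ ∫_0^{2π} u(x) e^{-ikx} dx`. -/

/-- The Sobolev space `H^s(𝕋)`, `s ∈ ℝ`: the `u` such that
`J^s u = ∑ (1+k²)^{s/2} u_k e^{ikx}` is square integrable. -/
structure Sobolev (s : ℝ) where
  coeff : ℤ → ℂ
  mem : Memℓp (fun k : ℤ => (((1 + (k : ℝ) ^ 2) ^ (s / 2) : ℝ) : ℂ) * coeff k) 2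

/-- The map `J^s : H^s → L²(𝕋) ≅ ℓ²(ℤ)`. -/
def Sobolev.bessel {s : ℝ} (u : Sobolev s) : lp (fun _ : ℤ => ℂ) 2 :=
  ⟨fun k : ℤ => (((1 + (k : ℝ) ^ 2) ^ (s / 2) : ℝ) : ℂ) * u.coeff k, u.mem⟩

/-- The topology of `H^s` is that of the norm `‖J^s u‖_{L²}`. -/
instance (s : ℝ) : TopologicalSpace (Sobolev s) :=
  TopologicalSpace.induced Sobolev.bessel inferInstance

instance (s : ℝ) : MeasurableSpace (Sobolev s) := borel _

instance (s : ℝ) : BorelSpace (Sobolev s) := ⟨rfl⟩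

/-- The Dirichlet projection `Π_N u = ∑_{|k| ≤ N} u_k e^{ikx}`, as a function of `x`. -/
def proj (N : ℕ) (u : ℤ → ℂ) : ℝ → ℂ := fun x =>
  ∑ k ∈ Finset.Icc (-(N : ℤ)) N, u k * Complex.exp (Complex.I * k * x)

/-- The `k`-th Fourier coefficient of a `2π`-periodic function. -/
def fourierCoef (f : ℝ → ℂ) (k : ℤ) : ℂ :=
  (2 * Real.pi : ℂ)⁻¹ * ∫ x in (0 : ℝ)..2 * Real.pi, f x * Complex.exp (-(Complex.I * k * x))

/-- `u : ℝ → (ℤ → ℂ)` is a global solution of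
`∂_t u + ∂_x³ u - 6 Π_N (|Π_N u|² ∂_x Π_N u) = 0`, `u(0) = u₀`, written mode by mode:
`∂_x³` is the multiplier `(ik)³ = -ik³`. -/
structure IsSolution (N : ℕ) (u₀ : ℤ → ℂ) (u : ℝ → ℤ → ℂ) : Prop where
  initial : u 0 = u₀
  equation : ∀ (t : ℝ) (k : ℤ),
    HasDerivAt (fun τ => u τ k)
      (-((Complex.I * k) ^ 3 * u t k) +
        if |k| ≤ (N : ℤ) then
          6 * fourierCoef
            (fun x => ((‖proj N (u t) x‖ ^ 2 : ℝ) : ℂ) * deriv (proj N (u t)) x) k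
        else 0) t

/-- The flow `Φ_N(t)` of the truncated equation: the value at time `t` of the solution with
initial datum `u₀`. -/
def flow (N : ℕ) (t : ℝ) (u₀ : ℤ → ℂ) : ℤ → ℂ :=
  Classical.epsilon (IsSolution N u₀) t

/-- The operators `w_1[u] = u`,
`w_{n+1}[u] = -i ∂_x w_n[u] + ū ∑_{k=1}^{n-1} w_k[u] w_{n-k}[u]` (index `0` is not used). -/
def w (u : ℝ → ℂ) : ℕ → ℝ → ℂ
  | 0 => 0
  | 1 => u
  | n + 2 => fun x =>
      -Complex.I * deriv (w u (n + 1)) x +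
        (starRingEnd ℂ) (u x) * ∑ k : Fin n, w u (k + 1) x * w u (n - k) x
  termination_by n => n
  decreasing_by all_goals omega

/-- The conservation laws `E_n(u) = Re ∫_𝕋 ū w_n[u] dx`. -/
def E (n : ℕ) (u : ℝ → ℂ) : ℝ :=
  (∫ x in (0 : ℝ)..2 * Real.pi, (starRingEnd ℂ) (u x) * w u n x).re

/-- `R_n(u)`, defined by `E_{2n+1}(u) = ‖∂_x^n u‖²_{L²} + R_n(u)`. -/
def Rem (n : ℕ) (u : ℝ → ℂ) : ℝ :=
  E (2 * n + 1) u - ∫ x in (0 : ℝ)..2 * Real.pi, ‖iteratedDeriv n u x‖ ^ 2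

/-- The density `F_{n,R}(u) = ∏_{l=0}^{n-1} χ(E_{2l+1}(u)/R) exp(-R_n(u))`. -/
def F (χ : ℝ → ℝ) (n : ℕ) (R : ℝ) (u : ℝ → ℂ) : ℝ :=
  (∏ l ∈ Finset.range n, χ (E (2 * l + 1) u / R)) * Real.exp (-Rem n u)

/-- The standard complex Gaussian law, of density `π⁻¹ e^{-|z|²}`: the real and imaginary parts are
independent, centered, of variance `1/2`. -/
def complexGaussian : Measure ℂ :=
  ((gaussianReal 0 (1 / 2)).prod (gaussianReal 0 (1 / 2))).map (fun p => (⟨p.1, p.2⟩ : ℂ))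

instance : IsProbabilityMeasure complexGaussian :=
  Measure.isProbabilityMeasure_map
    (Complex.measurableEquivRealProd.symm.measurable.aemeasurable)

/-- The Gaussian measure `μ_n`: the law of
`∑_j g_j (2π(1+j^{2n}))^{-1/2} e^{ijx}` with `g_j` i.i.d. standard complex Gaussians. -/
def gaussian (n : ℕ) : Measure (ℤ → ℂ) :=
  (Measure.infinitePi (fun _ : ℤ => complexGaussian)).map
    (fun g j => g j / (Real.sqrt (2 * Real.pi * (1 + (j : ℝ) ^ (2 * n))) : ℂ))

/-- The weighted (possibly signed) measure `dρ_{n,R,N} = F_{n,R}(Π_N u) dμ_n`. -/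
def rho (χ : ℝ → ℝ) (n : ℕ) (R : ℝ) (N : ℕ) (A : Set (ℤ → ℂ)) : ℝ :=
  ∫ u in A, F χ n R (proj N u) ∂(gaussian n)

end CmKdV

end

/-! The truncated equation decouples. On the frequencies `|k| ≤ N` it is an ODE with a polynomial
vector field, and above `N` each mode merely rotates by `exp(i k³ t)`. The ODE conserves the mass,
whose sublevel sets are compact and convex, so it has a global flow (`ConservedField`,
`conservedField`). Its field is divergence free (`trace_fderiv_field`), so Lebesgue measure on the
low modes is invariant (`measurePreserving_flowMap`). Rotations preserve the Gaussian law of the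
high modes. The product of the two, `refMeasure`, is therefore invariant under `flow`.

Relative to `refMeasure`, the Gaussian exponent and `-R_n` combine, and the weighted measure has
density `c ∏ χ(E_{2l+1}/R) exp(-E_{2n+1} - E_1)` in the low modes (`exists_lowDensity_mul_F_eq`).
After a change of variables, `ρ(Φ(t)A) - ρ(A)` is the integral over `A` of the change of this
density along the flow. It is bounded, uniformly in `A`, by `t` times the `L¹` norm of the rate of
change (`ofReal_abs_setIntegral_flow_sub_le`, `lintegral_flowMap_sub_le`). On the support of the
cut-offs the energies below level `n` bound the `H^{n-1}` norm and hence `R_n`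
(`exists_abs_rem_le`). So the weight is bounded, and the rate is at most a constant times the
Gaussian density times the drifts of `E_1, E_3, ..., E_{2n+1}`
(`exists_hasDerivAt_lowDensity_mul_F`).

It remains to see that the mean drift tends to zero. The full equation conserves every `E_m`, a
formal identity obtained from a Riccati equation for the generating series of the densities
(`exists_densLin_eq_deriv`). Hence the drift is the derivative of `E_m` in the direction of the
discarded part of the nonlinearity, which has frequencies above `N`. In such a direction the
quadratic part of the energy contributes nothing, and the rest of `E_{2l+1}` carries two derivatives
less, which costs `N^{2l-2}` (`exists_nnnorm_energyLin_le`). The nonlinearity costs one more factor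
`N`. If the coefficients decay like `⟨k⟩^{-s}` with `s > 3/2`, three frequencies of size at most `N`
with sum beyond `N`, paired with the remaining factors, contribute only `N^{1/2-2s}`
(`exists_high_cube_mul_pow_le`). The total is at most `N^{2n-1/2-2s}`. Under the Gaussian law one
may take `s = n - 2/M` at the price of a factor with an `N`-independent expectation
(`majorant_toPoly_le`, `lintegral_modeSum_le`). With `M = 4n+6` the power of `N` is at most `-3/14`
(`exists_sum_abs_energyRate_le`). -/

noncomputable section

namespace CmKdV

open MeasureTheory ProbabilityTheory

/-! ### Formal conservation laws: generating series and Riccati equations. -/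

section Hierarchy

variable {K A : Type*} [CommRing K] [CommRing A] [Algebra K A] (D : Derivation K A A)

/-- The densities `w_m` in a commutative differential ring, with `D` in the role of `-i∂_x` and
`v` in that of `ū`. -/
def dens (u v : A) : ℕ → A
  | 0 => 0
  | 1 => u
  | n + 2 => D (dens u v (n + 1)) +
      v * ∑ k : Fin n, dens u v (k + 1) * dens u v (n - k)
  termination_by n => n
  decreasing_by all_goals omega

/-- The linearization of `dens` at `(u, v)` in the direction `(h, k)`. -/
def densLin (u v h k : A) : ℕ → A
  | 0 => 0
  | 1 => h
  | n + 2 => D (densLin u v h k (n + 1)) +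
      (k * ∑ j : Fin n, dens D u v (j + 1) * dens D u v (n - j) +
        v * ∑ j : Fin n, (densLin u v h k (j + 1) * dens D u v (n - j) +
          dens D u v (j + 1) * densLin u v h k (n - j)))
  termination_by n => n
  decreasing_by all_goals omega

lemma dens_zero (u v : A) : dens D u v 0 = 0 := by rw [dens]
lemma dens_one (u v : A) : dens D u v 1 = u := by rw [dens]
lemma dens_add_two (u v : A) (n : ℕ) : dens D u v (n + 2) = D (dens D u v (n + 1)) +
    v * ∑ k : Fin n, dens D u v (k + 1) * dens D u v (n - k) := by rw [dens]
lemma densLin_zero (u v h k : A) : densLin D u v h k 0 = 0 := by rw [densLin]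
lemma densLin_one (u v h k : A) : densLin D u v h k 1 = h := by rw [densLin]
lemma densLin_add_two (u v h k : A) (n : ℕ) : densLin D u v h k (n + 2) =
    D (densLin D u v h k (n + 1)) +
      (k * ∑ j : Fin n, dens D u v (j + 1) * dens D u v (n - j) +
        v * ∑ j : Fin n, (densLin D u v h k (j + 1) * dens D u v (n - j) +
          dens D u v (j + 1) * densLin D u v h k (n - j))) := by rw [densLin]

lemma densLin_add (u v h k h' k' : A) (m : ℕ) :
    densLin D u v (h + h') (k + k') m = densLin D u v h k m + densLin D u v h' k' m := by
  induction m using Nat.strong_induction_on with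
  | _ m ih =>
    match m with
    | 0 => simp [densLin_zero]
    | 1 => simp [densLin_one]
    | n + 2 =>
      simp only [densLin_add_two]
      rw [ih (n + 1) (by omega), map_add]
      have : ∑ j : Fin n, (densLin D u v (h + h') (k + k') (j + 1) * dens D u v (n - j) +
          dens D u v (j + 1) * densLin D u v (h + h') (k + k') (n - j)) =
          ∑ j : Fin n, (densLin D u v h k (j + 1) * dens D u v (n - j) +
          dens D u v (j + 1) * densLin D u v h k (n - j)) +
          ∑ j : Fin n, (densLin D u v h' k' (j + 1) * dens D u v (n - j) +
          dens D u v (j + 1) * densLin D u v h' k' (n - j)) := by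
        rw [← Finset.sum_add_distrib]
        refine Finset.sum_congr rfl fun j _ => ?_
        rw [ih (j + 1) (by omega), ih (n - j) (by omega)]
        ring
      rw [this]
      ring

lemma densLin_smul (u v h k : A) (c : K) (m : ℕ) :
    densLin D u v (c • h) (c • k) m = c • densLin D u v h k m := by
  induction m using Nat.strong_induction_on with
  | _ m ih =>
    match m with
    | 0 => simp [densLin_zero]
    | 1 => simp [densLin_one]
    | n + 2 =>
      simp only [densLin_add_two]
      rw [ih (n + 1) (by omega), Derivation.map_smul]
      have : ∑ j : Fin n, (densLin D u v (c • h) (c • k) (j + 1) * dens D u v (n - j) +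
          dens D u v (j + 1) * densLin D u v (c • h) (c • k) (n - j)) =
          c • ∑ j : Fin n, (densLin D u v h k (j + 1) * dens D u v (n - j) +
          dens D u v (j + 1) * densLin D u v h k (n - j)) := by
        rw [Finset.smul_sum]
        refine Finset.sum_congr rfl fun j _ => ?_
        rw [ih (j + 1) (by omega), ih (n - j) (by omega)]
        simp [smul_add]
      rw [this]
      simp [smul_add]


open PowerSeries

/-- The derivation `D` acting on the coefficients of power series. -/
def coeffDeriv : Derivation K A⟦X⟧ A⟦X⟧ :=
  Derivation.mk'
    { toFun := fun f => PowerSeries.mk fun n => D (coeff n f)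
      map_add' := fun f g => by ext n; simp
      map_smul' := fun c f => by ext n; simp }
    (fun f g => by
      ext n
      simp only [LinearMap.coe_mk, AddHom.coe_mk, coeff_mk, coeff_mul, map_sum, Derivation.leibniz,
        smul_eq_mul, map_add, Finset.sum_add_distrib]
      congr 1
      rw [← Finset.Nat.sum_antidiagonal_swap]
      simp)

lemma coeff_coeffDeriv (f : A⟦X⟧) (n : ℕ) : coeff n (coeffDeriv D f) = D (coeff n f) := by
  simp [coeffDeriv]

lemma coeffDeriv_C (a : A) : coeffDeriv D (C a) = C (D a) := by
  ext n
  rw [coeff_coeffDeriv, coeff_C, coeff_C]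
  split_ifs <;> simp

lemma coeffDeriv_X : coeffDeriv D (X : A⟦X⟧) = 0 := by
  ext n
  rw [coeff_coeffDeriv, coeff_X]
  split_ifs <;> simp

/-- The two end terms of the convolution contain an index-`0` factor and vanish. This matches the
coefficients of a product of series with the sum in the recursion. -/
lemma sum_antidiagonal_eq_sum_fin (f g : ℕ → A) (hf : f 0 = 0) (hg : g 0 = 0) (n : ℕ) :
    ∑ p ∈ Finset.HasAntidiagonal.antidiagonal (n + 1), f p.1 * g p.2 =
      ∑ j : Fin n, f (j + 1) * g (n - j) := by
  rw [Finset.Nat.sum_antidiagonal_eq_sum_range_succ (fun i j => f i * g j), Finset.sum_range_succ,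
    Finset.sum_range_succ', hf, Nat.sub_self, hg, mul_zero, zero_mul, add_zero, add_zero]
  rw [Finset.sum_range]
  refine Finset.sum_congr rfl fun j _ => ?_
  rw [show n + 1 - ((j : ℕ) + 1) = n - j by omega]

/-- The Riccati equation for the generating series of the densities. -/
lemma mk_dens (u v : A) :
    PowerSeries.mk (dens D u v) = X * C u + X * coeffDeriv D (PowerSeries.mk (dens D u v)) +
      X * (C v * (PowerSeries.mk (dens D u v) * PowerSeries.mk (dens D u v))) := by
  ext n
  match n with
  | 0 => simp [dens_zero]
  | 1 => simp [dens_zero, dens_one, coeff_succ_X_mul, coeff_coeffDeriv]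
  | n + 2 =>
    simp only [map_add, coeff_succ_X_mul, coeff_coeffDeriv, coeff_mk, coeff_C_mul]
    simp only [coeff_mul, coeff_mk]
    rw [sum_antidiagonal_eq_sum_fin _ _ (dens_zero D u v) (dens_zero D u v), dens_add_two]
    simp

/-- The Riccati equation differentiated in the direction `(h, k)`; it is linear in the unknown
series. -/
lemma mk_densLin (u v h k : A) :
    PowerSeries.mk (densLin D u v h k) =
      X * C h + X * coeffDeriv D (PowerSeries.mk (densLin D u v h k)) +
      X * (C k * (PowerSeries.mk (dens D u v) * PowerSeries.mk (dens D u v)) +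
        C v * (PowerSeries.mk (densLin D u v h k) * PowerSeries.mk (dens D u v) +
          PowerSeries.mk (dens D u v) * PowerSeries.mk (densLin D u v h k))) := by
  ext n
  match n with
  | 0 => simp [densLin_zero]
  | 1 => simp [dens_zero, densLin_zero, densLin_one, coeff_succ_X_mul, coeff_coeffDeriv]
  | n + 2 =>
    simp only [map_add, coeff_succ_X_mul, coeff_coeffDeriv, coeff_mk, coeff_C_mul]
    simp only [coeff_mul, coeff_mk]
    rw [sum_antidiagonal_eq_sum_fin _ _ (dens_zero D u v) (dens_zero D u v),
      sum_antidiagonal_eq_sum_fin _ _ (densLin_zero D u v h k) (dens_zero D u v),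
      sum_antidiagonal_eq_sum_fin _ _ (dens_zero D u v) (densLin_zero D u v h k),
      densLin_add_two, Finset.sum_add_distrib]
    simp

/-- The factor `X` makes each coefficient depend only on the preceding ones, linearly and without
constant term. This is the uniqueness statement for the linearized Riccati equation. -/
lemma eq_zero_of_eq_X_mul (Z P : A⟦X⟧) (h : Z = X * (coeffDeriv D Z + P * Z)) : Z = 0 := by
  have key : ∀ n, coeff n Z = 0 := by
    intro n
    induction n using Nat.strong_induction_on with
    | _ n ih =>
      match n with
      | 0 => rw [h]; simp
      | n + 1 =>
        rw [h, coeff_succ_X_mul, map_add, coeff_coeffDeriv, ih n (by omega), map_zero, coeff_mul]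
        rw [zero_add]
        refine Finset.sum_eq_zero fun p hp => ?_
        rw [ih p.2 (by have := Finset.HasAntidiagonal.mem_antidiagonal.1 hp; omega), mul_zero]
  ext n
  simpa using key n

/-- The densities `v * dens m` are conserved by the complex mKdV flow: their derivative in the
direction of the vector field is exact. -/
theorem exists_densLin_eq_deriv (u v : A) (m : ℕ) :
    ∃ g, (D (D (D v)) + 6 * (u * v * D v)) * dens D u v m +
      v * densLin D u v (D (D (D u)) + 6 * (u * v * D u))
        (D (D (D v)) + 6 * (u * v * D v)) m = D g := by
  set h := D (D (D u)) + 6 * (u * v * D u) with hh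
  set k := D (D (D v)) + 6 * (u * v * D v) with hk
  set W := PowerSeries.mk (dens D u v) with hW
  set S := PowerSeries.mk (densLin D u v h k) with hS
  have eW : W = X * C u + X * coeffDeriv D W + X * (C v * (W * W)) := mk_dens D u v
  have eS : S = X * C h + X * coeffDeriv D S + X * (C k * (W * W) + C v * (S * W + W * S)) :=
    mk_densLin D u v h k
  -- The time part of the Lax pair gives a second Riccati equation, for the time derivative of `W`.
  -- Multiplied by `X ^ 3`, its coefficients `α`, `1 + 2β'`, `γ` are polynomials in `X`, and `Y` is
  -- its right-hand side. The claim will be `Y = X ^ 3 * S`.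
  set α : A⟦X⟧ := -(C u * X) - C (D u) * X ^ 2 -
    (C (D (D u)) + 2 * (C u * C u * C v)) * X ^ 3 with hα
  set β' : A⟦X⟧ := C u * C v * X ^ 2 + (C v * C (D u) - C u * C (D v)) * X ^ 3 with hβ
  set γ : A⟦X⟧ := -(C v * X) + C (D v) * X ^ 2 -
    (C (D (D v)) + 2 * (C u * C v * C v)) * X ^ 3 with hγ
  set Y := α + (1 + 2 * β') * W + γ * (W * W) with hY
  have dα : coeffDeriv D α = -(C (D u) * X) - C (D (D u)) * X ^ 2 -
      (C (D (D (D u))) + 2 * (2 * C (D u) * C u * C v + C u * C u * C (D v))) * X ^ 3 := by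
    simp only [hα, map_sub, map_neg, map_add, Derivation.leibniz, Derivation.leibniz_pow,
      coeffDeriv_C, coeffDeriv_X, smul_eq_mul, smul_zero, mul_zero, zero_add, two_mul]
    ring
  have dβ : coeffDeriv D β' = (C (D u) * C v + C u * C (D v)) * X ^ 2 +
      (C v * C (D (D u)) - C u * C (D (D v))) * X ^ 3 := by
    simp only [hβ, map_sub, map_add, Derivation.leibniz, Derivation.leibniz_pow,
      coeffDeriv_C, coeffDeriv_X, smul_eq_mul, smul_zero, mul_zero, zero_add]
    ring
  have dγ : coeffDeriv D γ = -(C (D v) * X) + C (D (D v)) * X ^ 2 -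
      (C (D (D (D v))) + 2 * (C (D u) * C v * C v + 2 * C u * C v * C (D v))) * X ^ 3 := by
    simp only [hγ, map_sub, map_neg, map_add, Derivation.leibniz, Derivation.leibniz_pow,
      coeffDeriv_C, coeffDeriv_X, smul_eq_mul, smul_zero, mul_zero, zero_add, two_mul]
    ring
  have dY : coeffDeriv D Y = coeffDeriv D α + (1 + 2 * β') * coeffDeriv D W +
      2 * coeffDeriv D β' * W + γ * (2 * W * coeffDeriv D W) + coeffDeriv D γ * (W * W) := by
    have h1 : coeffDeriv D (1 : A⟦X⟧) = 0 := Derivation.map_one_eq_zero _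
    simp only [hY, map_add, Derivation.leibniz, smul_eq_mul, h1, two_mul, zero_add]
    ring
  have Ch : (C h : A⟦X⟧) = C (D (D (D u))) + 6 * (C u * C v * C (D u)) := by
    simp [hh, map_ofNat]
  have Ck : (C k : A⟦X⟧) = C (D (D (D v))) + 6 * (C u * C v * C (D v)) := by
    simp [hk, map_ofNat]
  have eY : Y = X * coeffDeriv D Y + X * (X ^ 3 * C h + X ^ 3 * C k * (W * W) +
      2 * C v * W * Y) := by
    rw [dY, dα, dβ, dγ, Ch, Ck]
    have := eW
    simp only [hY, hα, hβ, hγ]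
    linear_combination ((1 + 2 * β') + 2 * γ * W) * eW
  -- By `eY`, `Y` solves the same linear equation as `X ^ 3 * S`, so the difference solves the
  -- homogeneous one.
  have hZ : Y - X ^ 3 * S = 0 := by
    apply eq_zero_of_eq_X_mul D _ (2 * C v * W)
    have h3 : coeffDeriv D (X ^ 3 * S) = X ^ 3 * coeffDeriv D S := by
      simp [Derivation.leibniz_pow, coeffDeriv_X]
    rw [map_sub, h3]
    linear_combination eY - X ^ 3 * eS
  -- With `S` known, the rate of `v W` is the derivative of an explicit current. The extra factor
  -- `X` in `h4` allows the Riccati equation `eW` to eliminate the derivative of `W`.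
  have fin : X ^ 3 * (C k * W + C v * S) = coeffDeriv D (-(γ * W + β')) := by
    have h4 : X * (X ^ 3 * (C k * W + C v * S)) = X * coeffDeriv D (-(γ * W + β')) := by
      simp only [map_neg, map_add, Derivation.leibniz, smul_eq_mul, dβ, dγ, Ck]
      simp only [hY, hα, hβ, hγ] at hZ ⊢
      linear_combination (-X * C v) * hZ - γ * eW
    exact PowerSeries.X_mul_cancel h4
  -- The shift by `3` undoes the factor `X ^ 3`.
  refine ⟨coeff (m + 3) (-(γ * W + β')), ?_⟩
  rw [← coeff_coeffDeriv, ← fin, mul_comm (X ^ 3), coeff_mul_X_pow, map_add, coeff_C_mul,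
    coeff_C_mul, hW, hS, coeff_mk, coeff_mk]

end Hierarchy

/-! ### Trigonometric polynomials as Laurent polynomials, and their evaluation as functions. -/

section TrigPoly

/-- The index set need only contain the support of the left factor, so several products can be
compared over a common set. -/
lemma coeff_mul_eq_sum {R : Type*} [Semiring R] (f g : AddMonoidAlgebra R ℤ) (S : Finset ℤ)
    (hS : ∀ j, f.coeff j ≠ 0 → j ∈ S) (k : ℤ) :
    (f * g).coeff k = ∑ j ∈ S, f.coeff j * g.coeff (k - j) := by
  rw [AddMonoidAlgebra.coeff_mul_apply_left, Finsupp.sum]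
  refine (Finset.sum_subset (fun j hj => hS j (Finsupp.mem_support_iff.1 hj)) ?_).trans ?_
  · intro j _ hj
    rw [Finsupp.notMem_support_iff.1 hj, zero_mul]
  · refine Finset.sum_congr rfl fun j _ => ?_
    rw [neg_add_eq_sub]

/-- Trigonometric polynomials `∑ f_k e^{ikx}`. -/
abbrev TrigPoly := AddMonoidAlgebra ℂ ℤ

namespace TrigPoly

/-- The Fourier multiplier with symbol `m`. -/
def mult (m : ℤ → ℂ) : TrigPoly →ₗ[ℂ] TrigPoly where
  toFun f := .ofCoeff (Finsupp.onFinset f.coeff.support (fun k => m k * f.coeff k)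
    fun k hk => Finsupp.mem_support_iff.2 (right_ne_zero_of_mul hk))
  map_add' f g := by ext k; simp [mul_add]
  map_smul' c f := by ext k; simp [mul_left_comm]

@[simp] lemma coeff_mult (m : ℤ → ℂ) (f : TrigPoly) (k : ℤ) :
    (mult m f).coeff k = m k * f.coeff k := rfl

/-- The derivation `-i∂_x`. -/
def D : Derivation ℂ TrigPoly TrigPoly :=
  Derivation.mk' (mult fun k => k) fun f g => by
    ext k
    simp only [smul_eq_mul, AddMonoidAlgebra.coeff_add, Finsupp.add_apply, coeff_mult]
    rw [mul_comm g, coeff_mul_eq_sum f g f.coeff.support fun j hj => Finsupp.mem_support_iff.2 hj,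
      coeff_mul_eq_sum f _ f.coeff.support fun j hj => Finsupp.mem_support_iff.2 hj,
      coeff_mul_eq_sum _ g f.coeff.support fun j hj => Finsupp.mem_support_iff.2
        (right_ne_zero_of_mul hj), ← Finset.sum_add_distrib, Finset.mul_sum]
    refine Finset.sum_congr rfl fun j _ => ?_
    simp only [coeff_mult]
    push_cast
    ring

@[simp] lemma coeff_D (f : TrigPoly) (k : ℤ) : (D f).coeff k = k * f.coeff k := rfl

/-- Complex conjugation of trigonometric polynomials. -/
def cj : TrigPoly →+* TrigPoly :=
  (AddMonoidAlgebra.mapRingHom ℤ (starRingEnd ℂ)).comp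
    (AddMonoidAlgebra.mapDomainRingHom ℂ (negAddMonoidHom : ℤ →+ ℤ))

lemma cj_single (k : ℤ) (a : ℂ) :
    cj (AddMonoidAlgebra.single k a) = AddMonoidAlgebra.single (-k) (starRingEnd ℂ a) := by
  simp [cj, -LaurentPolynomial.single_eq_C_mul_T]

@[simp] lemma coeff_cj (f : TrigPoly) (k : ℤ) :
    (cj f).coeff k = starRingEnd ℂ (f.coeff (-k)) := by
  induction f using AddMonoidAlgebra.induction_linear with
  | zero => simp
  | add f g hf hg => simp [hf, hg]
  | single j a =>
    rw [cj_single]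
    simp only [AddMonoidAlgebra.coeff_single, Finsupp.single_apply, neg_eq_iff_eq_neg]
    split_ifs <;> simp

lemma cj_D (f : TrigPoly) : cj (D f) = -D (cj f) := by
  ext k; simp

lemma cj_smul (c : ℂ) (f : TrigPoly) : cj (c • f) = starRingEnd ℂ c • cj f := by
  ext k; simp

lemma cj_cj (f : TrigPoly) : cj (cj f) = f := by
  ext k; simp

/-- The function `x ↦ ∑ f_k e^{ikx}`. -/
def ev : TrigPoly →ₐ[ℂ] (ℝ → ℂ) :=
  AddMonoidAlgebra.lift ℂ (ℝ → ℂ) ℤ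
    { toFun := fun m x => Complex.exp (Complex.I * (m.toAdd : ℤ) * x)
      map_one' := by ext x; simp
      map_mul' := fun a b => by
        ext x
        simp only [toAdd_mul, Int.cast_add, Pi.mul_apply, ← Complex.exp_add]
        ring_nf }

lemma ev_single (k : ℤ) (a : ℂ) (x : ℝ) :
    ev (AddMonoidAlgebra.single k a) x = a * Complex.exp (Complex.I * k * x) := by
  rw [ev, AddMonoidAlgebra.lift_single]
  rfl

lemma hasDerivAt_ev (f : TrigPoly) (x : ℝ) : HasDerivAt (ev f) (ev (Complex.I • D f) x) x := by
  induction f using AddMonoidAlgebra.induction_linear with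
  | zero => simp [hasDerivAt_zero]
  | add f g hf hg =>
    rw [map_add, map_add, smul_add, map_add]
    exact hf.add hg
  | single k a =>
    have h1 : D (AddMonoidAlgebra.single k a) = AddMonoidAlgebra.single k (k * a) := by
      ext j
      simp only [coeff_D, AddMonoidAlgebra.coeff_single, Finsupp.single_apply]
      split_ifs with h
      · rw [h]
      · simp
    have h2 : ev (AddMonoidAlgebra.single k a) = fun x : ℝ => a * Complex.exp (Complex.I * k * x) :=
      funext (ev_single k a)
    rw [h1, AddMonoidAlgebra.smul_single, ev_single, h2]
    have h3 : HasDerivAt (fun x : ℝ => Complex.I * k * (x : ℂ)) (Complex.I * k * 1) x :=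
      (Complex.ofRealCLM.hasDerivAt (x := x)).const_mul _
    refine (h3.cexp.const_mul a).congr_deriv ?_
    rw [smul_eq_mul]
    ring

lemma deriv_ev (f : TrigPoly) : deriv (ev f) = ev (Complex.I • D f) :=
  funext fun x => (hasDerivAt_ev f x).deriv

lemma continuous_ev (f : TrigPoly) : Continuous (ev f) :=
  continuous_iff_continuousAt.2 fun x => (hasDerivAt_ev f x).continuousAt

lemma conj_ev (f : TrigPoly) (x : ℝ) : starRingEnd ℂ (ev f x) = ev (cj f) x := by
  induction f using AddMonoidAlgebra.induction_linear with
  | zero => simp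
  | add f g hf hg => simp [hf, hg]
  | single k a =>
    rw [cj_single, ev_single, ev_single, map_mul, ← Complex.exp_conj]
    simp

lemma integral_ev (f : TrigPoly) :
    ∫ x in (0 : ℝ)..2 * Real.pi, ev f x = 2 * Real.pi * f.coeff 0 := by
  induction f using AddMonoidAlgebra.induction_linear with
  | zero => simp
  | add f g hf hg =>
    simp only [map_add, Pi.add_apply, AddMonoidAlgebra.coeff_add, Finsupp.add_apply]
    rw [intervalIntegral.integral_add ((continuous_ev f).intervalIntegrable _ _)
      ((continuous_ev g).intervalIntegrable _ _), hf, hg]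
    ring
  | single k a =>
    simp only [ev_single, AddMonoidAlgebra.coeff_single, Finsupp.single_apply]
    split_ifs with hk
    · subst hk
      simp
    · rw [intervalIntegral.integral_const_mul, integral_exp_mul_complex]
      · have : Complex.exp (Complex.I * k * ((2 * Real.pi : ℝ) : ℂ)) = 1 := by
          rw [Complex.exp_eq_one_iff]
          exact ⟨k, by push_cast; ring⟩
        rw [this]
        simp
      · simpa using hk

lemma fourierCoef_ev (f : TrigPoly) (k : ℤ) : fourierCoef (ev f) k = f.coeff k := by
  have h1 : ∀ x : ℝ, ev f x * Complex.exp (-(Complex.I * k * x)) =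
      ev (f * AddMonoidAlgebra.single (-k) 1) x := by
    intro x
    rw [map_mul, Pi.mul_apply, ev_single]
    push_cast
    simp
  have h2 : (f * AddMonoidAlgebra.single (-k) 1).coeff 0 = f.coeff k := by
    rw [AddMonoidAlgebra.coeff_mul_single_apply]
    simp
  have h3 : (2 * Real.pi : ℂ) ≠ 0 := by
    simp [Real.pi_ne_zero]
  simp only [fourierCoef, h1, integral_ev, h2]
  field_simp

/-- The trigonometric polynomial `∑_{|k| ≤ N} u_k e^{ikx}`. -/
def trunc (N : ℕ) (u : ℤ → ℂ) : TrigPoly :=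
  ∑ k ∈ Finset.Icc (-(N : ℤ)) N, AddMonoidAlgebra.single k (u k)

lemma coeff_trunc (N : ℕ) (u : ℤ → ℂ) (k : ℤ) :
    (trunc N u).coeff k = if |k| ≤ (N : ℤ) then u k else 0 := by
  simp only [trunc, AddMonoidAlgebra.coeff_sum, Finsupp.finsetSum_apply,
    AddMonoidAlgebra.coeff_single, Finsupp.single_apply, Finset.sum_ite_eq', Finset.mem_Icc, abs_le]

lemma proj_eq_ev (N : ℕ) (u : ℤ → ℂ) : proj N u = ev (trunc N u) := by
  ext x
  simp only [proj, trunc, map_sum, Finset.sum_apply, ev_single]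

/-- Since `∂_x` becomes `i D` on coefficients, `-i∂_x` becomes `D`. From here on the analytic
densities can be handled purely algebraically. -/
lemma w_ev (f : TrigPoly) (m : ℕ) : w (ev f) m = ev (dens D f (cj f) m) := by
  induction m using Nat.strong_induction_on with
  | _ m ih =>
    match m with
    | 0 => rw [w, dens_zero, map_zero]
    | 1 => rw [w, dens_one]
    | n + 2 =>
      rw [w, dens_add_two]
      ext x
      rw [ih (n + 1) (by omega), deriv_ev, conj_ev]
      simp only [map_add, map_mul, map_sum, map_smul, Pi.add_apply, Pi.mul_apply, Finset.sum_apply,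
        Pi.smul_apply, smul_eq_mul]
      congr 1
      · rw [← mul_assoc, neg_mul, Complex.I_mul_I, neg_neg, one_mul]
      · congr 1
        refine Finset.sum_congr rfl fun k _ => ?_
        rw [ih (k + 1) (by omega), ih (n - k) (by omega)]

/-- The conservation law `E_m` of a trigonometric polynomial. -/
def energy (m : ℕ) (f : TrigPoly) : ℝ :=
  2 * Real.pi * ((cj f * dens D f (cj f) m).coeff 0).re

lemma E_ev (m : ℕ) (f : TrigPoly) : E m (ev f) = energy m f := by
  have : ∀ x, (starRingEnd ℂ) (ev f x) * w (ev f) m x = ev (cj f * dens D f (cj f) m) x := by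
    intro x
    rw [conj_ev, w_ev, map_mul, Pi.mul_apply]
  simp only [E, this, integral_ev, energy]
  rw [← Complex.ofReal_ofNat, ← Complex.ofReal_mul, Complex.re_ofReal_mul]

lemma iteratedDeriv_ev (f : TrigPoly) (n : ℕ) :
    iteratedDeriv n (ev f) = ev (mult (fun k => (Complex.I * k) ^ n) f) := by
  induction n with
  | zero =>
    rw [iteratedDeriv_zero]
    congr 1
    ext k
    simp
  | succ n ih =>
    rw [iteratedDeriv_succ, ih, deriv_ev]
    congr 1
    ext k
    simp
    ring

/-- Parseval's identity for the pairing of `f` and `g`. -/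
lemma coeff_zero_cj_mul (f g : TrigPoly) (S : Finset ℤ) (hS : ∀ j, f.coeff j ≠ 0 → j ∈ S) :
    (cj f * g).coeff 0 = ∑ k ∈ S, starRingEnd ℂ (f.coeff k) * g.coeff k := by
  rw [coeff_mul_eq_sum (cj f) g (S.map (Equiv.neg ℤ).toEmbedding)]
  · simp
  · intro j hj
    simp only [coeff_cj, ne_eq, map_eq_zero] at hj
    simpa using hS _ hj

lemma integral_norm_sq_ev (f : TrigPoly) (S : Finset ℤ) (hS : ∀ j, f.coeff j ≠ 0 → j ∈ S) :
    ∫ x in (0 : ℝ)..2 * Real.pi, ‖ev f x‖ ^ 2 = 2 * Real.pi * ∑ k ∈ S, ‖f.coeff k‖ ^ 2 := by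
  have h1 : ∀ x, ((‖ev f x‖ ^ 2 : ℝ) : ℂ) = ev (cj f * f) x := by
    intro x
    rw [map_mul, Pi.mul_apply, ← conj_ev, Complex.conj_mul', Complex.ofReal_pow]
  have h2 : ((∫ x in (0 : ℝ)..2 * Real.pi, ‖ev f x‖ ^ 2 : ℝ) : ℂ) =
      ((2 * Real.pi * ∑ k ∈ S, ‖f.coeff k‖ ^ 2 : ℝ) : ℂ) := by
    rw [← intervalIntegral.integral_ofReal]
    simp only [h1, integral_ev]
    rw [coeff_zero_cj_mul f f S hS]
    push_cast
    congr 1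
    exact Finset.sum_congr rfl fun k _ => Complex.conj_mul' _
  exact_mod_cast h2

lemma integral_norm_iteratedDeriv_sq_ev (f : TrigPoly) (n : ℕ) (S : Finset ℤ)
    (hS : ∀ j, f.coeff j ≠ 0 → j ∈ S) :
    ∫ x in (0 : ℝ)..2 * Real.pi, ‖iteratedDeriv n (ev f) x‖ ^ 2 =
      2 * Real.pi * ∑ k ∈ S, (k : ℝ) ^ (2 * n) * ‖f.coeff k‖ ^ 2 := by
  rw [iteratedDeriv_ev, integral_norm_sq_ev _ S]
  · congr 1
    refine Finset.sum_congr rfl fun k _ => ?_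
    simp only [coeff_mult, norm_mul, norm_pow, Complex.norm_I, Complex.norm_intCast,
      mul_pow, ← pow_mul, mul_comm n 2]
    rw [one_pow, one_mul, Even.pow_abs ⟨n, by ring⟩]
  · intro j hj
    exact hS j (right_ne_zero_of_mul hj)

/-- The nonlinearity `|f|² (-i∂_x) f`. -/
def nonlin (f : TrigPoly) : TrigPoly := f * cj f * D f

lemma fourierCoef_nonlin (N : ℕ) (u : ℤ → ℂ) (k : ℤ) :
    fourierCoef (fun x => ((‖proj N u x‖ ^ 2 : ℝ) : ℂ) * deriv (proj N u) x) k =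
      Complex.I * (nonlin (trunc N u)).coeff k := by
  have : (fun x => ((‖proj N u x‖ ^ 2 : ℝ) : ℂ) * deriv (proj N u) x) =
      ev (Complex.I • nonlin (trunc N u)) := by
    ext x
    rw [proj_eq_ev, deriv_ev, nonlin]
    simp only [map_smul, map_mul, Pi.smul_apply, Pi.mul_apply, smul_eq_mul]
    rw [← conj_ev, Complex.mul_conj', Complex.ofReal_pow]
    ring
  rw [this, fourierCoef_ev]
  simp

end TrigPoly

end TrigPoly

/-! ### Coefficientwise majorants and the count of derivatives. -/

section Majorants

/-- Finitely supported nonnegative sequences with the convolution product, ordered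
coefficientwise. They serve as majorants of the Fourier coefficients of trigonometric
polynomials. -/
abbrev Maj := AddMonoidAlgebra NNReal ℤ

namespace Maj

instance : PartialOrder Maj :=
  PartialOrder.lift (fun F => F.coeff) fun _ _ h => AddMonoidAlgebra.coeff_injective h

lemma le_def {F G : Maj} : F ≤ G ↔ ∀ k, F.coeff k ≤ G.coeff k := Iff.rfl

lemma mul_coeff (F G : Maj) (k : ℤ) :
    (F * G).coeff k = ∑ j ∈ F.coeff.support, F.coeff j * G.coeff (k - j) :=
  coeff_mul_eq_sum F G _ (fun _ hj => Finsupp.mem_support_iff.2 hj) k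

instance : CanonicallyOrderedAdd Maj where
  exists_add_of_le {F G} h := by
    obtain ⟨c, hc⟩ := exists_add_of_le (show F.coeff ≤ G.coeff from h)
    exact ⟨.ofCoeff c, AddMonoidAlgebra.coeff_injective hc⟩
  le_self_add F G := le_def.2 fun k => by simp
  le_add_self F G := le_def.2 fun k => by simp

instance : IsOrderedRing Maj where
  add_le_add_left F G h H := le_def.2 fun k => by
    simpa using le_def.1 h k
  zero_le_one := le_def.2 fun k => by simp
  mul_le_mul_of_nonneg_left H _ F G h := le_def.2 fun k => by
    simp only [mul_coeff]
    exact Finset.sum_le_sum fun j _ => mul_le_mul_right (le_def.1 h _) _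
  mul_le_mul_of_nonneg_right H _ F G h := le_def.2 fun k => by
    simp only [mul_comm _ H, mul_coeff]
    exact Finset.sum_le_sum fun j _ => mul_le_mul_right (le_def.1 h _) _

lemma natCast_mul_coeff (n : ℕ) (F : Maj) (k : ℤ) :
    ((n : Maj) * F).coeff k = n * F.coeff k := by
  rw [← nsmul_eq_mul, AddMonoidAlgebra.coeff_smul, Finsupp.smul_apply, nsmul_eq_mul]

lemma one_coeff (k : ℤ) : (1 : Maj).coeff k = if k = 0 then 1 else 0 := by
  rw [AddMonoidAlgebra.one_def, AddMonoidAlgebra.coeff_single, Finsupp.single_apply]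
  simp [eq_comm]

/-- The weight `⟨k⟩ = 1 + |k|`. -/
def wt (k : ℤ) : NNReal := 1 + k.natAbs

lemma one_le_wt (k : ℤ) : 1 ≤ wt k := by simp [wt]

lemma wt_neg (k : ℤ) : wt (-k) = wt k := by simp [wt]

lemma wt_add_le (j k : ℤ) : wt (j + k) ≤ wt j + wt k := by
  have : ((j + k).natAbs : NNReal) ≤ j.natAbs + k.natAbs := by exact_mod_cast Int.natAbs_add_le j k
  calc wt (j + k) ≤ 1 + (j.natAbs + k.natAbs) := by unfold wt; gcongr
    _ ≤ wt j + wt k := by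
      unfold wt
      rw [add_assoc]
      gcongr
      exact le_add_self

/-- Multiplication by `⟨k⟩^p`. -/
def T (p : ℕ) : Maj →+ Maj where
  toFun F := .ofCoeff (Finsupp.onFinset F.coeff.support (fun k => wt k ^ p * F.coeff k)
    fun k hk => Finsupp.mem_support_iff.2 (right_ne_zero_of_mul hk))
  map_zero' := by ext k; simp
  map_add' F G := by ext k; simp [mul_add]

@[simp] lemma T_coeff (p : ℕ) (F : Maj) (k : ℤ) : (T p F).coeff k = wt k ^ p * F.coeff k := rfl

lemma T_mono (p : ℕ) {F G : Maj} (h : F ≤ G) : T p F ≤ T p G := le_def.2 fun k => by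
  simp only [T_coeff]
  exact mul_le_mul_right (le_def.1 h k) _

lemma T_natCast_mul (p n : ℕ) (F : Maj) : T p (n * F) = n * T p F := by
  rw [← nsmul_eq_mul, map_nsmul, nsmul_eq_mul]

lemma T_T (p q : ℕ) (F : Maj) : T p (T q F) = T (p + q) F := by
  ext k; simp [pow_add, mul_assoc]

lemma T_zero (F : Maj) : T 0 F = F := by
  ext k; simp

lemma T_le_T {p q : ℕ} (h : p ≤ q) (F : Maj) : T p F ≤ T q F := le_def.2 fun k => by
  simp only [T_coeff]
  exact mul_le_mul_left (pow_le_pow_right₀ (one_le_wt k) h) _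

lemma mul_coeff' (F G : Maj) (S : Finset ℤ) (hS : ∀ j, F.coeff j ≠ 0 → j ∈ S) (k : ℤ) :
    (F * G).coeff k = ∑ j ∈ S, F.coeff j * G.coeff (k - j) := coeff_mul_eq_sum F G S hS k

/-- A Leibniz rule, from `⟨k⟩ ≤ ⟨j⟩ + ⟨k - j⟩ ≤ 2 max(⟨j⟩, ⟨k - j⟩)`. -/
lemma T_mul_le (p : ℕ) (F G : Maj) : T p (F * G) ≤ (2 ^ p : ℕ) * (T p F * G + F * T p G) :=
  le_def.2 fun k => by
  have hF : ∀ j, F.coeff j ≠ 0 → j ∈ F.coeff.support := fun _ hj => Finsupp.mem_support_iff.2 hj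
  rw [T_coeff, natCast_mul_coeff, AddMonoidAlgebra.coeff_add, Finsupp.add_apply,
    mul_coeff' F G _ hF, mul_coeff' F _ _ hF, mul_coeff' (T p F) G F.coeff.support fun j hj =>
      hF j (right_ne_zero_of_mul hj), ← Finset.sum_add_distrib, Finset.mul_sum, Finset.mul_sum]
  refine Finset.sum_le_sum fun j _ => ?_
  have h1 : wt k ^ p ≤ 2 ^ p * (wt j ^ p + wt (k - j) ^ p) := by
    have h2 : wt k ≤ wt j + wt (k - j) := by simpa using wt_add_le j (k - j)
    calc wt k ^ p ≤ (wt j + wt (k - j)) ^ p := by gcongr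
      _ ≤ (2 * max (wt j) (wt (k - j))) ^ p := by
        rw [two_mul]; gcongr <;> simp
      _ ≤ _ := by
        rw [mul_pow]
        gcongr
        rcases le_total (wt j) (wt (k - j)) with h | h
        · rw [max_eq_right h]; exact le_add_self
        · rw [max_eq_left h]; exact le_self_add
  calc wt k ^ p * (F.coeff j * G.coeff (k - j))
      ≤ 2 ^ p * (wt j ^ p + wt (k - j) ^ p) * (F.coeff j * G.coeff (k - j)) := by gcongr
    _ = _ := by simp only [T_coeff]; push_cast; ring

/-- The factor with the larger frequency can absorb all the weights. Both factors being the same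
`F`, the two cases give the same product, and all derivatives may be placed on a single factor. -/
lemma T_mul_T_le (p q : ℕ) (F : Maj) : T p F * T q F ≤ 2 * (T (p + q) F * F) :=
  le_def.2 fun k => by
  have hF : ∀ r, ∀ j, (T r F).coeff j ≠ 0 → j ∈ F.coeff.support := fun _ j hj =>
    Finsupp.mem_support_iff.2 (right_ne_zero_of_mul hj)
  have e : (2 : Maj) * (T (p + q) F * F) = T (p + q) F * F + T 0 F * T (p + q) F := by
    rw [T_zero]; ring
  rw [e, AddMonoidAlgebra.coeff_add, Finsupp.add_apply, mul_coeff' _ _ _ (hF p),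
    mul_coeff' _ _ _ (hF (p + q)), mul_coeff' _ _ _ (hF 0), ← Finset.sum_add_distrib]
  refine Finset.sum_le_sum fun j _ => ?_
  simp only [T_coeff, pow_zero, one_mul]
  have h1 : wt j ^ p * wt (k - j) ^ q ≤ wt j ^ (p + q) + wt (k - j) ^ (p + q) := by
    rcases le_total (wt j) (wt (k - j)) with h | h
    · refine le_trans ?_ le_add_self
      rw [pow_add]
      gcongr
    · refine le_trans ?_ le_self_add
      rw [pow_add]
      gcongr
  calc wt j ^ p * F.coeff j * (wt (k - j) ^ q * F.coeff (k - j))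
      = wt j ^ p * wt (k - j) ^ q * (F.coeff j * F.coeff (k - j)) := by ring
    _ ≤ (wt j ^ (p + q) + wt (k - j) ^ (p + q)) * (F.coeff j * F.coeff (k - j)) := by gcongr
    _ = _ := by ring

section Semiring

variable {S : Type*} [CommSemiring S] [PartialOrder S] [IsOrderedRing S] [CanonicallyOrderedAdd S]

lemma mul_mul_le_of_mul_le {a x y z : S} (ha : 1 ≤ a) (h : x * y ≤ 2 * (z * a)) (c d : S)
    {p q r : ℕ} (hr : p + q + 2 ≤ r) :
    a * (c * (x * a ^ p) * (d * (y * a ^ q))) ≤ c * d * 2 * (z * a ^ r) :=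
  calc a * (c * (x * a ^ p) * (d * (y * a ^ q))) = c * d * (x * y) * a ^ (p + q + 1) := by ring
    _ ≤ c * d * (2 * (z * a)) * a ^ (p + q + 1) := by gcongr
    _ = c * d * 2 * (z * a ^ (p + q + 2)) := by ring
    _ ≤ c * d * 2 * (z * a ^ r) := by gcongr

lemma mul_le_of_le_mul_pow {a x y c₁ : S} (ha : 1 ≤ a) (c : S) {p q : ℕ}
    (h : x ≤ c₁ * (y * a ^ p)) (hpq : p ≤ q) : c * x ≤ c * c₁ * (y * a ^ q) :=
  calc c * x ≤ c * (c₁ * (y * a ^ p)) := by gcongr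
    _ ≤ c * (c₁ * (y * a ^ q)) := by gcongr
    _ = _ := by ring

end Semiring

lemma one_le_pow' {a : Maj} (ha : 1 ≤ a) (m : ℕ) : 1 ≤ a ^ m := one_le_pow₀ ha

lemma pow_le_pow' {a : Maj} (ha : 1 ≤ a) {m n : ℕ} (h : m ≤ n) : a ^ m ≤ a ^ n :=
  pow_le_pow_right₀ ha h

lemma T_pow_le (q m : ℕ) : ∃ C : ℕ, ∀ a : Maj, 1 ≤ a → T q (a ^ m) ≤ C * (T q a * a ^ m) := by
  induction m with
  | zero =>
    refine ⟨1, fun a ha => ?_⟩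
    simpa using T_mono q ha
  | succ m ih =>
    obtain ⟨C, hC⟩ := ih
    refine ⟨2 ^ q * (C + 1), fun a ha => ?_⟩
    calc T q (a ^ (m + 1)) = T q (a ^ m * a) := by rw [pow_succ]
      _ ≤ (2 ^ q : ℕ) * (T q (a ^ m) * a + a ^ m * T q a) := T_mul_le _ _ _
      _ ≤ (2 ^ q : ℕ) * (C * (T q a * a ^ m) * a + a ^ (m + 1) * T q a) := by
        gcongr
        · exact hC a ha
        · exact Nat.le_succ m
      _ = _ := by push_cast; ring

/-- The form "one differentiated factor times a power of `a`" is stable under further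
differentiation, which drives the inductions on the densities below. -/
lemma T_T_mul_pow_le (q p m : ℕ) : ∃ C : ℕ, ∀ a : Maj, 1 ≤ a →
    T q (T p a * a ^ m) ≤ C * (T (q + p) a * a ^ (m + 1)) := by
  obtain ⟨C, hC⟩ := T_pow_le q m
  refine ⟨2 ^ q * (1 + 2 * C), fun a ha => ?_⟩
  calc T q (T p a * a ^ m) ≤ (2 ^ q : ℕ) * (T q (T p a) * a ^ m + T p a * T q (a ^ m)) :=
        T_mul_le _ _ _
    _ ≤ (2 ^ q : ℕ) * (T (q + p) a * a ^ (m + 1) + C * (T q a * T p a) * a ^ m) := by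
      rw [T_T]
      have : T p a * T q (a ^ m) ≤ C * (T q a * T p a) * a ^ m := by
        calc T p a * T q (a ^ m) ≤ T p a * (C * (T q a * a ^ m)) := by gcongr; exact hC a ha
          _ = _ := by ring
      gcongr
      exact Nat.le_succ m
    _ ≤ (2 ^ q : ℕ) * (T (q + p) a * a ^ (m + 1) + C * (2 * (T (q + p) a * a)) * a ^ m) := by
      gcongr (2 ^ q : ℕ) * (_ + _ * ?_ * _)
      exact T_mul_T_le q p a
    _ = _ := by push_cast; ring

end Maj

open Maj TrigPoly

/-- `F` majorizes the Fourier coefficients of `f`. -/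
def Dom (f : TrigPoly) (F : Maj) : Prop := ∀ k, ‖f.coeff k‖₊ ≤ F.coeff k

namespace Dom

lemma mono {f : TrigPoly} {F G : Maj} (h : Dom f F) (hFG : F ≤ G) : Dom f G :=
  fun k => (h k).trans (le_def.1 hFG k)

lemma zero (F : Maj) : Dom 0 F := fun k => by simp

lemma add {f g : TrigPoly} {F G : Maj} (hf : Dom f F) (hg : Dom g G) : Dom (f + g) (F + G) :=
  fun k => by
    simp only [AddMonoidAlgebra.coeff_add, Finsupp.add_apply]
    exact (nnnorm_add_le _ _).trans (add_le_add (hf k) (hg k))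

lemma neg {f : TrigPoly} {F : Maj} (hf : Dom f F) : Dom (-f) F := fun k => by
  simpa using hf k

lemma mul {f g : TrigPoly} {F G : Maj} (hf : Dom f F) (hg : Dom g G) : Dom (f * g) (F * G) :=
  fun k => by
    have h1 : ∀ j, f.coeff j ≠ 0 → j ∈ F.coeff.support := by
      intro j hj
      rw [Finsupp.mem_support_iff]
      intro h0
      have := hf j
      rw [h0] at this
      exact hj (by simpa using this)
    rw [coeff_mul_eq_sum f g _ h1, mul_coeff]
    refine (nnnorm_sum_le _ _).trans (Finset.sum_le_sum fun j _ => ?_)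
    rw [nnnorm_mul]
    gcongr
    · exact hf j
    · exact hg _

lemma sum {ι : Type*} {s : Finset ι} {f : ι → TrigPoly} {F : ι → Maj}
    (h : ∀ i ∈ s, Dom (f i) (F i)) : Dom (∑ i ∈ s, f i) (∑ i ∈ s, F i) := by
  classical
  induction s using Finset.induction_on with
  | empty => simpa using zero 0
  | insert i s hi ih =>
    rw [Finset.sum_insert hi, Finset.sum_insert hi]
    exact (h i (Finset.mem_insert_self i s)).add
      (ih fun j hj => h j (Finset.mem_insert_of_mem hj))

lemma D {f : TrigPoly} {F : Maj} (hf : Dom f F) : Dom (D f) (T 1 F) := fun k => by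
  simp only [coeff_D, T_coeff, nnnorm_mul, pow_one]
  gcongr
  · simp only [wt]
    have : ‖(k : ℂ)‖₊ = k.natAbs := by
      ext
      simp [Nat.cast_natAbs, ← Int.norm_eq_abs]
    rw [this]
    exact le_add_self
  · exact hf k

end Dom

/-- The difference between `dens (n + 1)` and its linear part. -/
def densRem (f : TrigPoly) (n : ℕ) : TrigPoly :=
  dens D f (cj f) (n + 1) - mult (fun k => (k : ℂ) ^ n) f

lemma mult_pow_succ (f : TrigPoly) (n : ℕ) :
    mult (fun k => (k : ℂ) ^ (n + 1)) f = D (mult (fun k => (k : ℂ) ^ n) f) := by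
  ext k; simp; ring

lemma densRem_zero (f : TrigPoly) : densRem f 0 = 0 := by
  ext k; simp [densRem, dens_one]

lemma densRem_succ (f : TrigPoly) (n : ℕ) : densRem f (n + 1) = D (densRem f n) +
    cj f * ∑ k : Fin n, dens D f (cj f) (k + 1) * dens D f (cj f) (n - k) := by
  rw [densRem, dens_add_two, mult_pow_succ, densRem, map_sub]
  ring

lemma densRem_one (f : TrigPoly) : densRem f 1 = 0 := by
  rw [densRem_succ, densRem_zero]; simp

lemma densRem_two (f : TrigPoly) : densRem f 2 = cj f * (f * f) := by
  rw [densRem_succ, densRem_one]; simp [dens_one]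

/-- `a` majorizes `f`, its conjugate and the constant `1`. -/
structure Majorizes (a : Maj) (f : TrigPoly) : Prop where
  one_le : 1 ≤ a
  dom : Dom f a
  dom_cj : Dom (cj f) a

lemma dom_cj_mul_sum {f : TrigPoly} {a : Maj} (h : Majorizes a f) (C : ℕ → ℕ) (n : ℕ)
    (hC : ∀ m ≤ n, Dom (dens TrigPoly.D f (cj f) m) (C m * (T (m - 1) a * a ^ (2 * m)))) :
    Dom (cj f * ∑ k : Fin n, dens TrigPoly.D f (cj f) (k + 1) * dens TrigPoly.D f (cj f) (n - k))
      ((∑ k : Fin n, C (k + 1) * C (n - k) * 2 : ℕ) * (T (n - 1) a * a ^ (2 * (n + 2)))) := by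
  have h1 : ∀ k ∈ (Finset.univ : Finset (Fin n)),
      Dom (dens TrigPoly.D f (cj f) (k + 1) * dens TrigPoly.D f (cj f) (n - k))
      ((C (k + 1) * (T (k + 1 - 1) a * a ^ (2 * (k + 1 : ℕ)))) *
        (C (n - k) * (T (n - k - 1) a * a ^ (2 * (n - k))))) := fun k _ =>
    (hC (k + 1) (by omega)).mul (hC (n - k) (by omega))
  refine (h.dom_cj.mul (Dom.sum h1)).mono ?_
  rw [Nat.cast_sum, Finset.mul_sum, Finset.sum_mul]
  refine Finset.sum_le_sum fun k _ => ?_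
  have hk := k.2
  have h3 : T (k + 1 - 1) a * T (n - k - 1) a ≤ 2 * (T (n - 1) a * a) :=
    (T_mul_T_le _ _ _).trans (mul_le_mul_right (mul_le_mul_left (T_le_T (by omega) a) a) 2)
  have := mul_mul_le_of_mul_le h.one_le h3 (C (k + 1) : Maj) (C (n - k) : Maj)
    (p := 2 * (k + 1 : ℕ)) (q := 2 * (n - k)) (r := 2 * (n + 2)) (by omega)
  rw [Nat.cast_mul, Nat.cast_mul]
  exact this

/-- `w_m` contains at most `m - 1` derivatives. Terms of different degrees fit under one power of
`a` because `1 ≤ a`, so the exponent `2m` need not be sharp. -/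
lemma exists_dom_dens (m : ℕ) : ∃ C : ℕ, ∀ (f : TrigPoly) (a : Maj), Majorizes a f →
    Dom (dens D f (cj f) m) (C * (T (m - 1) a * a ^ (2 * m))) := by
  induction m using Nat.strong_induction_on with
  | _ m ih =>
    match m with
    | 0 => exact ⟨0, fun f a _ => by rw [dens_zero]; exact Dom.zero _⟩
    | 1 =>
      refine ⟨1, fun f a h => ?_⟩
      rw [dens_one, Nat.sub_self, T_zero, Nat.cast_one, one_mul]
      exact h.dom.mono (le_mul_of_one_le_right zero_le (one_le_pow' h.one_le _))
    | n + 2 =>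
      choose! C hC using ih
      obtain ⟨C₁, hC₁⟩ := T_T_mul_pow_le 1 n (2 * (n + 1))
      refine ⟨C (n + 1) * C₁ + ∑ k : Fin n, C (k + 1) * C (n - k) * 2, fun f a h => ?_⟩
      rw [dens_add_two, Nat.cast_add, add_mul]
      refine ((hC (n + 1) (by omega) f a h).D.mono ?_).add
        ((dom_cj_mul_sum h C n fun m hm => hC m (by omega) f a h).mono ?_)
      · rw [T_natCast_mul]
        have := mul_le_of_le_mul_pow (q := 2 * (n + 2)) h.one_le (C (n + 1) : Maj)
          (hC₁ a h.one_le) (by omega)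
        rw [Nat.cast_mul, show n + 2 - 1 = 1 + n by omega]
        exact this
      · exact mul_le_mul_right (mul_le_mul_left (T_le_T (by omega) a) _) _

/-- Each quadratic term `ū w_{k+1} w_{n-k}` in the recursion has only `n - 1` derivatives, against
`n + 1` in the linear part of `w_{n+2}`. Removing the linear part thus gains two derivatives. -/
lemma exists_dom_densRem (n : ℕ) : ∃ C : ℕ, ∀ (f : TrigPoly) (a : Maj), Majorizes a f →
    Dom (densRem f n) (C * (T (n - 2) a * a ^ (2 * (n + 1)))) := by
  induction n with
  | zero => exact ⟨0, fun f a _ => by rw [densRem_zero]; exact Dom.zero _⟩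
  | succ n ih =>
    obtain ⟨C₀, hC₀⟩ := ih
    choose C hC using exists_dom_dens
    obtain ⟨C₁, hC₁⟩ := T_T_mul_pow_le 1 (n - 2) (2 * (n + 1))
    refine ⟨C₀ * C₁ + ∑ k : Fin n, C (k + 1) * C (n - k) * 2, fun f a h => ?_⟩
    rw [densRem_succ, Nat.cast_add, add_mul]
    refine Dom.add ?_ (dom_cj_mul_sum h C n fun m _ => hC m f a h)
    rcases Nat.lt_or_ge n 2 with hn | hn
    · have : densRem f n = 0 := by
        interval_cases n
        · exact densRem_zero f
        · exact densRem_one f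
      rw [this, map_zero]
      exact Dom.zero _
    refine (hC₀ f a h).D.mono ?_
    rw [T_natCast_mul]
    have := mul_le_of_le_mul_pow (q := 2 * (n + 1 + 1)) h.one_le (C₀ : Maj)
      (hC₁ a h.one_le) (by omega)
    rw [Nat.cast_mul, show n + 1 - 2 = 1 + (n - 2) by omega]
    exact this

end Majorants

/-! ### Energies control Sobolev norms and the remainder. -/

section EnergyBounds

open Maj TrigPoly

lemma summable_wt_rpow {r : ℝ} (hr : 1 < r) : Summable fun k : ℤ => ((wt k : NNReal) : ℝ) ^ (-r) := by
  refine Summable.of_norm_bounded_eventually (g := fun k : ℤ => |(k : ℝ)| ^ (-r))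
    (Real.summable_abs_int_rpow hr) ?_
  have : ∀ᶠ k : ℤ in Filter.cofinite, k ≠ 0 := by
    rw [Filter.eventually_cofinite]
    simp
  filter_upwards [this] with k hk
  rw [Real.norm_of_nonneg (Real.rpow_nonneg (wt k).coe_nonneg _)]
  have h1 : |(k : ℝ)| ≤ (wt k : ℝ) := by
    simp [wt, Nat.cast_natAbs]
  exact Real.rpow_le_rpow_of_nonpos (by positivity) h1 (by linarith)

/-- Young's inequality `ℓ² * ℓ² ⊂ ℓ^∞`, via `xy ≤ x² + y²`. -/
lemma mul_self_coeff_le (F : Maj) (B : NNReal) (hB : ∀ S : Finset ℤ, ∑ j ∈ S, F.coeff j ^ 2 ≤ B)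
    (k : ℤ) : (F * F).coeff k ≤ 2 * B := by
  have h2 : ∑ j ∈ F.coeff.support, F.coeff (k - j) ^ 2 ≤ B := by
    have := hB (F.coeff.support.map ((Equiv.subLeft k).toEmbedding))
    simpa using this
  calc (F * F).coeff k = ∑ j ∈ F.coeff.support, F.coeff j * F.coeff (k - j) := mul_coeff F F k
    _ ≤ ∑ j ∈ F.coeff.support, (F.coeff j ^ 2 + F.coeff (k - j) ^ 2) := by
      refine Finset.sum_le_sum fun j _ => ?_
      rcases le_total (F.coeff j) (F.coeff (k - j)) with h | h
      · refine le_trans ?_ le_add_self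
        rw [sq]; gcongr
      · refine le_trans ?_ le_self_add
        rw [sq]; gcongr
    _ ≤ B + B := by
      rw [Finset.sum_add_distrib]
      exact add_le_add (hB _) h2
    _ = 2 * B := (two_mul B).symm

/-- Young's inequality `ℓ^∞ * ℓ¹ ⊂ ℓ^∞`, iterated. -/
lemma mul_pow_coeff_le (H a : Maj) (B s : NNReal) (hB : ∀ k, H.coeff k ≤ B)
    (hs : ∀ S : Finset ℤ, ∑ j ∈ S, a.coeff j ≤ s) (m : ℕ) (k : ℤ) :
    (H * a ^ m).coeff k ≤ B * s ^ m := by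
  induction m generalizing k with
  | zero => simpa using hB k
  | succ m ih =>
    rw [pow_succ, ← mul_assoc, mul_comm, mul_coeff]
    calc ∑ j ∈ a.coeff.support, a.coeff j * (H * a ^ m).coeff (k - j)
        ≤ ∑ j ∈ a.coeff.support, a.coeff j * (B * s ^ m) := by
          gcongr
          exact ih _
      _ = (∑ j ∈ a.coeff.support, a.coeff j) * (B * s ^ m) := by rw [Finset.sum_mul]
      _ ≤ s * (B * s ^ m) := by gcongr; exact hs _
      _ = B * s ^ (m + 1) := by ring

/-- Integration by parts: in the zeroth coefficient of a product the two frequencies are opposite,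
and the weight is even. -/
lemma T_mul_coeff_zero (p q : ℕ) (F G : Maj) :
    (T (p + q) F * G).coeff 0 = (T p F * T q G).coeff 0 := by
  have h : ∀ r j, (T r F).coeff j ≠ 0 → j ∈ F.coeff.support := fun _ j hj =>
    Finsupp.mem_support_iff.2 (right_ne_zero_of_mul hj)
  rw [mul_coeff' _ _ _ (h (p + q)), mul_coeff' _ _ _ (h p)]
  refine Finset.sum_congr rfl fun j _ => ?_
  simp only [T_coeff, zero_sub, wt_neg, pow_add]
  ring

/-- The sequence of absolute values of the Fourier coefficients. -/
def absMaj (f : TrigPoly) : Maj :=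
  .ofCoeff (Finsupp.onFinset f.coeff.support (fun k => ‖f.coeff k‖₊)
    fun _ hk => Finsupp.mem_support_iff.2 (nnnorm_ne_zero_iff.1 hk))

@[simp] lemma absMaj_coeff (f : TrigPoly) (k : ℤ) : (absMaj f).coeff k = ‖f.coeff k‖₊ := rfl

/-- The canonical majorant of `f`, its conjugate and `1`. -/
def majorant (f : TrigPoly) : Maj := 1 + absMaj f + absMaj (cj f)

lemma majorizes_majorant (f : TrigPoly) : Majorizes (majorant f) f where
  one_le := by
    rw [majorant, add_assoc]
    exact le_self_add
  dom k := by
    simp only [majorant, AddMonoidAlgebra.coeff_add, Finsupp.add_apply, absMaj_coeff]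
    exact le_add_right le_add_self
  dom_cj k := by
    simp only [majorant, AddMonoidAlgebra.coeff_add, Finsupp.add_apply, absMaj_coeff]
    exact le_add_self

lemma majorant_coeff (f : TrigPoly) (k : ℤ) : (majorant f).coeff k =
    (if k = 0 then 1 else 0) + ‖f.coeff k‖₊ + ‖f.coeff (-k)‖₊ := by
  simp [majorant, one_coeff]

/-- The `H^σ` norm of `f` is at most `√B`. -/
def SobolevLE (σ : ℕ) (f : TrigPoly) (B : NNReal) : Prop :=
  ∀ S : Finset ℤ, ∑ k ∈ S, wt k ^ (2 * σ) * ‖f.coeff k‖₊ ^ 2 ≤ B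

lemma SobolevLE.neg {σ : ℕ} {f : TrigPoly} {B : NNReal} (h : SobolevLE σ f B) (S : Finset ℤ) :
    ∑ k ∈ S, wt k ^ (2 * σ) * ‖f.coeff (-k)‖₊ ^ 2 ≤ B := by
  have := h (S.map (Equiv.neg ℤ).toEmbedding)
  simpa [wt_neg] using this

lemma sum_ite_zero_le (S : Finset ℤ) : ∑ k ∈ S, (if k = 0 then 1 else 0 : NNReal) ≤ 1 := by
  rw [Finset.sum_ite_eq' S 0]
  split_ifs <;> simp

lemma SobolevLE.majorant_sq {σ : ℕ} {f : TrigPoly} {B : NNReal} (h : SobolevLE σ f B)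
    (S : Finset ℤ) : ∑ k ∈ S, (T σ (majorant f)).coeff k ^ 2 ≤ 3 * (1 + B + B) := by
  calc ∑ k ∈ S, (T σ (majorant f)).coeff k ^ 2
      ≤ ∑ k ∈ S, 3 * ((if k = 0 then 1 else 0) + wt k ^ (2 * σ) * ‖f.coeff k‖₊ ^ 2 +
          wt k ^ (2 * σ) * ‖f.coeff (-k)‖₊ ^ 2) := by
        refine Finset.sum_le_sum fun k _ => ?_
        have h1 : (if k = 0 then 1 else 0 : NNReal) =
            wt k ^ (2 * σ) * (if k = 0 then 1 else 0) ^ 2 := by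
          split_ifs with hk
          · subst hk; simp [wt]
          · simp
        rw [h1, T_coeff, majorant_coeff, ← mul_add, ← mul_add, mul_pow, ← pow_mul, mul_comm σ 2,
          mul_left_comm]
        gcongr
        generalize (if k = 0 then 1 else 0 : NNReal) = x
        generalize ‖f.coeff k‖₊ = y
        generalize ‖f.coeff (-k)‖₊ = z
        rw [← NNReal.coe_le_coe]
        push_cast
        nlinarith [sq_nonneg ((x : ℝ) - y), sq_nonneg ((y : ℝ) - z), sq_nonneg ((x : ℝ) - z)]
    _ ≤ _ := by
        rw [← Finset.mul_sum, Finset.sum_add_distrib, Finset.sum_add_distrib]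
        gcongr
        · exact sum_ite_zero_le S
        · exact h S
        · exact h.neg S

/-- `∑_k ⟨k⟩^{-2}`. -/
def zetaTwo : NNReal := ∑' k : ℤ, (wt k ^ 2)⁻¹

lemma sum_le_zetaTwo (S : Finset ℤ) : ∑ k ∈ S, (wt k ^ 2)⁻¹ ≤ zetaTwo := by
  refine Summable.sum_le_tsum S (fun _ _ => zero_le) ?_
  rw [← NNReal.summable_coe]
  have := summable_wt_rpow (r := 2) (by norm_num)
  refine this.congr fun k => ?_
  rw [Real.rpow_neg (wt k).coe_nonneg, NNReal.coe_inv, NNReal.coe_pow]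
  norm_cast

/-- The embedding of `H¹` into absolutely convergent Fourier series, via `x ≤ ⟨k⟩^{-2} + ⟨k⟩² x²`.
-/
lemma SobolevLE.majorant_sum {σ : ℕ} (hσ : 1 ≤ σ) {f : TrigPoly} {B : NNReal}
    (h : SobolevLE σ f B) (S : Finset ℤ) :
    ∑ k ∈ S, (majorant f).coeff k ≤ 1 + (zetaTwo + B) + (zetaTwo + B) := by
  have key : ∀ (k : ℤ) (x : NNReal), x ≤ (wt k ^ 2)⁻¹ + wt k ^ (2 * σ) * x ^ 2 := by
    intro k x
    have h1 : wt k ^ 2 * x ^ 2 ≤ wt k ^ (2 * σ) * x ^ 2 := by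
      gcongr
      · exact one_le_wt k
      · omega
    refine le_trans ?_ (add_le_add le_rfl h1)
    have h0 : wt k ≠ 0 := (zero_lt_one.trans_le (one_le_wt k)).ne'
    rw [← inv_pow, ← mul_pow]
    have h2 : x = (wt k)⁻¹ * (wt k * x) := by
      rw [← mul_assoc, inv_mul_cancel₀ h0, one_mul]
    conv_lhs => rw [h2]
    rcases le_total (wt k)⁻¹ (wt k * x) with h | h
    · refine le_trans ?_ le_add_self
      rw [sq]; gcongr
    · refine le_trans ?_ le_self_add
      rw [sq]; gcongr
  calc ∑ k ∈ S, (majorant f).coeff k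
      ≤ ∑ k ∈ S, ((if k = 0 then 1 else 0) +
          ((wt k ^ 2)⁻¹ + wt k ^ (2 * σ) * ‖f.coeff k‖₊ ^ 2) +
          ((wt k ^ 2)⁻¹ + wt k ^ (2 * σ) * ‖f.coeff (-k)‖₊ ^ 2)) := by
        refine Finset.sum_le_sum fun k _ => ?_
        rw [majorant_coeff]
        gcongr
        · exact key _ _
        · exact key _ _
    _ ≤ _ := by
        simp only [Finset.sum_add_distrib]
        gcongr
        · exact sum_ite_zero_le S
        · exact sum_le_zetaTwo S
        · exact h S
        · exact sum_le_zetaTwo S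
        · exact h.neg S

/-- The nonquadratic part of the energy is controlled by one derivative less. -/
lemma exists_nnnorm_densRem_le {σ : ℕ} (hσ : 1 ≤ σ) (B : NNReal) : ∃ C : NNReal, ∀ f,
    SobolevLE σ f B → ‖(cj f * densRem f (2 * (σ + 1))).coeff 0‖₊ ≤ C := by
  obtain ⟨C₀, hC₀⟩ := exists_dom_densRem (2 * (σ + 1))
  set M := 2 * (2 * (σ + 1) + 1) + 1 with hM
  obtain ⟨C₁, hC₁⟩ := T_pow_le σ M
  refine ⟨C₀ * (C₁ * (2 * (3 * (1 + B + B)) * (1 + (zetaTwo + B) + (zetaTwo + B)) ^ M)),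
    fun f hf => ?_⟩
  have ha := majorizes_majorant f
  set a := majorant f
  refine ((ha.dom_cj.mul (hC₀ f a ha)) 0).trans ?_
  -- Exactly `2σ` derivatives remain. Half of them move to the other factors, after which `(T σ a)²`
  -- is bounded by the `H^σ` norm and every other factor is summable.
  have e1 : a * (C₀ * (T (2 * (σ + 1) - 2) a * a ^ (2 * (2 * (σ + 1) + 1)))) =
      C₀ * (T (σ + σ) a * a ^ M) := by
    rw [show 2 * (σ + 1) - 2 = σ + σ by omega, hM]
    ring
  rw [e1, natCast_mul_coeff, T_mul_coeff_zero]
  gcongr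
  have h2 : T σ a * T σ (a ^ M) ≤ C₁ * (T σ a * T σ a * a ^ M) := by
    calc T σ a * T σ (a ^ M) ≤ T σ a * (C₁ * (T σ a * a ^ M)) :=
          mul_le_mul_right (hC₁ a ha.one_le) _
      _ = _ := by ring
  refine (le_def.1 h2 0).trans ?_
  rw [natCast_mul_coeff]
  gcongr
  exact mul_pow_coeff_le _ a _ _ (mul_self_coeff_le _ _ hf.majorant_sq) (hf.majorant_sum hσ) M 0

lemma energy_eq (l : ℕ) (f : TrigPoly) (S : Finset ℤ) (hS : ∀ j, f.coeff j ≠ 0 → j ∈ S) :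
    energy (2 * l + 1) f = 2 * Real.pi * (∑ k ∈ S, (k : ℝ) ^ (2 * l) * ‖f.coeff k‖ ^ 2 +
      ((cj f * densRem f (2 * l)).coeff 0).re) := by
  have h1 : dens D f (cj f) (2 * l + 1) = mult (fun k => (k : ℂ) ^ (2 * l)) f +
      densRem f (2 * l) := by
    rw [densRem]; ring
  rw [energy, h1, mul_add, AddMonoidAlgebra.coeff_add, Finsupp.add_apply, Complex.add_re,
    coeff_zero_cj_mul f _ S hS, Complex.re_sum]
  congr 2
  refine Finset.sum_congr rfl fun k _ => ?_
  rw [coeff_mult, mul_left_comm, Complex.conj_mul']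
  norm_cast

lemma rem_ev (n : ℕ) (f : TrigPoly) :
    Rem n (ev f) = 2 * Real.pi * ((cj f * densRem f (2 * n)).coeff 0).re := by
  have hS : ∀ j, f.coeff j ≠ 0 → j ∈ f.coeff.support := fun j hj => Finsupp.mem_support_iff.2 hj
  rw [Rem, E_ev, energy_eq n f _ hS, integral_norm_iteratedDeriv_sq_ev f n _ hS]
  ring

lemma sobolevLE_of_le {l : ℕ} {f : TrigPoly} {S₀ : Finset ℤ} (hS : ∀ j, f.coeff j ≠ 0 → j ∈ S₀)
    {b₀ b₁ : ℝ} (h₀ : ∑ k ∈ S₀, ‖f.coeff k‖ ^ 2 ≤ b₀)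
    (h₁ : ∑ k ∈ S₀, (k : ℝ) ^ (2 * l) * ‖f.coeff k‖ ^ 2 ≤ b₁) :
    SobolevLE l f (2 ^ (2 * l) * (b₀ + b₁)).toNNReal := by
  intro S
  have h1 : ∑ k ∈ S, wt k ^ (2 * l) * ‖f.coeff k‖₊ ^ 2 ≤
      ∑ k ∈ S₀, wt k ^ (2 * l) * ‖f.coeff k‖₊ ^ 2 := by
    classical
    rw [← Finset.sum_filter_ne_zero S]
    refine Finset.sum_le_sum_of_subset fun k hk => hS k ?_
    rintro h0
    simp [h0] at hk
  refine h1.trans (NNReal.le_toNNReal_of_coe_le ?_)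
  push_cast
  calc ∑ k ∈ S₀, (wt k : ℝ) ^ (2 * l) * ‖f.coeff k‖ ^ 2
      ≤ ∑ k ∈ S₀, 2 ^ (2 * l) * (‖f.coeff k‖ ^ 2 + (k : ℝ) ^ (2 * l) * ‖f.coeff k‖ ^ 2) := by
        refine Finset.sum_le_sum fun k _ => ?_
        have h2 : (wt k : ℝ) ^ (2 * l) ≤ 2 ^ (2 * l) * (1 + (k : ℝ) ^ (2 * l)) := by
          have e : (wt k : ℝ) = 1 + |(k : ℝ)| := by simp [wt, Nat.cast_natAbs]
          have e2 : (k : ℝ) ^ (2 * l) = |(k : ℝ)| ^ (2 * l) := (Even.pow_abs ⟨l, by ring⟩ _).symm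
          rw [e, e2]
          have h3 : 1 + |(k : ℝ)| ≤ 2 * max 1 |(k : ℝ)| := by
            rw [two_mul]; gcongr <;> simp
          calc (1 + |(k : ℝ)|) ^ (2 * l) ≤ (2 * max 1 |(k : ℝ)|) ^ (2 * l) := by gcongr
            _ ≤ _ := by
              rw [mul_pow]
              gcongr
              rcases le_total 1 |(k : ℝ)| with h | h
              · rw [max_eq_right h]; simp
              · rw [max_eq_left h]; simp
        calc (wt k : ℝ) ^ (2 * l) * ‖f.coeff k‖ ^ 2
            ≤ 2 ^ (2 * l) * (1 + (k : ℝ) ^ (2 * l)) * ‖f.coeff k‖ ^ 2 := by gcongr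
          _ = _ := by ring
    _ ≤ _ := by
      rw [← Finset.mul_sum, Finset.sum_add_distrib]
      gcongr

/-- Bounds on the energies below level `n` bound the `H^{n-1}` norm. -/
lemma exists_sobolevLE_of_energy_le (l : ℕ) (M : ℝ) : ∃ B : NNReal, ∀ f : TrigPoly,
    (∀ j ≤ l + 1, |energy (2 * j + 1) f| ≤ M) → SobolevLE (l + 1) f B := by
  have hpi : 0 < 2 * Real.pi := by positivity
  have hmass : ∀ f : TrigPoly, |energy (2 * 0 + 1) f| ≤ M →
      ∑ k ∈ f.coeff.support, ‖f.coeff k‖ ^ 2 ≤ M / (2 * Real.pi) := by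
    intro f hf
    rw [energy_eq 0 f _ fun j hj => Finsupp.mem_support_iff.2 hj, mul_zero, densRem_zero] at hf
    rw [le_div_iff₀' hpi]
    simpa using (le_abs_self _).trans hf
  have hstep : ∀ (j : ℕ) (C : ℝ) (f : TrigPoly), |energy (2 * j + 1) f| ≤ M →
      -C ≤ ((cj f * densRem f (2 * j)).coeff 0).re →
      ∑ k ∈ f.coeff.support, (k : ℝ) ^ (2 * j) * ‖f.coeff k‖ ^ 2 ≤ M / (2 * Real.pi) + C := by
    intro j C f hf hC
    rw [energy_eq j f _ fun j hj => Finsupp.mem_support_iff.2 hj] at hf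
    have h1 := (le_abs_self _).trans hf
    rw [← le_div_iff₀' hpi] at h1
    linarith
  -- The base case uses the defocusing sign: the quartic part of `E_3` is `‖f²‖² ≥ 0`, so mass and
  -- `E_3` bound the `H¹` norm. In the inductive step the remainder of the next energy is controlled
  -- by the norm already bounded.
  induction l with
  | zero =>
    refine ⟨_, fun f hf => sobolevLE_of_le (fun j hj => Finsupp.mem_support_iff.2 hj)
      (hmass f (hf 0 (by omega))) (hstep 1 0 f (hf 1 (by omega)) ?_)⟩
    have h2 : cj f * densRem f (2 * 1) = cj (f * f) * (f * f) := by
      rw [mul_one, densRem_two, map_mul]; ring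
    rw [h2, coeff_zero_cj_mul (f * f) (f * f) _ fun j hj => Finsupp.mem_support_iff.2 hj,
      Complex.re_sum, neg_zero]
    refine Finset.sum_nonneg fun k _ => ?_
    rw [Complex.conj_mul']
    norm_cast
    positivity
  | succ l ih =>
    obtain ⟨B, hB⟩ := ih
    obtain ⟨C, hC⟩ := exists_nnnorm_densRem_le (σ := l + 1) (by omega) B
    refine ⟨_, fun f hf => sobolevLE_of_le (fun j hj => Finsupp.mem_support_iff.2 hj)
      (hmass f (hf 0 (by omega))) (hstep (l + 2) C f (hf (l + 2) (by omega)) ?_)⟩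
    have h1 := hC f (hB f fun j hj => hf j (by omega))
    have h2 := (Complex.abs_re_le_norm _).trans (show ‖(cj f * densRem f (2 * (l + 2))).coeff 0‖ ≤ C
      from h1)
    exact (abs_le.1 h2).1

/-- On the support of the cut-offs the remainder `R_n` is bounded. -/
lemma exists_abs_rem_le {n : ℕ} (hn : 2 ≤ n) (M : ℝ) : ∃ C : ℝ, ∀ f : TrigPoly,
    (∀ j < n, |energy (2 * j + 1) f| ≤ M) → |Rem n (ev f)| ≤ C := by
  obtain ⟨m, rfl⟩ := Nat.exists_eq_add_of_le' hn
  obtain ⟨B, hB⟩ := exists_sobolevLE_of_energy_le m M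
  obtain ⟨C, hC⟩ := exists_nnnorm_densRem_le (σ := m + 1) (by omega) B
  refine ⟨2 * Real.pi * C, fun f hf => ?_⟩
  rw [rem_ev, abs_mul, abs_of_pos (by positivity : 0 < 2 * Real.pi)]
  gcongr
  exact (Complex.abs_re_le_norm _).trans (hC f (hB f fun j hj => hf j (by omega)))

end EnergyBounds

/-! ### The linearized densities in high-frequency directions. -/

section Linearization

open Maj TrigPoly

/-- `F` is supported in the frequencies `|k| ≤ M`. -/
def Maj.SuppLE (F : Maj) (M : ℕ) : Prop := ∀ k, F.coeff k ≠ 0 → k.natAbs ≤ M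

namespace Maj.SuppLE

lemma mono {F : Maj} {M M' : ℕ} (h : SuppLE F M) (hM : M ≤ M') : SuppLE F M' :=
  fun k hk => (h k hk).trans hM

lemma mul {F G : Maj} {M M' : ℕ} (hF : SuppLE F M) (hG : SuppLE G M') :
    SuppLE (F * G) (M + M') := by
  intro k hk
  rw [mul_coeff] at hk
  obtain ⟨j, _, hj⟩ := Finset.exists_ne_zero_of_sum_ne_zero hk
  have h1 := hF j (left_ne_zero_of_mul hj)
  have h2 := hG (k - j) (right_ne_zero_of_mul hj)
  omega

lemma one : SuppLE 1 0 := by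
  intro k hk
  rw [one_coeff] at hk
  simp at hk
  simp [hk]

lemma pow {F : Maj} {M : ℕ} (hF : SuppLE F M) (m : ℕ) : SuppLE (F ^ m) (m * M) := by
  induction m with
  | zero => simpa using one
  | succ m ih =>
    rw [pow_succ]
    exact (ih.mul hF).mono (by rw [add_mul, one_mul])

lemma natCast_mul {F : Maj} {M : ℕ} (hF : SuppLE F M) (n : ℕ) : SuppLE (n * F) M := by
  intro k hk
  rw [natCast_mul_coeff] at hk
  exact hF k (right_ne_zero_of_mul hk)

/-- Bernstein's inequality. It trades derivatives for powers of the cut-off. -/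
lemma T_le {F : Maj} {M : ℕ} (hF : SuppLE F M) (p : ℕ) :
    T p F ≤ ((M + 1) ^ p : ℕ) * F := le_def.2 fun k => by
  rw [T_coeff, natCast_mul_coeff]
  by_cases hk : F.coeff k = 0
  · simp [hk]
  · gcongr
    push_cast
    have : (k.natAbs : NNReal) ≤ M := by exact_mod_cast hF k hk
    gcongr
    rw [wt, add_comm]
    gcongr

end Maj.SuppLE

/-- `f` has frequencies at most `N`, and `a` is a majorant of it with the same property. -/
structure LowMajorizes (N : ℕ) (a : Maj) (f : TrigPoly) : Prop extends Majorizes a f where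
  supp : SuppLE a N

lemma exists_dom_dens_low (m : ℕ) : ∃ C : ℕ, ∀ (N : ℕ) (f : TrigPoly) (a : Maj),
    LowMajorizes N a f →
      Dom (dens D f (cj f) m) (C * (((N + 1) ^ (m - 1) : ℕ) * a ^ (2 * m + 1))) := by
  obtain ⟨C, hC⟩ := exists_dom_dens m
  refine ⟨C, fun N f a h => (hC f a h.toMajorizes).mono ?_⟩
  refine mul_le_mul_right ?_ _
  calc T (m - 1) a * a ^ (2 * m) ≤ ((N + 1) ^ (m - 1) : ℕ) * a * a ^ (2 * m) :=
        mul_le_mul_left (h.supp.T_le _) _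
    _ = _ := by ring

lemma exists_dom_densRem_low (m : ℕ) : ∃ C : ℕ, ∀ (N : ℕ) (f : TrigPoly) (a : Maj),
    LowMajorizes N a f →
      Dom (densRem f m) (C * (((N + 1) ^ (m - 2) : ℕ) * a ^ (2 * (m + 1) + 1))) := by
  obtain ⟨C, hC⟩ := exists_dom_densRem m
  refine ⟨C, fun N f a h => (hC f a h.toMajorizes).mono ?_⟩
  refine mul_le_mul_right ?_ _
  calc T (m - 2) a * a ^ (2 * (m + 1)) ≤ ((N + 1) ^ (m - 2) : ℕ) * a * a ^ (2 * (m + 1)) :=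
        mul_le_mul_left (h.supp.T_le _) _
    _ = _ := by ring

/-- `(h, k)` is a direction with majorant `b`, of frequencies at most `3N`. -/
structure DirMajorizes (N : ℕ) (b : Maj) (h k : TrigPoly) : Prop where
  dom_left : Dom h b
  dom_right : Dom k b
  supp : SuppLE b (3 * N)

section Semiring

variable {S : Type*} [CommSemiring S] [PartialOrder S] [IsOrderedRing S] [CanonicallyOrderedAdd S]

lemma mul_scaled_le {x L c d : S} {p q r p' q' r' : ℕ} (a : S) (hL : 1 ≤ L)
    (hr : p + q ≤ r) (hr' : p' + q' = r') :
    x * (c * (L ^ p * a ^ p') * (d * (L ^ q * a ^ q'))) ≤ c * d * (L ^ r * (x * a ^ r')) :=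
  calc x * (c * (L ^ p * a ^ p') * (d * (L ^ q * a ^ q')))
      = c * d * (L ^ (p + q) * (x * a ^ (p' + q'))) := by ring
    _ ≤ c * d * (L ^ r * (x * a ^ r')) := by rw [hr']; gcongr

lemma mul_scaled_le' {a b L c d : S} {p q r p' q' r' : ℕ} (hL : 1 ≤ L)
    (hr : p + q ≤ r) (hr' : p' + q' + 1 = r') :
    a * (c * (L ^ p * (b * a ^ p')) * (d * (L ^ q * a ^ q'))) ≤ c * d * (L ^ r * (b * a ^ r')) :=
  calc a * (c * (L ^ p * (b * a ^ p')) * (d * (L ^ q * a ^ q')))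
      = c * d * (L ^ (p + q) * (b * a ^ (p' + q' + 1))) := by ring
    _ ≤ c * d * (L ^ r * (b * a ^ r')) := by rw [hr']; gcongr

end Semiring

/-- The product `b * a ^ q` has frequencies at most `(q + 3) N`, so one derivative costs at most `(q
+ 4)(N + 1)`. -/
lemma dom_D_scaled {N : ℕ} {a b : Maj} (ha : SuppLE a N) (hb : SuppLE b (3 * N)) (ha1 : 1 ≤ a)
    {g : TrigPoly} {C p q : ℕ} (hg : Dom g (C * (((N + 1) ^ p : ℕ) * (b * a ^ q)))) {p' q' : ℕ}
    (hp : p + 1 ≤ p') (hq : q ≤ q') :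
    Dom (TrigPoly.D g) ((C * (q + 4) : ℕ) * (((N + 1) ^ p' : ℕ) * (b * a ^ q'))) := by
  refine hg.D.mono ?_
  rw [T_natCast_mul, T_natCast_mul]
  have h1 : T 1 (b * a ^ q) ≤ ((q + 4) * (N + 1) : ℕ) * (b * a ^ q) := by
    refine ((hb.mul (ha.pow q)).T_le 1).trans (mul_le_mul_left ?_ _)
    exact Nat.mono_cast (by rw [pow_one]; nlinarith)
  calc (C : Maj) * (((N + 1) ^ p : ℕ) * T 1 (b * a ^ q))
      ≤ C * (((N + 1) ^ p : ℕ) * (((q + 4) * (N + 1) : ℕ) * (b * a ^ q))) :=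
        mul_le_mul_right (mul_le_mul_right h1 _) _
    _ = (C * (q + 4) : ℕ) * (((N + 1) ^ (p + 1) : ℕ) * (b * a ^ q)) := by push_cast; ring
    _ ≤ (C * (q + 4) : ℕ) * (((N + 1) ^ p' : ℕ) * (b * a ^ q')) := by
        refine mul_le_mul_right (mul_le_mul' (Nat.mono_cast ?_) ?_) _
        · exact Nat.pow_le_pow_right (Nat.succ_pos N) hp
        · exact mul_le_mul_right (Maj.pow_le_pow' ha1 hq) _

lemma dom_lin_sum {N : ℕ} {f h k : TrigPoly} {a b : Maj} (ha : LowMajorizes N a f)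
    (hb : DirMajorizes N b h k) (C C' : ℕ → ℕ) (n : ℕ)
    (hC : ∀ m ≤ n,
      Dom (dens TrigPoly.D f (cj f) m) (C m * (((N + 1) ^ (m - 1) : ℕ) * a ^ (2 * m + 1))))
    (hC' : ∀ m ≤ n, Dom (densLin TrigPoly.D f (cj f) h k m)
      (C' m * (((N + 1) ^ (m - 1) : ℕ) * (b * a ^ (2 * m))))) :
    Dom (k * ∑ j : Fin n, dens TrigPoly.D f (cj f) (j + 1) * dens TrigPoly.D f (cj f) (n - j) +
        cj f * ∑ j : Fin n, (densLin TrigPoly.D f (cj f) h k (j + 1) *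
          dens TrigPoly.D f (cj f) (n - j) + dens TrigPoly.D f (cj f) (j + 1) *
          densLin TrigPoly.D f (cj f) h k (n - j)))
      ((∑ j : Fin n, (C (j + 1) * C (n - j) + (C' (j + 1) * C (n - j) + C' (n - j) * C (j + 1)) : ℕ) : ℕ)
        * (((N + 1) ^ (n - 1) : ℕ) * (b * a ^ (2 * (n + 2))))) := by
  have h1 : ∀ j ∈ (Finset.univ : Finset (Fin n)),
      Dom (dens TrigPoly.D f (cj f) (j + 1) * dens TrigPoly.D f (cj f) (n - j)) _ := fun j _ =>
    (hC (j + 1) (by omega)).mul (hC (n - j) (by omega))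
  have h2 : ∀ j ∈ (Finset.univ : Finset (Fin n)),
      Dom (densLin TrigPoly.D f (cj f) h k (j + 1) * dens TrigPoly.D f (cj f) (n - j) +
        dens TrigPoly.D f (cj f) (j + 1) * densLin TrigPoly.D f (cj f) h k (n - j)) _ := fun j _ => by
    rw [mul_comm (dens TrigPoly.D f (cj f) (j + 1))]
    exact ((hC' (j + 1) (by omega)).mul (hC (n - j) (by omega))).add
      ((hC' (n - j) (by omega)).mul (hC (j + 1) (by omega)))
  have hL : (1 : Maj) ≤ (N : Maj) + 1 := le_add_self
  refine ((hb.dom_right.mul (Dom.sum h1)).add (ha.dom_cj.mul (Dom.sum h2))).mono ?_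
  rw [Nat.cast_sum, Finset.mul_sum, Finset.mul_sum, Finset.sum_mul, ← Finset.sum_add_distrib]
  refine Finset.sum_le_sum fun j _ => ?_
  have hj := j.2
  push_cast
  rw [mul_add a, add_mul, add_mul]
  refine add_le_add ?_ (add_le_add ?_ ?_)
  · exact mul_scaled_le a hL (by omega) (by omega)
  · exact mul_scaled_le' hL (by omega) (by omega)
  · exact mul_scaled_le' hL (by omega) (by omega)

lemma exists_dom_densLin (m : ℕ) : ∃ C : ℕ, ∀ (N : ℕ) (f h k : TrigPoly) (a b : Maj),
    LowMajorizes N a f → DirMajorizes N b h k →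
      Dom (densLin D f (cj f) h k m) (C * (((N + 1) ^ (m - 1) : ℕ) * (b * a ^ (2 * m)))) := by
  induction m using Nat.strong_induction_on with
  | _ m ih =>
    match m with
    | 0 => exact ⟨0, fun N f h k a b _ _ => by rw [densLin_zero]; exact Dom.zero _⟩
    | 1 =>
      refine ⟨1, fun N f h k a b ha hb => ?_⟩
      rw [densLin_one, Nat.sub_self, pow_zero, Nat.cast_one, one_mul, one_mul]
      exact hb.dom_left.mono (le_mul_of_one_le_right zero_le (one_le_pow' ha.one_le _))
    | n + 2 =>
      choose! C' hC' using ih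
      choose C hC using exists_dom_dens_low
      refine ⟨C' (n + 1) * (2 * (n + 1) + 4) + ∑ j : Fin n, (C (j + 1) * C (n - j) +
        (C' (j + 1) * C (n - j) + C' (n - j) * C (j + 1))), fun N f h k a b ha hb => ?_⟩
      rw [densLin_add_two, Nat.cast_add, add_mul]
      refine Dom.add ?_ ((dom_lin_sum ha hb C C' n (fun m hm => hC m N f a ha)
        (fun m hm => hC' m (by omega) N f h k a b ha hb)).mono ?_)
      · exact dom_D_scaled ha.supp hb.supp ha.one_le (hC' (n + 1) (by omega) N f h k a b ha hb)
          (by omega) (by omega)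
      · refine mul_le_mul_right (mul_le_mul_left (Nat.mono_cast ?_) _) _
        exact Nat.pow_le_pow_right (Nat.succ_pos N) (by omega)

/-- The difference between `densLin (n + 1)` and its part of degree one. -/
def densLinRem (f h k : TrigPoly) (n : ℕ) : TrigPoly :=
  densLin D f (cj f) h k (n + 1) - mult (fun k => (k : ℂ) ^ n) h

lemma densLinRem_zero (f h k : TrigPoly) : densLinRem f h k 0 = 0 := by
  ext j; simp [densLinRem, densLin_one]

lemma densLinRem_succ (f h k : TrigPoly) (n : ℕ) : densLinRem f h k (n + 1) =
    TrigPoly.D (densLinRem f h k n) +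
      (k * ∑ j : Fin n, dens TrigPoly.D f (cj f) (j + 1) * dens TrigPoly.D f (cj f) (n - j) +
        cj f * ∑ j : Fin n, (densLin TrigPoly.D f (cj f) h k (j + 1) *
          dens TrigPoly.D f (cj f) (n - j) + dens TrigPoly.D f (cj f) (j + 1) *
          densLin TrigPoly.D f (cj f) h k (n - j))) := by
  rw [densLinRem, densLin_add_two, mult_pow_succ, densLinRem, map_sub]
  ring

/-- As in `exists_dom_densRem`, the terms beyond the linear one gain two derivatives, here two
powers of `N + 1`. Linearity in the direction shows as a single factor `b`. -/
lemma exists_dom_densLinRem (n : ℕ) : ∃ C : ℕ, ∀ (N : ℕ) (f h k : TrigPoly) (a b : Maj),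
    LowMajorizes N a f → DirMajorizes N b h k →
      Dom (densLinRem f h k n) (C * (((N + 1) ^ (n - 2) : ℕ) * (b * a ^ (2 * (n + 1))))) := by
  induction n with
  | zero => exact ⟨0, fun N f h k a b _ _ => by rw [densLinRem_zero]; exact Dom.zero _⟩
  | succ n ih =>
    obtain ⟨C₀, hC₀⟩ := ih
    choose C hC using exists_dom_dens_low
    choose C' hC' using exists_dom_densLin
    refine ⟨C₀ * (2 * (n + 1) + 4) + ∑ j : Fin n, (C (j + 1) * C (n - j) +
        (C' (j + 1) * C (n - j) + C' (n - j) * C (j + 1))), fun N f h k a b ha hb => ?_⟩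
    rw [densLinRem_succ, Nat.cast_add, add_mul]
    refine Dom.add ?_ (dom_lin_sum ha hb C C' n (fun m hm => hC m N f a ha)
        (fun m hm => hC' m N f h k a b ha hb))
    rcases Nat.lt_or_ge n 2 with hn | hn
    · have : densLinRem f h k n = 0 := by
        interval_cases n
        · exact densLinRem_zero f h k
        · rw [densLinRem_succ, densLinRem_zero]; simp
      rw [this, map_zero]
      exact Dom.zero _
    exact dom_D_scaled ha.supp hb.supp ha.one_le (hC₀ N f h k a b ha hb) (by omega) (by omega)

/-- The zeroth Fourier coefficient of the derivative of `v w_m` in the direction `(h, k)`. -/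
def energyLin (f h k : TrigPoly) (m : ℕ) : ℂ :=
  (k * dens D f (cj f) m + cj f * densLin D f (cj f) h k m).coeff 0

/-- Orthogonality of low and high frequencies. It removes the quadratic part of the energies from
the drift and also yields conservation of mass. -/
lemma mul_coeff_zero_of_disjoint {N : ℕ} {f g : TrigPoly}
    (hf : ∀ j : ℤ, f.coeff j ≠ 0 → j.natAbs ≤ N) (hg : ∀ j : ℤ, g.coeff j ≠ 0 → N < j.natAbs) :
    (f * g).coeff 0 = 0 := by
  rw [coeff_mul_eq_sum f g f.coeff.support fun j hj => Finsupp.mem_support_iff.2 hj]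
  refine Finset.sum_eq_zero fun j hj => ?_
  have h1 := hf j (Finsupp.mem_support_iff.1 hj)
  by_contra h0
  have h2 := hg _ (right_ne_zero_of_mul h0)
  omega

/-- In a high-frequency direction the quadratic part of the energy does not contribute. -/
lemma exists_nnnorm_energyLin_le (l : ℕ) : ∃ C : NNReal, ∀ (N : ℕ) (f h k : TrigPoly) (a b : Maj),
    LowMajorizes N a f → DirMajorizes N b h k →
    (∀ j : ℤ, h.coeff j ≠ 0 → N < j.natAbs) → (∀ j : ℤ, k.coeff j ≠ 0 → N < j.natAbs) →
      ‖energyLin f h k (2 * l + 1)‖₊ ≤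
        C * ((N + 1 : NNReal) ^ (2 * l - 2) * (b * a ^ (4 * l + 3)).coeff 0) := by
  obtain ⟨C, hC⟩ := exists_dom_densRem_low (2 * l)
  obtain ⟨C', hC'⟩ := exists_dom_densLinRem (2 * l)
  refine ⟨C + C', fun N f h k a b ha hb hh hk => ?_⟩
  have hlow : ∀ (g : TrigPoly), Dom g a → ∀ j : ℤ, g.coeff j ≠ 0 → j.natAbs ≤ N := by
    intro g hg j hj
    refine ha.supp j fun h0 => hj ?_
    have := hg j
    rw [h0] at this
    simpa using this
  have e1 : energyLin f h k (2 * l + 1) =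
      (k * densRem f (2 * l) + cj f * densLinRem f h k (2 * l)).coeff 0 := by
    have h1 : dens D f (cj f) (2 * l + 1) = mult (fun k => (k : ℂ) ^ (2 * l)) f +
      densRem f (2 * l) := by rw [densRem]; ring
    have h2 : densLin D f (cj f) h k (2 * l + 1) = mult (fun k => (k : ℂ) ^ (2 * l)) h +
      densLinRem f h k (2 * l) := by rw [densLinRem]; ring
    have h3 : (mult (fun k => (k : ℂ) ^ (2 * l)) f * k).coeff 0 = 0 :=
      mul_coeff_zero_of_disjoint (fun j hj => hlow f ha.dom j (right_ne_zero_of_mul hj)) hk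
    have h4 : (cj f * mult (fun k => (k : ℂ) ^ (2 * l)) h).coeff 0 = 0 :=
      mul_coeff_zero_of_disjoint (fun j hj => hlow _ ha.dom_cj j hj)
        fun j hj => hh j (right_ne_zero_of_mul hj)
    rw [energyLin, h1, h2, mul_add, mul_add, mul_comm k (mult _ f)]
    simp only [AddMonoidAlgebra.coeff_add, Finsupp.add_apply, h3, h4, zero_add]
  rw [e1]
  refine (((hb.dom_right.mul (hC N f a ha)).add
    (ha.dom_cj.mul (hC' N f h k a b ha hb))).mono (G := (C + C' : ℕ) *
      (((N + 1) ^ (2 * l - 2) : ℕ) * (b * a ^ (4 * l + 3)))) (le_of_eq ?_) 0).trans ?_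
  · rw [show 4 * l + 3 = 2 * (2 * l + 1) + 1 by ring]
    push_cast
    ring
  · rw [natCast_mul_coeff, natCast_mul_coeff]
    push_cast
    exact le_rfl

end Linearization

/-! ### Convolution sums with power decay near the frequency cut-off. -/

section Convolution

open Maj TrigPoly

namespace Maj

/-- The part of `F` of frequencies larger than `N`. -/
def high (N : ℕ) (F : Maj) : Maj :=
  .ofCoeff (Finsupp.onFinset F.coeff.support (fun k => if k.natAbs ≤ N then 0 else F.coeff k)
    fun k hk => Finsupp.mem_support_iff.2 fun h0 => hk (by simp [h0]))

lemma high_coeff (N : ℕ) (F : Maj) (k : ℤ) :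
    (high N F).coeff k = if k.natAbs ≤ N then 0 else F.coeff k := rfl

lemma high_le (N : ℕ) (F : Maj) : high N F ≤ F := le_def.2 fun k => by
  rw [high_coeff]; split_ifs <;> simp

lemma high_mono (N : ℕ) {F G : Maj} (h : F ≤ G) : high N F ≤ high N G := le_def.2 fun k => by
  rw [high_coeff, high_coeff]; split_ifs
  · exact le_rfl
  · exact le_def.1 h k

lemma high_smul (N : ℕ) (c : NNReal) (F : Maj) : high N (c • F) = c • high N F := by
  ext k; simp [high_coeff]

lemma wt_pos (k : ℤ) : 0 < wt k := zero_lt_one.trans_le (one_le_wt k)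

lemma wt_ne_zero (k : ℤ) : wt k ≠ 0 := (wt_pos k).ne'

/-- The sequence `⟨k⟩^{-s}`, `|k| ≤ N`. -/
def decay (s : ℝ) (N : ℕ) : Maj :=
  .ofCoeff (Finsupp.onFinset (Finset.Icc (-(N : ℤ)) N)
    (fun k => if k.natAbs ≤ N then wt k ^ (-s) else 0)
    fun k hk => by
      have : k.natAbs ≤ N := by
        by_contra h
        simp [h] at hk
      rw [Finset.mem_Icc]
      omega)

lemma decay_coeff (s : ℝ) (N : ℕ) (k : ℤ) :
    (decay s N).coeff k = if k.natAbs ≤ N then wt k ^ (-s) else 0 := rfl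

lemma decay_coeff_le (s : ℝ) (N : ℕ) (k : ℤ) : (decay s N).coeff k ≤ wt k ^ (-s) := by
  rw [decay_coeff]; split_ifs <;> simp

/-- `∑_k ⟨k⟩^{-r}`. -/
def zeta (r : ℝ) : NNReal := ∑' k : ℤ, wt k ^ (-r)

lemma sum_le_zeta {r : ℝ} (hr : 1 < r) (S : Finset ℤ) : ∑ k ∈ S, wt k ^ (-r) ≤ zeta r := by
  refine Summable.sum_le_tsum S (fun _ _ => zero_le) ?_
  rw [← NNReal.summable_coe]
  refine (summable_wt_rpow hr).congr fun k => ?_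
  rw [NNReal.coe_rpow]

/-- The larger of `⟨j⟩` and `⟨k - j⟩` is at least `⟨k⟩ / 2`. -/
lemma wt_rpow_mul_le {s : ℝ} (hs : 0 ≤ s) (j k : ℤ) : wt j ^ (-s) * wt (k - j) ^ (-s) ≤
    2 ^ s * wt k ^ (-s) * (wt j ^ (-s) + wt (k - j) ^ (-s)) := by
  have h : wt k ≤ wt j + wt (k - j) := by simpa using wt_add_le j (k - j)
  have key : ∀ x y z : NNReal, 0 < x → 0 < y → 0 < z → z ≤ x + y → x ≤ y →
      x ^ (-s) * y ^ (-s) ≤ 2 ^ s * z ^ (-s) * x ^ (-s) := by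
    intro x y z hx hy hz h1 h2
    rw [mul_comm]
    gcongr
    have h3 : z ≤ 2 * y := h1.trans (by rw [two_mul]; gcongr)
    rw [NNReal.rpow_neg, NNReal.rpow_neg, ← div_eq_mul_inv, ← one_div, div_le_div_iff₀
      (NNReal.rpow_pos hy) (NNReal.rpow_pos hz), one_mul, ← NNReal.mul_rpow]
    gcongr
  rcases le_total (wt j) (wt (k - j)) with h2 | h2
  · refine (key _ _ _ (wt_pos _) (wt_pos _) (wt_pos k) h h2).trans ?_
    gcongr
    exact le_self_add
  · rw [mul_comm]
    refine (key _ _ _ (wt_pos _) (wt_pos _) (wt_pos k) (by rwa [add_comm]) h2).trans ?_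
    gcongr
    exact le_add_self

lemma exists_decay_pow_le {s : ℝ} (hs : 1 < s) (m : ℕ) : ∃ C : NNReal, ∀ (N : ℕ) (k : ℤ),
    (decay s N ^ (m + 1)).coeff k ≤ C * wt k ^ (-s) := by
  induction m with
  | zero => exact ⟨1, fun N k => by simpa using decay_coeff_le s N k⟩
  | succ m ih =>
    obtain ⟨C, hC⟩ := ih
    refine ⟨C * (2 ^ s * (zeta s + zeta s)), fun N k => ?_⟩
    rw [pow_succ, mul_comm, mul_coeff]
    set S := (decay s N).coeff.support
    have h2 : ∑ j ∈ S, wt (k - j) ^ (-s) ≤ zeta s := by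
      have := sum_le_zeta hs (S.map ((Equiv.subLeft k).toEmbedding))
      simpa using this
    calc ∑ j ∈ S, (decay s N).coeff j * (decay s N ^ (m + 1)).coeff (k - j)
        ≤ ∑ j ∈ S, C * (2 ^ s * wt k ^ (-s) * (wt j ^ (-s) + wt (k - j) ^ (-s))) := by
          refine Finset.sum_le_sum fun j _ => ?_
          calc (decay s N).coeff j * (decay s N ^ (m + 1)).coeff (k - j)
              ≤ wt j ^ (-s) * (C * wt (k - j) ^ (-s)) := by
                gcongr
                · exact decay_coeff_le s N j
                · exact hC N _
            _ = C * (wt j ^ (-s) * wt (k - j) ^ (-s)) := by ring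
            _ ≤ _ := by
              exact mul_le_mul_right (wt_rpow_mul_le (zero_le_one.trans hs.le) j k) C
      _ = C * (2 ^ s * wt k ^ (-s) * (∑ j ∈ S, wt j ^ (-s) + ∑ j ∈ S, wt (k - j) ^ (-s))) := by
          rw [← Finset.mul_sum, ← Finset.mul_sum, Finset.sum_add_distrib]
      _ ≤ C * (2 ^ s * wt k ^ (-s) * (zeta s + zeta s)) := by
          gcongr
          exact sum_le_zeta hs S
      _ = _ := by ring

/-- The indicator of the resonance-free region `|i + j + k| > N`. -/
def outside (N : ℕ) (m : ℤ) : NNReal := if N < m.natAbs then 1 else 0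

/-- Substituting `k = K - i - j` turns the sum over output frequencies into a sum over triples of
input frequencies, each at most `N` in size and with sum outside the cut-off. -/
lemma sum_high_cube_le (s : ℝ) (N : ℕ) (S : Finset ℤ) :
    ∑ K ∈ S, (high N (decay s N ^ 3)).coeff K ≤
      ∑ i ∈ Finset.Icc (-(N : ℤ)) N, ∑ j ∈ Finset.Icc (-(N : ℤ)) N, ∑ k ∈ Finset.Icc (-(N : ℤ)) N,
        outside N (i + j + k) * (wt i ^ (-s) * wt j ^ (-s) * wt k ^ (-s)) := by
  set I := Finset.Icc (-(N : ℤ)) N with hI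
  have hsup : ∀ j, (decay s N).coeff j ≠ 0 → j ∈ I := by
    intro j hj
    rw [decay_coeff] at hj
    have : j.natAbs ≤ N := by
      by_contra h
      simp [h] at hj
    rw [hI, Finset.mem_Icc]
    omega
  have e1 : ∀ K, (high N (decay s N ^ 3)).coeff K = ∑ i ∈ I, ∑ j ∈ I,
      outside N K * ((decay s N).coeff i * ((decay s N).coeff j *
        (decay s N).coeff (K - i - j))) := by
    intro K
    rw [high_coeff, pow_succ', sq, mul_coeff' _ _ I hsup]
    simp only [mul_coeff' _ _ I hsup, ← Finset.mul_sum]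
    by_cases h : K.natAbs ≤ N
    · simp [outside, h]
    · simp [outside, h, not_le.1 h]
  simp only [e1]
  rw [Finset.sum_comm]
  refine Finset.sum_le_sum fun i _ => ?_
  rw [Finset.sum_comm]
  refine Finset.sum_le_sum fun j _ => ?_
  have e2 : ∑ K ∈ S, outside N K * ((decay s N).coeff i * ((decay s N).coeff j *
      (decay s N).coeff (K - i - j))) =
      ∑ k ∈ S.map (Equiv.subRight (i + j)).toEmbedding, outside N (i + j + k) *
        ((decay s N).coeff i * (decay s N).coeff j * (decay s N).coeff k) := by
    rw [Finset.sum_map]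
    refine Finset.sum_congr rfl fun K _ => ?_
    simp only [Equiv.toEmbedding_apply, Equiv.subRight_apply, add_sub_cancel, sub_sub, mul_assoc]
  rw [e2]
  calc _ ≤ ∑ k ∈ I, outside N (i + j + k) *
        ((decay s N).coeff i * (decay s N).coeff j * (decay s N).coeff k) := by
        rw [← Finset.sum_filter_ne_zero]
        refine Finset.sum_le_sum_of_subset fun k hk => ?_
        rw [Finset.mem_filter] at hk
        exact hsup k (right_ne_zero_of_mul (right_ne_zero_of_mul hk.2))
    _ ≤ _ := by
        gcongr <;> exact decay_coeff_le s N _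

/-- The count is at most `2(N + 1)` trivially, and at most `2⟨m⟩` because `i` must lie within `|m|`
of an end of the interval; the bound is the geometric mean. Using `⟨m⟩` alone would require `s > 2`
afterwards, whereas the case `n = 2` needs `s` slightly below `2`. -/
lemma sum_outside_le (N : ℕ) (m : ℤ) : ∑ i ∈ Finset.Icc (-(N : ℤ)) N, outside N (i + m) ≤
    2 * (N + 1 : NNReal) ^ (1 / 2 : ℝ) * wt m ^ (1 / 2 : ℝ) := by
  have h1 : ∑ i ∈ Finset.Icc (-(N : ℤ)) N, outside N (i + m) ≤ 2 * (N + 1 : ℕ) := by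
    calc ∑ i ∈ Finset.Icc (-(N : ℤ)) N, outside N (i + m)
        ≤ ∑ i ∈ Finset.Icc (-(N : ℤ)) N, 1 := by
          refine Finset.sum_le_sum fun i _ => ?_
          unfold outside; split_ifs <;> simp
      _ = ((2 * N + 1 : ℕ) : NNReal) := by
          rw [Finset.sum_const, Int.card_Icc, nsmul_eq_mul, mul_one]
          congr 1
          omega
      _ ≤ _ := by
          exact (Nat.mono_cast (show 2 * N + 1 ≤ 2 * (N + 1) by omega)).trans
            (le_of_eq (by push_cast; ring))
  have h2 : ∑ i ∈ Finset.Icc (-(N : ℤ)) N, outside N (i + m) ≤ 2 * wt m := by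
    have hsub : (Finset.Icc (-(N : ℤ)) N).filter (fun i => N < (i + m).natAbs) ⊆
        Finset.Icc (N + 1 - m.natAbs : ℤ) N ∪ Finset.Icc (-(N : ℤ)) (m.natAbs - N - 1) := by
      intro i hi
      simp only [Finset.mem_filter, Finset.mem_Icc, Finset.mem_union] at hi ⊢
      omega
    unfold outside
    rw [Finset.sum_ite, Finset.sum_const, Finset.sum_const_zero, add_zero, nsmul_eq_mul, mul_one]
    have h3 : ((Finset.Icc (-(N : ℤ)) N).filter (fun i => N < (i + m).natAbs)).card ≤
        2 * m.natAbs := by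
      refine (Finset.card_le_card hsub).trans ((Finset.card_union_le _ _).trans ?_)
      rw [Int.card_Icc, Int.card_Icc]
      omega
    calc _ ≤ ((2 * m.natAbs : ℕ) : NNReal) := Nat.mono_cast h3
      _ ≤ _ := by
        push_cast
        gcongr
        exact le_add_self
  set x := ∑ i ∈ Finset.Icc (-(N : ℤ)) N, outside N (i + m)
  have e : x = x ^ (1 / 2 : ℝ) * x ^ (1 / 2 : ℝ) := by
    rcases eq_or_ne x 0 with h | h
    · rw [h]; simp
    · rw [← NNReal.rpow_add h]; norm_num
  have e2 : (2 : NNReal) = 2 ^ (1 / 2 : ℝ) * 2 ^ (1 / 2 : ℝ) := by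
    rw [← NNReal.rpow_add two_ne_zero]; norm_num
  calc x = x ^ (1 / 2 : ℝ) * x ^ (1 / 2 : ℝ) := e
    _ ≤ (2 * (N + 1 : ℕ)) ^ (1 / 2 : ℝ) * (2 * wt m) ^ (1 / 2 : ℝ) := by gcongr
    _ = 2 ^ (1 / 2 : ℝ) * 2 ^ (1 / 2 : ℝ) * (N + 1 : NNReal) ^ (1 / 2 : ℝ) *
        wt m ^ (1 / 2 : ℝ) := by
      rw [NNReal.mul_rpow, NNReal.mul_rpow]
      push_cast
      ring
    _ = _ := by rw [← e2]

lemma wt_add_le_mul (j k : ℤ) : wt (j + k) ≤ wt j * wt k := by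
  have : ((j + k).natAbs : NNReal) ≤ j.natAbs + k.natAbs := by exact_mod_cast Int.natAbs_add_le j k
  calc wt (j + k) ≤ 1 + (j.natAbs + k.natAbs) := by unfold wt; gcongr
    _ ≤ 1 + (j.natAbs + k.natAbs) + j.natAbs * k.natAbs := le_self_add
    _ = wt j * wt k := by unfold wt; ring

/-- The indicator of `|i| ≥ N / 3` times `⟨i⟩^{-s}`. -/
def large (s : ℝ) (N : ℕ) (i : ℤ) : NNReal := if N ≤ 3 * i.natAbs then wt i ^ (-s) else 0

lemma large_le {s : ℝ} (hs : 0 ≤ s) (N : ℕ) (i : ℤ) :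
    large s N i ≤ 3 ^ s * (N + 1 : NNReal) ^ (-s) := by
  unfold large
  split_ifs with h
  · have h1 : (N + 1 : NNReal) ≤ 3 * wt i := by
      have : (N : NNReal) ≤ 3 * i.natAbs := by exact_mod_cast h
      calc (N + 1 : NNReal) ≤ 3 * i.natAbs + 3 := by gcongr; norm_num
        _ = 3 * wt i := by unfold wt; ring
    have h0 : (0 : NNReal) < N + 1 := by positivity
    rw [NNReal.rpow_neg, NNReal.rpow_neg, ← div_eq_mul_inv, ← one_div, div_le_div_iff₀
      (NNReal.rpow_pos (wt_pos i)) (NNReal.rpow_pos h0), one_mul, ← NNReal.mul_rpow]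
    gcongr
  · exact zero_le

/-- The large frequency `i` yields `(N + 1)^{-s}`, and the count of admissible `i` costs `(N +
1)^{1/2} ⟨j⟩^{1/2} ⟨k⟩^{1/2}`. The sums over `j` and `k` then converge because `s - 1/2 > 1`. -/
lemma sum_outside_large_le {s : ℝ} (hs : 3 / 2 < s) (N : ℕ) :
    ∑ j ∈ Finset.Icc (-(N : ℤ)) N, ∑ k ∈ Finset.Icc (-(N : ℤ)) N, ∑ i ∈ Finset.Icc (-(N : ℤ)) N,
      outside N (i + (j + k)) * (large s N i * wt j ^ (-s) * wt k ^ (-s)) ≤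
    3 ^ s * 2 * (zeta (s - 1 / 2) * zeta (s - 1 / 2)) * (N + 1 : NNReal) ^ (1 / 2 - s) := by
  have h0 : (N + 1 : NNReal) ≠ 0 := by positivity
  calc _ ≤ ∑ j ∈ Finset.Icc (-(N : ℤ)) N, ∑ k ∈ Finset.Icc (-(N : ℤ)) N,
        3 ^ s * 2 * (N + 1 : NNReal) ^ (1 / 2 - s) *
          (wt j ^ (-(s - 1 / 2)) * wt k ^ (-(s - 1 / 2))) := by
        refine Finset.sum_le_sum fun j _ => Finset.sum_le_sum fun k _ => ?_
        calc ∑ i ∈ Finset.Icc (-(N : ℤ)) N,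
              outside N (i + (j + k)) * (large s N i * wt j ^ (-s) * wt k ^ (-s))
            ≤ ∑ i ∈ Finset.Icc (-(N : ℤ)) N, outside N (i + (j + k)) *
              (3 ^ s * (N + 1 : NNReal) ^ (-s) * wt j ^ (-s) * wt k ^ (-s)) := by
              gcongr
              exact large_le (by linarith) N _
          _ ≤ 2 * (N + 1 : NNReal) ^ (1 / 2 : ℝ) * (wt j * wt k) ^ (1 / 2 : ℝ) *
              (3 ^ s * (N + 1 : NNReal) ^ (-s) * wt j ^ (-s) * wt k ^ (-s)) := by
              rw [← Finset.sum_mul]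
              gcongr
              refine (sum_outside_le N (j + k)).trans ?_
              gcongr
              exact wt_add_le_mul j k
          _ = _ := by
              rw [NNReal.mul_rpow, show -(s - 1 / 2) = 1 / 2 + -s by ring,
                NNReal.rpow_add (wt_ne_zero j), NNReal.rpow_add (wt_ne_zero k),
                show 1 / 2 - s = 1 / 2 + -s by ring, NNReal.rpow_add h0]
              ring
    _ = 3 ^ s * 2 * (N + 1 : NNReal) ^ (1 / 2 - s) *
        ((∑ j ∈ Finset.Icc (-(N : ℤ)) N, wt j ^ (-(s - 1 / 2))) *
          ∑ k ∈ Finset.Icc (-(N : ℤ)) N, wt k ^ (-(s - 1 / 2))) := by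
        rw [Finset.sum_mul_sum, Finset.mul_sum]
        refine Finset.sum_congr rfl fun j _ => ?_
        rw [Finset.mul_sum]
    _ ≤ 3 ^ s * 2 * (N + 1 : NNReal) ^ (1 / 2 - s) *
        (zeta (s - 1 / 2) * zeta (s - 1 / 2)) := by
        gcongr <;> exact sum_le_zeta (by linarith) _
    _ = _ := by ring

/-- If `|i + j + k| > N`, one of the three frequencies is at least `N / 3` in size; by symmetry each
case is `sum_outside_large_le`. -/
lemma sum_high_cube_le' {s : ℝ} (hs : 3 / 2 < s) (N : ℕ) (S : Finset ℤ) :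
    ∑ K ∈ S, (high N (decay s N ^ 3)).coeff K ≤ 3 *
      (3 ^ s * 2 * (zeta (s - 1 / 2) * zeta (s - 1 / 2)) * (N + 1 : NNReal) ^ (1 / 2 - s)) := by
  refine (sum_high_cube_le s N S).trans ?_
  set I := Finset.Icc (-(N : ℤ)) N with hI
  have key := sum_outside_large_le hs N
  rw [← hI] at key
  set B := 3 ^ s * 2 * (zeta (s - 1 / 2) * zeta (s - 1 / 2)) * (N + 1 : NNReal) ^ (1 / 2 - s)
  calc ∑ i ∈ I, ∑ j ∈ I, ∑ k ∈ I, outside N (i + j + k) * (wt i ^ (-s) * wt j ^ (-s) * wt k ^ (-s))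
      ≤ ∑ i ∈ I, ∑ j ∈ I, ∑ k ∈ I,
        (outside N (i + (j + k)) * (large s N i * wt j ^ (-s) * wt k ^ (-s)) +
          outside N (j + (i + k)) * (large s N j * wt i ^ (-s) * wt k ^ (-s)) +
          outside N (k + (i + j)) * (large s N k * wt i ^ (-s) * wt j ^ (-s))) := by
        refine Finset.sum_le_sum fun i _ => Finset.sum_le_sum fun j _ =>
          Finset.sum_le_sum fun k _ => ?_
        rw [show i + (j + k) = i + j + k by ring, show j + (i + k) = i + j + k by ring,
          show k + (i + j) = i + j + k by ring, ← mul_add, ← mul_add]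
        unfold outside
        split_ifs with h
        · rw [one_mul, one_mul]
          have h3 : N ≤ 3 * i.natAbs ∨ N ≤ 3 * j.natAbs ∨ N ≤ 3 * k.natAbs := by omega
          rcases h3 with h3 | h3 | h3
          · refine le_trans (le_of_eq ?_) (le_self_add.trans le_self_add)
            simp [large, h3]
          · refine le_trans (le_of_eq ?_) (le_add_self.trans le_self_add)
            simp only [large, h3, if_true]
            ring
          · refine le_trans (le_of_eq ?_) le_add_self
            simp only [large, h3, if_true]
            ring
        · simp
    _ = (∑ j ∈ I, ∑ k ∈ I, ∑ i ∈ I,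
          outside N (i + (j + k)) * (large s N i * wt j ^ (-s) * wt k ^ (-s))) +
        (∑ i ∈ I, ∑ k ∈ I, ∑ j ∈ I,
          outside N (j + (i + k)) * (large s N j * wt i ^ (-s) * wt k ^ (-s))) +
        ∑ i ∈ I, ∑ j ∈ I, ∑ k ∈ I,
          outside N (k + (i + j)) * (large s N k * wt i ^ (-s) * wt j ^ (-s)) := by
        simp only [Finset.sum_add_distrib]
        congr 2
        · rw [Finset.sum_comm]
          exact Finset.sum_congr rfl fun j _ => Finset.sum_comm
        · exact Finset.sum_congr rfl fun i _ => Finset.sum_comm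
    _ ≤ B + B + B := add_le_add (add_le_add key key) key
    _ = 3 * B := by ring

/-- Frequencies `> N` of the cube only arise from interactions near the cut-off. -/
lemma exists_high_cube_mul_pow_le {s : ℝ} (hs : 3 / 2 < s) (m : ℕ) : ∃ C : NNReal, ∀ N : ℕ,
    (high N (decay s N ^ 3) * decay s N ^ (m + 1)).coeff 0 ≤
      C * (N + 1 : NNReal) ^ (1 / 2 - 2 * s) := by
  obtain ⟨C, hC⟩ := exists_decay_pow_le (s := s) (by linarith) m
  refine ⟨C * (3 * (3 ^ s * 2 * (zeta (s - 1 / 2) * zeta (s - 1 / 2)))), fun N => ?_⟩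
  have h0 : (N + 1 : NNReal) ≠ 0 := by positivity
  rw [mul_coeff]
  calc ∑ K ∈ (high N (decay s N ^ 3)).coeff.support,
        (high N (decay s N ^ 3)).coeff K * (decay s N ^ (m + 1)).coeff (0 - K)
      ≤ ∑ K ∈ (high N (decay s N ^ 3)).coeff.support,
        (high N (decay s N ^ 3)).coeff K * (C * (N + 1 : NNReal) ^ (-s)) := by
        -- The second factor is evaluated at `-K` with `|K| > N`, which gains another `(N +
        -- 1)^{-s}`.
        refine Finset.sum_le_sum fun K hK => ?_
        gcongr
        refine (hC N _).trans (mul_le_mul_right ?_ C)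
        rw [Finsupp.mem_support_iff, high_coeff] at hK
        have hK' : N < K.natAbs := by
          by_contra h
          simp [not_lt.1 h] at hK
        rw [zero_sub, wt_neg, NNReal.rpow_neg, NNReal.rpow_neg]
        gcongr
        rw [wt, add_comm]
        gcongr
    _ = (∑ K ∈ (high N (decay s N ^ 3)).coeff.support, (high N (decay s N ^ 3)).coeff K) *
        (C * (N + 1 : NNReal) ^ (-s)) := by rw [Finset.sum_mul]
    _ ≤ 3 * (3 ^ s * 2 * (zeta (s - 1 / 2) * zeta (s - 1 / 2)) * (N + 1 : NNReal) ^ (1 / 2 - s)) *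
        (C * (N + 1 : NNReal) ^ (-s)) := by
        gcongr
        exact sum_high_cube_le' hs N _
    _ = _ := by
        rw [show 1 / 2 - 2 * s = (1 / 2 - s) + -s by ring, NNReal.rpow_add h0 (1 / 2 - s) (-s)]
        ring

end Maj

end Convolution

/-! ### The discarded part of the nonlinearity and the resulting energy drift. -/

section Defect

open Maj TrigPoly

/-- The part of `f` of frequencies larger than `N`. -/
def TrigPoly.high (N : ℕ) (f : TrigPoly) : TrigPoly :=
  mult (fun k => if k.natAbs ≤ N then 0 else 1) f

lemma TrigPoly.high_coeff (N : ℕ) (f : TrigPoly) (k : ℤ) :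
    (TrigPoly.high N f).coeff k = if k.natAbs ≤ N then 0 else f.coeff k := by
  simp [TrigPoly.high]

lemma TrigPoly.lt_of_high_ne_zero {N : ℕ} {f : TrigPoly} {k : ℤ}
    (h : (TrigPoly.high N f).coeff k ≠ 0) : N < k.natAbs := by
  by_contra h0
  rw [TrigPoly.high_coeff, if_pos (not_lt.1 h0)] at h
  exact h rfl

lemma Dom.high {f : TrigPoly} {F : Maj} (h : Dom f F) (N : ℕ) :
    Dom (TrigPoly.high N f) (Maj.high N F) := fun k => by
  rw [TrigPoly.high_coeff, Maj.high_coeff]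
  split_ifs
  · simp
  · exact h k

lemma TrigPoly.cj_high (N : ℕ) (f : TrigPoly) :
    cj (TrigPoly.high N f) = TrigPoly.high N (cj f) := by
  ext k
  simp only [coeff_cj, TrigPoly.high_coeff, Int.natAbs_neg]
  split_ifs <;> simp

/-- The direction in which the truncated equation differs from the full one. -/
def defectDir (N : ℕ) (f : TrigPoly) : TrigPoly := (-6 : ℂ) • TrigPoly.high N (nonlin f)

lemma cj_nonlin (f : TrigPoly) : cj (nonlin f) = -(cj f * f * D (cj f)) := by
  simp only [nonlin, map_mul, cj_cj, cj_D]
  ring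

/-- The single derivative in the nonlinearity costs one factor `N + 1`. The conjugate has the same
form up to sign, because conjugation anticommutes with `D`. -/
lemma dom_nonlin {N : ℕ} {a : Maj} {f : TrigPoly} (h : LowMajorizes N a f) :
    Dom (nonlin f) ((N + 1 : ℕ) * a ^ 3) ∧ Dom (cj (nonlin f)) ((N + 1 : ℕ) * a ^ 3) := by
  have h1 : T 1 a ≤ ((N + 1) ^ 1 : ℕ) * a := h.supp.T_le 1
  rw [pow_one] at h1
  have e : a * a * T 1 a ≤ (N + 1 : ℕ) * a ^ 3 :=
    (mul_le_mul_right h1 (a * a)).trans (le_of_eq (by ring))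
  refine ⟨((h.dom.mul h.dom_cj).mul h.dom.D).mono e, ?_⟩
  rw [cj_nonlin]
  exact ((h.dom_cj.mul h.dom).mul h.dom_cj.D).neg.mono e

lemma Dom.smul {f : TrigPoly} {F : Maj} (h : Dom f F) (c : ℂ) {C : ℕ} (hc : ‖c‖₊ = C) :
    Dom (c • f) (C * F) := fun k => by
  rw [AddMonoidAlgebra.coeff_smul_apply, smul_eq_mul, nnnorm_mul, natCast_mul_coeff, hc]
  gcongr
  exact h k

lemma high_natCast_mul (N n : ℕ) (F : Maj) : Maj.high N (n * F) = n * Maj.high N F := by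
  ext k
  simp only [Maj.high_coeff, natCast_mul_coeff]
  split_ifs <;> simp

lemma dirMajorizes_defectDir {N : ℕ} {a : Maj} {f : TrigPoly} (h : LowMajorizes N a f) :
    DirMajorizes N ((6 : ℕ) * ((N + 1 : ℕ) * Maj.high N (a ^ 3))) (defectDir N f)
      (-cj (defectDir N f)) where
  dom_left := by
    have := ((dom_nonlin h).1.high N).smul (-6) (C := 6) (by ext; simp)
    rwa [high_natCast_mul] at this
  dom_right := by
    have := ((dom_nonlin h).2.high N).smul (-6) (C := 6) (by ext; simp)
    rw [high_natCast_mul] at this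
    rw [defectDir, cj_smul, cj_high]
    have e : (starRingEnd ℂ) (-6) = -6 := by rw [map_neg, map_ofNat]
    rw [e]
    exact this.neg
  supp := by
    refine Maj.SuppLE.natCast_mul (Maj.SuppLE.natCast_mul ?_ _) _
    intro k hk
    refine (h.supp.pow 3) k fun h0 => hk ?_
    have := le_def.1 (Maj.high_le N (a ^ 3)) k
    rw [h0] at this
    simpa using this

/-- The energy drift of the truncated flow for data with decay `⟨k⟩^{-s}`. -/
lemma exists_nnnorm_energyLin_defect_le {n : ℕ} (hn : 1 ≤ n) {s : ℝ} (hs : 3 / 2 < s) {l : ℕ}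
    (hl : l ≤ n) : ∃ C : NNReal, ∀ (N : ℕ) (f : TrigPoly) (a : Maj) (Λ : NNReal),
      LowMajorizes N a f → a ≤ Λ • decay s N →
      ‖energyLin f (defectDir N f) (-cj (defectDir N f)) (2 * l + 1)‖₊ ≤
        C * Λ ^ (4 * n + 6) * (N + 1 : NNReal) ^ (2 * n - 1 / 2 - 2 * s) := by
  obtain ⟨C, hC⟩ := exists_nnnorm_energyLin_le l
  obtain ⟨C', hC'⟩ := exists_high_cube_mul_pow_le hs (4 * n + 2)
  refine ⟨C * (6 * C'), fun N f a Λ ha hΛ => ?_⟩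
  have hdir := dirMajorizes_defectDir ha
  refine (hC N f _ _ a _ ha hdir ?_ ?_).trans ?_
  · intro j hj
    exact lt_of_high_ne_zero (right_ne_zero_of_mul hj)
  · intro j hj
    rw [defectDir, cj_smul, cj_high, ← smul_neg, AddMonoidAlgebra.coeff_smul_apply] at hj
    have := right_ne_zero_of_mul hj
    rw [AddMonoidAlgebra.coeff_neg, Finsupp.neg_apply, neg_ne_zero] at this
    exact lt_of_high_ne_zero this
  -- Since `1 ≤ a`, the power may be raised from `4l + 3` to `4n + 3`, so every level `l ≤ n` has
  -- the same degree `4n + 6` in `Λ`.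
  have h1 : Maj.high N (a ^ 3) * a ^ (4 * l + 3) ≤
      Λ ^ (4 * n + 6) • (Maj.high N (decay s N ^ 3) * decay s N ^ (4 * n + 2 + 1)) := by
    calc Maj.high N (a ^ 3) * a ^ (4 * l + 3)
        ≤ Maj.high N ((Λ • decay s N) ^ 3) * (Λ • decay s N) ^ (4 * n + 3) := by
          refine mul_le_mul' (Maj.high_mono N (pow_le_pow_left' hΛ 3)) ?_
          exact (Maj.pow_le_pow' ha.one_le (by omega)).trans (pow_le_pow_left' hΛ _)
      _ = _ := by
          rw [smul_pow, smul_pow, Maj.high_smul, smul_mul_smul_comm, ← pow_add]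
          congr 2
          omega
  have h2 : ((6 : ℕ) * ((N + 1 : ℕ) * Maj.high N (a ^ 3)) * a ^ (4 * l + 3)).coeff 0 ≤
      6 * (N + 1) * (Λ ^ (4 * n + 6) * (C' * (N + 1 : NNReal) ^ (1 / 2 - 2 * s))) := by
    rw [mul_assoc, mul_assoc, natCast_mul_coeff, natCast_mul_coeff, mul_assoc]
    push_cast
    gcongr
    refine (le_def.1 h1 0).trans ?_
    rw [AddMonoidAlgebra.coeff_smul_apply, smul_eq_mul]
    gcongr
    exact hC' N
  have h0 : (N + 1 : NNReal) ≠ 0 := by positivity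
  have h1N : (1 : NNReal) ≤ N + 1 := le_add_self
  -- The exponents add up as `(2n - 2) + 1 + (1/2 - 2s)`: energy density, derivative in the
  -- nonlinearity, convolution sum.
  calc C * ((N + 1 : NNReal) ^ (2 * l - 2) *
        ((6 : ℕ) * ((N + 1 : ℕ) * Maj.high N (a ^ 3)) * a ^ (4 * l + 3)).coeff 0)
      ≤ C * ((N + 1 : NNReal) ^ (2 * n - 2) *
        (6 * (N + 1) * (Λ ^ (4 * n + 6) * (C' * (N + 1 : NNReal) ^ (1 / 2 - 2 * s))))) := by
        gcongr
    _ = C * (6 * C') * Λ ^ (4 * n + 6) *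
        ((N + 1 : NNReal) ^ (2 * n - 2 + 1) * (N + 1 : NNReal) ^ (1 / 2 - 2 * s)) := by ring
    _ = _ := by
        rw [← NNReal.rpow_natCast (_ + 1) (2 * n - 2 + 1), ← NNReal.rpow_add h0]
        congr 2
        rw [show 2 * n - 2 + 1 = 2 * n - 1 by omega, Nat.cast_sub (by omega)]
        push_cast
        ring

end Defect

/-! ### Global flows of vector fields with a proper conserved quantity. -/

section Flow

variable {V : Type*} [NormedAddCommGroup V] [NormedSpace ℝ V] [FiniteDimensional ℝ V]

/-- A bounded Lipschitz vector field has global integral curves. -/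
lemma exists_integralCurve_of_lipschitz {X : V → V} {K L : NNReal} (hX : LipschitzWith K X)
    (hL : ∀ x, ‖X x‖ ≤ L) (x₀ : V) :
    ∃ γ : ℝ → V, γ 0 = x₀ ∧ ∀ t, HasDerivAt γ (X (γ t)) t := by
  have : CompleteSpace V := FiniteDimensional.complete ℝ V
  have hloc : ∀ T : ℕ, ∃ γ : ℝ → V, γ 0 = x₀ ∧
      ∀ t ∈ Set.Ioo (-(T + 1 : ℝ)) (T + 1), HasDerivAt γ (X (γ t)) t := by
    intro T
    have hT : (0 : ℝ) ∈ Set.Icc (-(T + 1 : ℝ)) (T + 1) := ⟨by linarith [Nat.cast_nonneg (α := ℝ) T],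
      by positivity⟩
    have hp : IsPicardLindelof (fun _ => X) (⟨0, hT⟩ : Set.Icc (-(T + 1 : ℝ)) (T + 1)) x₀
        (L * (T + 1)) 0 L K := by
      refine IsPicardLindelof.of_time_independent (fun x _ => hL x) hX.lipschitzOnWith ?_
      simp
    obtain ⟨γ, h0, hγ⟩ := hp.exists_eq_forall_mem_Icc_hasDerivWithinAt₀
    exact ⟨γ, h0, fun t ht => (hγ t (Set.Ioo_subset_Icc_self ht)).hasDerivAt
      (Icc_mem_nhds ht.1 ht.2)⟩
  choose γ h0 hγ using hloc
  have hagree : ∀ (m n : ℕ), m ≤ n → ∀ t ∈ Set.Ioo (-(m + 1 : ℝ)) (m + 1), γ m t = γ n t := by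
    intro m n hmn
    have hmn' : (m : ℝ) ≤ n := by exact_mod_cast hmn
    refine ODE_solution_unique_of_mem_Ioo (v := fun _ => X) (s := fun _ => Set.univ) (K := K)
      (t₀ := 0) (fun t _ => hX.lipschitzOnWith) ⟨by linarith [Nat.cast_nonneg (α := ℝ) m],
        by positivity⟩ (fun t ht => ⟨hγ m t ht, trivial⟩) (fun t ht => ⟨hγ n t ?_, trivial⟩)
      ((h0 m).trans (h0 n).symm)
    exact ⟨by linarith [ht.1], by linarith [ht.2]⟩
  refine ⟨fun t => γ ⌈|t|⌉₊ t, h0 _, fun t => ?_⟩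
  -- The index is raised by one so that a single local curve represents the patched curve on a whole
  -- neighbourhood of `t`.
  set m := ⌈|t|⌉₊ + 1 with hm
  have htm : |t| < m := by
    rw [hm]; push_cast
    linarith [Nat.le_ceil |t|]
  have hmem : ∀ s : ℝ, s ∈ Set.Ioo (-(⌈|s|⌉₊ + 1 : ℝ)) (⌈|s|⌉₊ + 1) := fun s => by
    rw [Set.mem_Ioo, ← abs_lt]
    linarith [Nat.le_ceil |s|]
  have heq : (fun s : ℝ => γ ⌈|s|⌉₊ s) =ᶠ[𝓝 t] γ m := by
    have : ∀ᶠ s : ℝ in 𝓝 t, |s| < m := continuous_abs.continuousAt.eventually_lt continuousAt_const htm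
    filter_upwards [this] with s hs
    exact hagree _ _ (Nat.ceil_le.2 hs.le) s (hmem s)
  have ht' : γ ⌈|t|⌉₊ t = γ m t := heq.eq_of_nhds
  refine HasDerivAt.congr_of_eventuallyEq ?_ heq
  change HasDerivAt (γ m) (X (γ ⌈|t|⌉₊ t)) t
  rw [ht']
  refine hγ m t ?_
  rw [Set.mem_Ioo, ← abs_lt]
  linarith

/-- A smooth vector field with a conserved quantity whose sublevel sets are bounded and convex. -/
structure ConservedField (X : V → V) (Q : V → ℝ) : Prop where
  contDiff_field : ContDiff ℝ ∞ X
  contDiff_quantity : ContDiff ℝ ∞ Q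
  fderiv_apply : ∀ x, fderiv ℝ Q x (X x) = 0
  bounded : ∀ c, Bornology.IsBounded {x | Q x ≤ c}
  convex : ∀ c, Convex ℝ {x | Q x ≤ c}

namespace ConservedField

variable {X : V → V} {Q : V → ℝ} (hX : ConservedField X Q)

include hX

lemma isCompact (c : ℝ) : IsCompact {x | Q x ≤ c} := by
  have : ProperSpace V := FiniteDimensional.proper ℝ V
  exact Metric.isCompact_of_isClosed_isBounded
    (isClosed_le hX.contDiff_quantity.continuous continuous_const) (hX.bounded c)

/-- The scalar factor `η` makes the lemma apply also to the cut-off field used for existence. -/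
lemma const_of_hasDerivAt {γ : ℝ → V} {η : ℝ → ℝ}
    (hγ : ∀ t, HasDerivAt γ (η t • X (γ t)) t) (s t : ℝ) : Q (γ s) = Q (γ t) := by
  have hd : ∀ t, HasDerivAt (fun t => Q (γ t)) 0 t := by
    intro t
    have h1 := (hX.contDiff_quantity.differentiable (by simp) (γ t)).hasFDerivAt.comp_hasDerivAt t
      (hγ t)
    rw [map_smul, hX.fderiv_apply, smul_zero] at h1
    exact h1
  exact is_const_of_deriv_eq_zero (fun t => (hd t).differentiableAt) (fun t => (hd t).deriv) s t

lemma const_of_integralCurve {γ : ℝ → V} (hγ : ∀ t, HasDerivAt γ (X (γ t)) t) (s t : ℝ) :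
    Q (γ s) = Q (γ t) :=
  hX.const_of_hasDerivAt (η := fun _ => 1) (by simpa using hγ) s t

/-- Compactness of the sublevel set bounds the derivative, and convexity turns this into a Lipschitz
bound. -/
lemma exists_lipschitzOn {G : V → V} (hG : ContDiff ℝ 1 G) (c : ℝ) :
    ∃ K : NNReal, LipschitzOnWith K G {x | Q x ≤ c} := by
  obtain ⟨C, hC⟩ := (hX.isCompact c).exists_bound_of_continuousOn
    (hG.continuous_fderiv (by simp)).continuousOn
  refine ⟨C.toNNReal, (hX.convex c).lipschitzOnWith_of_nnnorm_fderiv_le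
    (fun x _ => (hG.differentiable (by simp)) x) fun x hx => ?_⟩
  exact NNReal.le_toNNReal_of_coe_le (hC x hx)

lemma exists_integralCurve (x₀ : V) :
    ∃ γ : ℝ → V, γ 0 = x₀ ∧ ∀ t, HasDerivAt γ (X (γ t)) t := by
  set c := Q x₀
  -- `φ` is `1` up to `c + 1` and `0` from `c + 2` on. The field `φ(Q) X` has compact support and is
  -- parallel to `X`, so it conserves `Q` too; the curve stays where `Q = c` and thus follows `X`
  -- itself.
  set φ : ℝ → ℝ := fun s => Real.smoothTransition (c + 2 - s)
  have hφ : ContDiff ℝ ∞ φ := Real.smoothTransition.contDiff.comp (contDiff_const.sub contDiff_id)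
  set Y : V → V := fun x => φ (Q x) • X x
  have hY : ContDiff ℝ ∞ Y := (hφ.comp hX.contDiff_quantity).smul hX.contDiff_field
  have hcpt : HasCompactSupport Y := by
    refine HasCompactSupport.of_support_subset_isCompact (hX.isCompact (c + 2)) fun x hx => ?_
    by_contra h
    refine hx ?_
    have : φ (Q x) = 0 := by
      refine Real.smoothTransition.zero_of_nonpos ?_
      have : c + 2 < Q x := not_le.1 h
      linarith
    simp [Y, this]
  obtain ⟨K, hK⟩ := hY.lipschitzWith_of_hasCompactSupport hcpt (by simp)
  obtain ⟨L, hL⟩ := hcpt.exists_bound_of_continuous hY.continuous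
  obtain ⟨γ, h0, hγ⟩ := exists_integralCurve_of_lipschitz (L := L.toNNReal) hK
    (fun x => (hL x).trans (Real.le_coe_toNNReal L)) x₀
  refine ⟨γ, h0, fun t => ?_⟩
  have h1 : Q (γ t) = c := by
    rw [hX.const_of_hasDerivAt hγ t 0, h0]
  have h2 : φ (Q (γ t)) = 1 := by
    rw [h1]
    exact Real.smoothTransition.one_of_one_le (by linarith)
  have h3 := hγ t
  simp only [Y, h2, one_smul] at h3
  exact h3

lemma integralCurve_unique {γ γ' : ℝ → V} (hγ : ∀ t, HasDerivAt γ (X (γ t)) t)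
    (hγ' : ∀ t, HasDerivAt γ' (X (γ' t)) t) {t₀ : ℝ} (h : γ t₀ = γ' t₀) : γ = γ' := by
  obtain ⟨K, hK⟩ := hX.exists_lipschitzOn (hX.contDiff_field.of_le (by simp)) (Q (γ t₀))
  refine ODE_solution_unique_univ (v := fun _ => X) (s := fun _ => {x | Q x ≤ Q (γ t₀)}) (K := K)
    (t₀ := t₀) (fun _ => hK) (fun t => ⟨hγ t, ?_⟩) (fun t => ⟨hγ' t, ?_⟩) h
  · exact (hX.const_of_integralCurve hγ t t₀).le
  · rw [h]
    exact (hX.const_of_integralCurve hγ' t t₀).le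

/-- The flow of a vector field with a proper conserved quantity. -/
def flowMap (t : ℝ) (x : V) : V := (hX.exists_integralCurve x).choose t

lemma flowMap_zero (x : V) : hX.flowMap 0 x = x := (hX.exists_integralCurve x).choose_spec.1

lemma hasDerivAt_flowMap (t : ℝ) (x : V) :
    HasDerivAt (fun s => hX.flowMap s x) (X (hX.flowMap t x)) t :=
  (hX.exists_integralCurve x).choose_spec.2 t

lemma eq_flowMap {γ : ℝ → V} (hγ : ∀ t, HasDerivAt γ (X (γ t)) t) (t : ℝ) :
    γ t = hX.flowMap t (γ 0) :=
  congrFun (hX.integralCurve_unique hγ (fun t => hX.hasDerivAt_flowMap t (γ 0))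
    (t₀ := 0) (hX.flowMap_zero _).symm) t

lemma flowMap_add (s t : ℝ) (x : V) :
    hX.flowMap (s + t) x = hX.flowMap s (hX.flowMap t x) := by
  have := hX.eq_flowMap (γ := fun s => hX.flowMap (s + t) x)
    (fun s => (hX.hasDerivAt_flowMap (s + t) x).comp_add_const s t) s
  simpa using this

lemma flowMap_neg_flowMap (t : ℝ) (x : V) : hX.flowMap (-t) (hX.flowMap t x) = x := by
  rw [← hX.flowMap_add, neg_add_cancel, hX.flowMap_zero]

lemma flowMap_flowMap_neg (t : ℝ) (x : V) : hX.flowMap t (hX.flowMap (-t) x) = x := by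
  rw [← hX.flowMap_add, add_neg_cancel, hX.flowMap_zero]

lemma quantity_flowMap (t : ℝ) (x : V) : Q (hX.flowMap t x) = Q x := by
  have := hX.const_of_integralCurve (fun t => hX.hasDerivAt_flowMap t x) t 0
  rwa [hX.flowMap_zero] at this

lemma continuous_flowMap_left (x : V) : Continuous fun t => hX.flowMap t x :=
  continuous_iff_continuousAt.2 fun t => (hX.hasDerivAt_flowMap t x).continuousAt

lemma neg : ConservedField (fun x => -X x) Q where
  contDiff_field := hX.contDiff_field.neg
  contDiff_quantity := hX.contDiff_quantity
  fderiv_apply x := by rw [map_neg, hX.fderiv_apply, neg_zero]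
  bounded := hX.bounded
  convex := hX.convex

lemma flowMap_neg_field (t : ℝ) (x : V) : hX.neg.flowMap t x = hX.flowMap (-t) x := by
  have := hX.neg.eq_flowMap (γ := fun s => hX.flowMap (-s) x) (fun s => by
    have h := (hX.hasDerivAt_flowMap (-s) x).scomp s (hasDerivAt_neg s)
    rw [neg_one_smul] at h
    exact h) t
  rw [this, neg_zero, hX.flowMap_zero]

lemma dist_flowMap_le {c : ℝ} {K : NNReal} (hK : LipschitzOnWith K X {x | Q x ≤ c}) {x y : V}
    (hx : Q x ≤ c) (hy : Q y ≤ c) {t : ℝ} (ht : 0 ≤ t) :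
    dist (hX.flowMap t x) (hX.flowMap t y) ≤ dist x y * Real.exp (K * t) := by
  have := dist_le_of_trajectories_ODE_of_mem (v := fun _ => X) (s := fun _ => {x | Q x ≤ c})
    (K := K) (a := 0) (b := t) (δ := dist x y) (f := fun t => hX.flowMap t x)
    (g := fun t => hX.flowMap t y)
    (fun _ _ => hK) (hX.continuous_flowMap_left x).continuousOn
    (fun s _ => (hX.hasDerivAt_flowMap s x).hasDerivWithinAt)
    (fun s _ => (hX.quantity_flowMap s x).trans_le hx)
    (hX.continuous_flowMap_left y).continuousOn
    (fun s _ => (hX.hasDerivAt_flowMap s y).hasDerivWithinAt)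
    (fun s _ => (hX.quantity_flowMap s y).trans_le hy)
    (by rw [hX.flowMap_zero, hX.flowMap_zero]) t ⟨ht, le_rfl⟩
  simpa using this

/-- By Grönwall the flow is Lipschitz on the invariant set `Q ≤ Q x + 1`, which is a neighbourhood
of `x`. -/
lemma continuous_flowMap_of_nonneg {t : ℝ} (ht : 0 ≤ t) : Continuous (hX.flowMap t) := by
  rw [continuous_iff_continuousAt]
  intro x
  obtain ⟨K, hK⟩ := hX.exists_lipschitzOn (hX.contDiff_field.of_le (by simp)) (Q x + 1)
  have hnhds : {y | Q y ≤ Q x + 1} ∈ 𝓝 x := by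
    filter_upwards [hX.contDiff_quantity.continuous.continuousAt.eventually_lt continuousAt_const
      (show Q x < Q x + 1 by linarith)] with y hy using hy.le
  have hl : LipschitzOnWith (Real.exp (K * t)).toNNReal (hX.flowMap t) {y | Q y ≤ Q x + 1} := by
    refine LipschitzOnWith.of_dist_le_mul fun y hy z hz => ?_
    rw [Real.coe_toNNReal _ (Real.exp_pos _).le, mul_comm]
    exact hX.dist_flowMap_le hK hy hz ht
  exact hl.continuousOn.continuousAt hnhds

lemma continuous_flowMap (t : ℝ) : Continuous (hX.flowMap t) := by
  rcases le_total 0 t with ht | ht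
  · exact hX.continuous_flowMap_of_nonneg ht
  · have := hX.neg.continuous_flowMap_of_nonneg (t := -t) (by linarith)
    refine this.congr fun x => ?_
    rw [hX.flowMap_neg_field, neg_neg]

/-- The flow as a homeomorphism. -/
def flowHomeo (t : ℝ) : V ≃ₜ V where
  toFun := hX.flowMap t
  invFun := hX.flowMap (-t)
  left_inv := hX.flowMap_neg_flowMap t
  right_inv := hX.flowMap_flowMap_neg t
  continuous_toFun := hX.continuous_flowMap t
  continuous_invFun := hX.continuous_flowMap (-t)

end ConservedField

end Flow

/-! ### Liouville's theorem through Euler steps, without differentiating the flow in the initial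
datum. -/

section Liouville

/-- The determinant is a polynomial in the entries, so it suffices to identify directional
derivatives, by expanding `det (1 + h M)` to first order. -/
lemma hasFDerivAt_det_one_add {d : ℕ} :
    ∃ f' : (Fin d → Fin d → ℝ) →L[ℝ] ℝ, (∀ M, f' M = Matrix.trace (Matrix.of M)) ∧
      HasFDerivAt (fun M : Fin d → Fin d → ℝ => Matrix.det (1 + Matrix.of M)) f' 0 := by
  have hd : Differentiable ℝ
      (fun M : Fin d → Fin d → ℝ => Matrix.det (1 + Matrix.of M)) := by
    simp only [Matrix.det_apply, Matrix.add_apply, Matrix.of_apply]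
    fun_prop
  refine ⟨_, fun M => ?_, (hd 0).hasFDerivAt⟩
  have h1 : HasDerivAt (fun h : ℝ => h • M) M 0 := by
    simpa using (hasDerivAt_id (0 : ℝ)).smul_const M
  have h2 := HasFDerivAt.comp_hasDerivAt_of_eq (0 : ℝ) (hd 0).hasFDerivAt h1 (by simp)
  have h3 : HasDerivAt (fun h : ℝ => Matrix.det (1 + Matrix.of (h • M)))
      (Matrix.trace (Matrix.of M)) 0 := by
    have : (fun h : ℝ => Matrix.det (1 + Matrix.of (h • M))) = fun h =>
        1 + Matrix.trace (Matrix.of M) * h +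
          (Matrix.det (1 + (Polynomial.X : Polynomial ℝ) •
            (Matrix.of M).map Polynomial.C)).divX.divX.eval h * h ^ 2 := by
      funext h
      exact Matrix.det_one_add_smul h (Matrix.of M)
    rw [this]
    set p := (Matrix.det (1 + (Polynomial.X : Polynomial ℝ) •
            (Matrix.of M).map Polynomial.C)).divX.divX
    have h4 := (((hasDerivAt_id (0 : ℝ)).const_mul (Matrix.trace (Matrix.of M))).const_add 1).add
      ((p.hasDerivAt 0).mul (hasDerivAt_pow 2 (0 : ℝ)))
    refine h4.congr_deriv ?_
    simp
  exact h2.unique h3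

variable {V : Type*} [NormedAddCommGroup V] [NormedSpace ℝ V] [FiniteDimensional ℝ V]

/-- For trace zero the first-order term vanishes. Fréchet rather than directional differentiability
makes `δ` uniform over the ball `‖A‖ ≤ M`. -/
lemma exists_abs_det_one_add_smul_le (M : ℝ) {ε : ℝ} (hε : 0 < ε) :
    ∃ δ > 0, ∀ A : V →L[ℝ] V, ‖A‖ ≤ M → LinearMap.trace ℝ V A = 0 →
      ∀ h ∈ Set.Icc 0 δ, |(ContinuousLinearMap.id ℝ V + h • A).det| ≤ 1 + ε * h := by
  obtain ⟨f', hf', hf⟩ := hasFDerivAt_det_one_add (d := Module.finrank ℝ V)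
  set b := Module.finBasis ℝ V
  let L₀ : (V →L[ℝ] V) →ₗ[ℝ] (Fin (Module.finrank ℝ V) → Fin (Module.finrank ℝ V) → ℝ) :=
    { toFun := fun A => Matrix.of.symm (LinearMap.toMatrix b b A)
      map_add' := fun A B => by simp; rfl
      map_smul' := fun c A => by simp; rfl }
  let L := LinearMap.toContinuousLinearMap L₀
  have hL : ∀ A : V →L[ℝ] V, Matrix.of (L A) = LinearMap.toMatrix b b A := fun A => rfl
  set C := ‖L‖ * |M| + 1
  have hC : 0 < C := by positivity
  have h1 := (hasFDerivAt_iff_isLittleO_nhds_zero.1 hf).def (c := ε / C) (by positivity)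
  obtain ⟨r, hr, h2⟩ := Metric.eventually_nhds_iff_ball.1 h1
  refine ⟨r / (2 * C), by positivity, fun A hA htr h hh => ?_⟩
  have hAC : ‖L A‖ ≤ C := by
    refine (L.le_opNorm A).trans ?_
    have : ‖L‖ * ‖A‖ ≤ ‖L‖ * |M| := by
      gcongr
      exact hA.trans (le_abs_self M)
    linarith
  have hnorm : ‖L (h • A)‖ ≤ h * C := by
    rw [map_smul, norm_smul, Real.norm_eq_abs, abs_of_nonneg hh.1]
    exact mul_le_mul_of_nonneg_left hAC hh.1
  have hlt : h * C < r := by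
    have : h * C ≤ r / (2 * C) * C := mul_le_mul_of_nonneg_right hh.2 hC.le
    have h3 : r / (2 * C) * C = r / 2 := by field_simp
    linarith
  have h3 := h2 (L (h • A)) (by simpa using hnorm.trans_lt hlt)
  have h4 : (ContinuousLinearMap.id ℝ V + h • A).det = Matrix.det (1 + Matrix.of (L (h • A))) := by
    rw [hL, ContinuousLinearMap.det, ← LinearMap.det_toMatrix b]
    congr 1
    have : ((ContinuousLinearMap.id ℝ V + h • A : V →L[ℝ] V) : V →ₗ[ℝ] V) =
      LinearMap.id + ((h • A : V →L[ℝ] V) : V →ₗ[ℝ] V) := rfl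
    rw [this, map_add, LinearMap.toMatrix_id]
  have h5 : f' (L (h • A)) = 0 := by
    rw [hf', hL, ← LinearMap.trace_eq_matrix_trace]
    simp [htr]
  rw [h4]
  simp only [zero_add, h5, sub_zero] at h3
  have h6 : Matrix.det (1 + Matrix.of (0 : Fin (Module.finrank ℝ V) → Fin _ → ℝ)) = (1 : ℝ) := by
    simp
  rw [h6, Real.norm_eq_abs] at h3
  have h7 : ε / C * ‖L (h • A)‖ ≤ ε * h := by
    calc ε / C * ‖L (h • A)‖ ≤ ε / C * (h * C) := by gcongr
      _ = ε * h := by field_simp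
  have := abs_sub_abs_le_abs_sub (Matrix.det (1 + Matrix.of (L (h • A)))) 1
  rw [abs_one] at this
  linarith

namespace ConservedField

variable {X : V → V} {Q : V → ℝ} (hX : ConservedField X Q)

include hX

/-- A Lipschitz form of the one-step error of Euler's method. The second time derivative of the flow
is `DX · X`, which is Lipschitz on sublevel sets; integrating its difference along two trajectories
twice gives `h²`. -/
lemma exists_norm_flowMap_sub_le (c : ℝ) :
    ∃ C : ℝ, 0 ≤ C ∧ ∀ x y, Q x ≤ c → Q y ≤ c → ∀ h ∈ Set.Icc (0 : ℝ) 1,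
      ‖hX.flowMap h x - hX.flowMap h y - ((x + h • X x) - (y + h • X y))‖ ≤
        C * h ^ 2 * ‖x - y‖ := by
  obtain ⟨K, hK⟩ := hX.exists_lipschitzOn (hX.contDiff_field.of_le (by simp)) c
  have hG : ContDiff ℝ 1 fun x => fderiv ℝ X x (X x) :=
    (((hX.contDiff_field.fderiv_right (m := ∞) le_rfl).of_le (by simp)).clm_apply
      (hX.contDiff_field.of_le (by simp)))
  obtain ⟨K', hK'⟩ := hX.exists_lipschitzOn hG c
  refine ⟨K' * Real.exp K, by positivity, fun x y hx hy h hh => ?_⟩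
  have hXd := hX.contDiff_field.differentiable (by simp)
  have he : ∀ s, HasDerivAt (fun s => X (hX.flowMap s x) - X (hX.flowMap s y))
      (fderiv ℝ X (hX.flowMap s x) (X (hX.flowMap s x)) -
        fderiv ℝ X (hX.flowMap s y) (X (hX.flowMap s y))) s := fun s =>
    ((hXd _).hasFDerivAt.comp_hasDerivAt s (hX.hasDerivAt_flowMap s x)).sub
      ((hXd _).hasFDerivAt.comp_hasDerivAt s (hX.hasDerivAt_flowMap s y))
  have hdist : ∀ s ∈ Set.Icc (0 : ℝ) 1,
      ‖hX.flowMap s x - hX.flowMap s y‖ ≤ Real.exp K * ‖x - y‖ := by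
    intro s hs
    have h1 := hX.dist_flowMap_le hK hx hy hs.1
    rw [dist_eq_norm, dist_eq_norm, mul_comm] at h1
    refine h1.trans (mul_le_mul_of_nonneg_right ?_ (norm_nonneg _))
    refine Real.exp_le_exp.2 ?_
    exact mul_le_of_le_one_right K.2 hs.2
  have hE : ∀ s ∈ Set.Icc (0 : ℝ) 1,
      ‖(X (hX.flowMap s x) - X (hX.flowMap s y)) - (X x - X y)‖ ≤
        K' * Real.exp K * ‖x - y‖ * s := by
    intro s hs
    have := norm_image_sub_le_of_norm_deriv_le_segment' (a := 0) (b := 1)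
      (C := K' * Real.exp K * ‖x - y‖) (fun s _ => (he s).hasDerivWithinAt) (fun s hs => ?_) s hs
    · simpa [hX.flowMap_zero] using this
    · have h1 := hK'.norm_sub_le ((hX.quantity_flowMap s x).trans_le hx)
        ((hX.quantity_flowMap s y).trans_le hy)
      refine h1.trans ?_
      rw [mul_assoc]
      exact mul_le_mul_of_nonneg_left (hdist s ⟨hs.1, hs.2.le⟩) K'.2
  have hd : ∀ s, HasDerivAt
      (fun s => hX.flowMap s x - hX.flowMap s y - ((x + s • X x) - (y + s • X y)))
      ((X (hX.flowMap s x) - X (hX.flowMap s y)) - (X x - X y)) s := fun s => by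
    have h1 : ∀ z : V, HasDerivAt (fun s : ℝ => z + s • X z) (X z) s := fun z => by
      simpa using ((hasDerivAt_id s).smul_const (X z)).const_add z
    exact ((hX.hasDerivAt_flowMap s x).sub (hX.hasDerivAt_flowMap s y)).sub ((h1 x).sub (h1 y))
  have := norm_image_sub_le_of_norm_deriv_le_segment' (a := 0) (b := h)
      (C := K' * Real.exp K * ‖x - y‖ * h) (fun s _ => (hd s).hasDerivWithinAt) (fun s hs => ?_) h
      ⟨hh.1, le_rfl⟩
  · simp only [hX.flowMap_zero, zero_smul, add_zero, sub_self, sub_zero] at this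
    refine this.trans (le_of_eq ?_)
    ring
  · refine (hE s ⟨hs.1, hs.2.le.trans hh.2⟩).trans ?_
    exact mul_le_mul_of_nonneg_left hs.2.le (by positivity)

variable [MeasurableSpace V] [BorelSpace V]

/-- The flow over time `h` is an Euler step followed by a map with Lipschitz constant `1 + O(h²)`.
The Euler step changes volume by at most `1 + ε h / 2`, because the divergence vanishes. Hausdorff
measure handles the second map, which is only known to be Lipschitz. -/
lemma exists_measure_flowMap_image_le (htr : ∀ x, LinearMap.trace ℝ V (fderiv ℝ X x) = 0)
    (c : ℝ) {ε : ℝ} (hε : 0 < ε) :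
    ∃ δ > 0, ∀ h ∈ Set.Icc 0 δ, ∀ A, MeasurableSet A → A ⊆ {x | Q x ≤ c} →
      Measure.hausdorffMeasure (Module.finrank ℝ V) (hX.flowMap h '' A) ≤
        ENNReal.ofReal (Real.exp (ε * h)) *
          Measure.hausdorffMeasure (Module.finrank ℝ V) A := by
  obtain ⟨C, hC0, hC⟩ := hX.exists_norm_flowMap_sub_le c
  obtain ⟨K, hK⟩ := hX.exists_lipschitzOn (hX.contDiff_field.of_le (by simp)) c
  obtain ⟨M, hM⟩ := (hX.isCompact c).exists_bound_of_continuousOn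
    (hX.contDiff_field.continuous_fderiv (by simp)).continuousOn
  obtain ⟨δ₁, hδ₁, hdet⟩ := exists_abs_det_one_add_smul_le (V := V) M (ε := ε / 2) (by positivity)
  set d := Module.finrank ℝ V
  -- The four bounds serve, in this order, the one-step error, the determinant, injectivity of the
  -- Euler step, and `(1 + 2Ch²)^d ≤ exp(εh/2)`.
  set δ := min (min 1 δ₁) (min (1 / (2 * (K + 1))) (ε / (2 * (2 * C * d + 1))))
  have hδ : 0 < δ := by positivity
  refine ⟨δ, hδ, fun h hh A hA hAc => ?_⟩
  have hh1 : h ∈ Set.Icc (0 : ℝ) 1 := ⟨hh.1, hh.2.trans ((min_le_left _ _).trans (min_le_left _ _))⟩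
  have hh2 : h ∈ Set.Icc (0 : ℝ) δ₁ :=
    ⟨hh.1, hh.2.trans ((min_le_left _ _).trans (min_le_right _ _))⟩
  have hh3 : h * K ≤ 1 / 2 := by
    have : h ≤ 1 / (2 * (K + 1)) := hh.2.trans ((min_le_right _ _).trans (min_le_left _ _))
    calc h * K ≤ 1 / (2 * (K + 1)) * (K + 1) := by
          refine mul_le_mul this (by linarith) K.2 (by positivity)
      _ = 1 / 2 := by field_simp
  have hh4 : 2 * C * d * h ≤ ε / 2 := by
    have : h ≤ ε / (2 * (2 * C * d + 1)) :=
      hh.2.trans ((min_le_right _ _).trans (min_le_right _ _))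
    calc 2 * C * d * h ≤ (2 * C * d + 1) * (ε / (2 * (2 * C * d + 1))) := by
          refine mul_le_mul (by linarith) this hh.1 (by positivity)
      _ = ε / 2 := by field_simp
  have hlow : ∀ x ∈ A, ∀ y ∈ A, ‖x - y‖ ≤ 2 * ‖(x + h • X x) - (y + h • X y)‖ := by
    intro x hx y hy
    have h1 : ‖h • (X x - X y)‖ ≤ 1 / 2 * ‖x - y‖ := by
      rw [norm_smul, Real.norm_of_nonneg hh.1]
      calc h * ‖X x - X y‖ ≤ h * (K * ‖x - y‖) :=
            mul_le_mul_of_nonneg_left (hK.norm_sub_le (hAc hx) (hAc hy)) hh.1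
        _ = h * K * ‖x - y‖ := by ring
        _ ≤ 1 / 2 * ‖x - y‖ := by gcongr
    have h2 : x - y = ((x + h • X x) - (y + h • X y)) - h • (X x - X y) := by
      rw [smul_sub]; abel
    have h3 := norm_sub_le ((x + h • X x) - (y + h • X y)) (h • (X x - X y))
    rw [← h2] at h3
    linarith
  set e : V → V := fun x => x + h • X x with he
  have hinj : Set.InjOn e A := by
    intro x hx y hy hxy
    have := hlow x hx y hy
    rw [show x + h • X x = y + h • X y from hxy, sub_self, norm_zero, mul_zero] at this
    exact sub_eq_zero.1 (norm_le_zero_iff.1 this)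
  set L : NNReal := (1 + 2 * C * h ^ 2).toNNReal
  have hL : (L : ℝ) = 1 + 2 * C * h ^ 2 := Real.coe_toNNReal _ (by positivity)
  have hlip : LipschitzOnWith L (fun z => hX.flowMap h (Function.invFunOn e A z)) (e '' A) := by
    refine LipschitzOnWith.of_dist_le_mul ?_
    rintro _ ⟨x, hx, rfl⟩ _ ⟨y, hy, rfl⟩
    rw [hinj.leftInvOn_invFunOn hx, hinj.leftInvOn_invFunOn hy, dist_eq_norm, dist_eq_norm, hL]
    have h1 := hC x y (hAc hx) (hAc hy) h hh1
    have h2 := norm_sub_norm_le (hX.flowMap h x - hX.flowMap h y) (e x - e y)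
    have h3 : C * h ^ 2 * ‖x - y‖ ≤ C * h ^ 2 * (2 * ‖e x - e y‖) := by
      gcongr
      exact hlow x hx y hy
    have h4 : ‖hX.flowMap h x - hX.flowMap h y‖ - ‖e x - e y‖ ≤ C * h ^ 2 * ‖x - y‖ := h2.trans h1
    linarith
  have himg : hX.flowMap h '' A =
      (fun z => hX.flowMap h (Function.invFunOn e A z)) '' (e '' A) := by
    rw [Set.image_image]
    refine Set.image_congr fun x hx => ?_
    rw [hinj.leftInvOn_invFunOn hx]
  have h1 : Measure.hausdorffMeasure d (hX.flowMap h '' A) ≤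
      (L : ℝ≥0∞) ^ (d : ℝ) * Measure.hausdorffMeasure d (e '' A) := by
    rw [himg]
    exact hlip.hausdorffMeasure_image_le (by positivity)
  have hder : ∀ x ∈ A, HasFDerivWithinAt e
      (ContinuousLinearMap.id ℝ V + h • fderiv ℝ X x) A x := fun x _ =>
    ((hasFDerivAt_id x).add (((hX.contDiff_field.differentiable (by simp)) x).hasFDerivAt.const_smul
      h)).hasFDerivWithinAt
  have h2 : Measure.hausdorffMeasure d (e '' A) ≤
      ENNReal.ofReal (1 + ε / 2 * h) * Measure.hausdorffMeasure d A := by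
    refine (addHaar_image_le_lintegral_abs_det_fderiv _ hA hder).trans ?_
    rw [← setLIntegral_const]
    refine setLIntegral_mono' hA fun x hx => ENNReal.ofReal_le_ofReal ?_
    exact hdet _ (hM x (hAc hx)) (htr x) h hh2
  refine h1.trans ((mul_le_mul_right h2 _).trans ?_)
  rw [← mul_assoc]
  refine mul_le_mul_left ?_ _
  rw [ENNReal.rpow_natCast, ← ENNReal.ofReal_coe_nnreal, hL, ← ENNReal.ofReal_pow (by positivity),
    ← ENNReal.ofReal_mul (by positivity)]
  refine ENNReal.ofReal_le_ofReal ?_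
  have h3 : (1 + 2 * C * h ^ 2) ^ d ≤ Real.exp (ε / 2 * h) := by
    calc (1 + 2 * C * h ^ 2) ^ d ≤ (Real.exp (2 * C * h ^ 2)) ^ d := by
          gcongr
          linarith [Real.add_one_le_exp (2 * C * h ^ 2)]
      _ = Real.exp (2 * C * d * h * h) := by
          rw [← Real.exp_nat_mul]; congr 1; ring
      _ ≤ Real.exp (ε / 2 * h) := Real.exp_le_exp.2 (mul_le_mul_of_nonneg_right hh4 hh.1)
  calc (1 + 2 * C * h ^ 2) ^ d * (1 + ε / 2 * h) ≤ Real.exp (ε / 2 * h) * Real.exp (ε / 2 * h) := by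
        refine mul_le_mul h3 (by linarith [Real.add_one_le_exp (ε / 2 * h)]) ?_ (Real.exp_pos _).le
        have := hh.1
        positivity
    _ = Real.exp (ε * h) := by rw [← Real.exp_add]; congr 1; ring

/-- On a fixed sublevel set, which is invariant, the short-time estimate is iterated over equal
steps; the factors multiply to `exp(ε t)`, and then `ε → 0`. -/
lemma measure_flowMap_image_le_of_nonneg (htr : ∀ x, LinearMap.trace ℝ V (fderiv ℝ X x) = 0)
    {t : ℝ} (ht : 0 ≤ t) {A : Set V} (hA : MeasurableSet A) :
    Measure.hausdorffMeasure (Module.finrank ℝ V) (hX.flowMap t '' A) ≤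
      Measure.hausdorffMeasure (Module.finrank ℝ V) A := by
  set μ : Measure V := Measure.hausdorffMeasure (Module.finrank ℝ V)
  have hmeas : ∀ t {A : Set V}, MeasurableSet A → MeasurableSet (hX.flowMap t '' A) :=
    fun t A hA => (hX.flowHomeo t).measurableEmbedding.measurableSet_image.2 hA
  have hbdd : ∀ c : ℝ, ∀ A : Set V, MeasurableSet A → A ⊆ {x | Q x ≤ c} →
      μ (hX.flowMap t '' A) ≤ μ A := by
    intro c A hA hAc
    have hε : ∀ ε : ℝ, 0 < ε → μ (hX.flowMap t '' A) ≤ ENNReal.ofReal (Real.exp (ε * t)) * μ A := by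
      intro ε hε
      obtain ⟨δ, hδ, h⟩ := hX.exists_measure_flowMap_image_le htr c hε
      obtain ⟨m, hm⟩ := exists_nat_ge (t / δ)
      have hm1 : (0 : ℝ) < m + 1 := by positivity
      set s := t / (m + 1)
      have hs : s ∈ Set.Icc 0 δ := by
        refine ⟨by positivity, ?_⟩
        rw [div_le_iff₀ hm1]
        rw [div_le_iff₀ hδ] at hm
        nlinarith
      have hk : ∀ k : ℕ, μ (hX.flowMap (k * s) '' A) ≤
          ENNReal.ofReal (Real.exp (ε * (k * s))) * μ A := by
        intro k
        induction k with
        | zero => simp [hX.flowMap_zero]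
        | succ k ih =>
          have h1 : hX.flowMap ((k + 1 : ℕ) * s) '' A =
              hX.flowMap s '' (hX.flowMap (k * s) '' A) := by
            rw [Set.image_image]
            refine Set.image_congr fun x _ => ?_
            rw [← hX.flowMap_add]
            congr 1
            push_cast; ring
          rw [h1]
          refine (h s hs _ (hmeas _ hA) ?_).trans ?_
          · rintro _ ⟨x, hx, rfl⟩
            exact (hX.quantity_flowMap _ x).trans_le (hAc hx)
          · refine (mul_le_mul_right ih _).trans (le_of_eq ?_)
            rw [← mul_assoc, ← ENNReal.ofReal_mul (Real.exp_pos _).le, ← Real.exp_add]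
            congr 3
            push_cast; ring
      have h2 := hk (m + 1)
      have h3 : ((m + 1 : ℕ) : ℝ) * s = t := by
        simp only [s]; push_cast; field_simp
      rwa [h3] at h2
    have hlim : Filter.Tendsto (fun ε : ℝ => ENNReal.ofReal (Real.exp (ε * t)) * μ A) (𝓝[>] 0)
        (𝓝 (ENNReal.ofReal (Real.exp (0 * t)) * μ A)) := by
      refine Filter.Tendsto.mono_left ?_ nhdsWithin_le_nhds
      refine ENNReal.Tendsto.mul_const ?_ (Or.inl (by simp))
      refine (ENNReal.continuous_ofReal.comp ?_).tendsto 0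
      fun_prop
    rw [zero_mul, Real.exp_zero, ENNReal.ofReal_one, one_mul] at hlim
    refine ge_of_tendsto hlim ?_
    filter_upwards [self_mem_nhdsWithin] with ε hε' using hε ε hε'
  -- The admissible step size depends on the sublevel set, so a general `A` is exhausted by its
  -- bounded parts.
  have hunion : A = ⋃ m : ℕ, A ∩ {x | Q x ≤ m} := by
    ext x
    simp only [Set.mem_iUnion, Set.mem_inter_iff, Set.mem_ofPred_eq, exists_and_left]
    exact ⟨fun hx => ⟨hx, exists_nat_ge (Q x)⟩, fun hx => hx.1⟩
  have hmono : Monotone fun m : ℕ => hX.flowMap t '' (A ∩ {x | Q x ≤ m}) := by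
    intro m m' hmm
    refine Set.image_mono (Set.inter_subset_inter_right _ fun x (hx : Q x ≤ m) => ?_)
    exact hx.trans (by exact_mod_cast hmm)
  calc μ (hX.flowMap t '' A) = μ (⋃ m : ℕ, hX.flowMap t '' (A ∩ {x | Q x ≤ m})) := by
        rw [← Set.image_iUnion, ← hunion]
    _ = ⨆ m : ℕ, μ (hX.flowMap t '' (A ∩ {x | Q x ≤ m})) := hmono.measure_iUnion
    _ ≤ μ A := by
        refine iSup_le fun m => ?_
        refine (hbdd m _ (hA.inter ?_) Set.inter_subset_right).trans
          (measure_mono Set.inter_subset_left)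
        exact (isClosed_le hX.contDiff_quantity.continuous continuous_const).measurableSet

/-- **Liouville's theorem**: the flow of a divergence free vector field preserves volume. -/
lemma measurePreserving_flowMap (htr : ∀ x, LinearMap.trace ℝ V (fderiv ℝ X x) = 0) (t : ℝ) :
    MeasurePreserving (hX.flowMap t) (Measure.hausdorffMeasure (Module.finrank ℝ V))
      (Measure.hausdorffMeasure (Module.finrank ℝ V)) := by
  set μ : Measure V := Measure.hausdorffMeasure (Module.finrank ℝ V)
  have hmeas : ∀ t {A : Set V}, MeasurableSet A → MeasurableSet (hX.flowMap t '' A) :=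
    fun t A hA => (hX.flowHomeo t).measurableEmbedding.measurableSet_image.2 hA
  have hle : ∀ t {A : Set V}, MeasurableSet A → μ (hX.flowMap t '' A) ≤ μ A := by
    intro t A hA
    rcases le_total 0 t with ht | ht
    · exact hX.measure_flowMap_image_le_of_nonneg htr ht hA
    · have h1 := hX.neg.measure_flowMap_image_le_of_nonneg (t := -t) (fun x => ?_) (by linarith) hA
      · have : hX.neg.flowMap (-t) = hX.flowMap t := by
          funext x
          rw [hX.flowMap_neg_field, neg_neg]
        rwa [this] at h1
      · have h2 : fderiv ℝ (fun x => -X x) x = -fderiv ℝ X x := fderiv_neg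
        rw [h2]
        simp [htr x]
  refine ⟨(hX.continuous_flowMap t).measurable, ?_⟩
  ext A hA
  rw [Measure.map_apply (hX.continuous_flowMap t).measurable hA]
  have hpre : hX.flowMap t ⁻¹' A = hX.flowMap (-t) '' A :=
    ((hX.flowHomeo t).symm.image_eq_preimage_symm A).symm
  rw [hpre]
  -- The reverse inequality is the same estimate for time `t` applied to the image under time `-t`.
  refine le_antisymm (hle _ hA) ?_
  have h1 := hle t (hmeas (-t) hA)
  rw [Set.image_image] at h1
  simpa [hX.flowMap_flowMap_neg] using h1

end ConservedField

end Liouville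

open scoped Pointwise in
lemma mem_add_of_coeff_mul_ne_zero {R : Type*} [Semiring R] {f g : AddMonoidAlgebra R ℤ}
    {S T : Finset ℤ} (hS : ∀ j, f.coeff j ≠ 0 → j ∈ S) (hT : ∀ j, g.coeff j ≠ 0 → j ∈ T) {k : ℤ}
    (hk : (f * g).coeff k ≠ 0) : k ∈ S + T := by
  rw [coeff_mul_eq_sum f g S hS] at hk
  obtain ⟨j, hj, hne⟩ := Finset.exists_ne_zero_of_sum_ne_zero hk
  have := Finset.add_mem_add hj (hT _ (right_ne_zero_of_mul hne))
  rwa [add_sub_cancel] at this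

/-! ### Differentiating energies along curves of trigonometric polynomials. -/

section SmoothFamily

open TrigPoly

variable {V : Type*} [NormedAddCommGroup V] [NormedSpace ℝ V]

/-- A family of trigonometric polynomials of uniformly bounded degree with smooth coefficients. -/
structure SmoothFamily (p : V → TrigPoly) : Prop where
  supp : ∃ S : Finset ℤ, ∀ x j, (p x).coeff j ≠ 0 → j ∈ S
  smooth : ∀ k, ContDiff ℝ ∞ fun x => (p x).coeff k

namespace SmoothFamily

variable {p q : V → TrigPoly}

lemma zero : SmoothFamily fun _ : V => (0 : TrigPoly) where
  supp := ⟨∅, by simp⟩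
  smooth k := by simpa using contDiff_const

lemma add (hp : SmoothFamily p) (hq : SmoothFamily q) : SmoothFamily fun x => p x + q x where
  supp := by
    obtain ⟨S, hS⟩ := hp.supp
    obtain ⟨T, hT⟩ := hq.supp
    refine ⟨S ∪ T, fun x j hj => ?_⟩
    by_contra h
    rw [Finset.mem_union, not_or] at h
    refine hj ?_
    rw [AddMonoidAlgebra.coeff_add, Finsupp.add_apply, not_not.1 (mt (hS x j) h.1),
      not_not.1 (mt (hT x j) h.2), add_zero]
  smooth k := by
    simpa using (hp.smooth k).add (hq.smooth k)

lemma mul (hp : SmoothFamily p) (hq : SmoothFamily q) : SmoothFamily fun x => p x * q x where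
  supp := by
    obtain ⟨S, hS⟩ := hp.supp
    obtain ⟨T, hT⟩ := hq.supp
    exact ⟨_, fun x j hj => mem_add_of_coeff_mul_ne_zero (hS x) (hT x) hj⟩
  smooth k := by
    obtain ⟨S, hS⟩ := hp.supp
    simp only [fun x => coeff_mul_eq_sum (p x) (q x) S (hS x)]
    exact ContDiff.sum fun j _ => (hp.smooth j).mul (hq.smooth _)

lemma smul (c : ℂ) (hp : SmoothFamily p) : SmoothFamily fun x => c • p x where
  supp := by
    obtain ⟨S, hS⟩ := hp.supp
    refine ⟨S, fun x j hj => hS x j ?_⟩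
    rw [AddMonoidAlgebra.coeff_smul_apply, smul_eq_mul] at hj
    exact right_ne_zero_of_mul hj
  smooth k := by
    simpa using contDiff_const.mul (hp.smooth k)

lemma D (hp : SmoothFamily p) : SmoothFamily fun x => D (p x) where
  supp := by
    obtain ⟨S, hS⟩ := hp.supp
    exact ⟨S, fun x j hj => hS x j (right_ne_zero_of_mul hj)⟩
  smooth k := by
    simpa using contDiff_const.mul (hp.smooth k)

lemma cj (hp : SmoothFamily p) : SmoothFamily fun x => cj (p x) where
  supp := by
    obtain ⟨S, hS⟩ := hp.supp
    refine ⟨S.map (Equiv.neg ℤ).toEmbedding, fun x j hj => ?_⟩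
    simp only [coeff_cj, ne_eq, map_eq_zero] at hj
    simpa using hS x _ hj
  smooth k := by
    simp only [coeff_cj]
    exact Complex.conjCLE.contDiff.comp (hp.smooth (-k))

lemma sum {ι : Type*} (s : Finset ι) {p : ι → V → TrigPoly} (hp : ∀ i ∈ s, SmoothFamily (p i)) :
    SmoothFamily fun x => ∑ i ∈ s, p i x := by
  classical
  induction s using Finset.induction_on with
  | empty => simpa using zero
  | insert i s hi ih =>
    simp only [Finset.sum_insert hi]
    exact (hp i (Finset.mem_insert_self i s)).add
      (ih fun j hj => hp j (Finset.mem_insert_of_mem hj))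

lemma dens (hp : SmoothFamily p) (hq : SmoothFamily q) (m : ℕ) :
    SmoothFamily fun x => dens TrigPoly.D (p x) (q x) m := by
  induction m using Nat.strong_induction_on with
  | _ m ih =>
    match m with
    | 0 => simpa only [dens_zero] using zero
    | 1 => simpa only [dens_one] using hp
    | n + 2 =>
      simp only [dens_add_two]
      exact (ih (n + 1) (by omega)).D.add (hq.mul (sum _ fun k _ =>
        (ih (k + 1) (by omega)).mul (ih (n - k) (by omega))))

lemma contDiff_energy (hp : SmoothFamily p) (m : ℕ) :
    ContDiff ℝ ∞ fun x => energy m (p x) := by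
  have := ((hp.cj.mul (hp.dens hp.cj m)).smooth 0)
  exact contDiff_const.mul (Complex.reCLM.contDiff.comp this)

end SmoothFamily

/-- Coefficientwise differentiability at `t` of a curve of trigonometric polynomials of bounded
degree. -/
structure HasCoeffDerivAt (p : ℝ → TrigPoly) (p' : TrigPoly) (t : ℝ) : Prop where
  supp : ∃ S : Finset ℤ, ∀ x j, (p x).coeff j ≠ 0 → j ∈ S
  deriv : ∀ k, HasDerivAt (fun s => (p s).coeff k) (p'.coeff k) t

namespace HasCoeffDerivAt

variable {p q : ℝ → TrigPoly} {p' q' : TrigPoly} {t : ℝ}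

lemma zero : HasCoeffDerivAt (fun _ => 0) 0 t where
  supp := ⟨∅, by simp⟩
  deriv k := by simpa using hasDerivAt_const t (0 : ℂ)

lemma add (hp : HasCoeffDerivAt p p' t) (hq : HasCoeffDerivAt q q' t) :
    HasCoeffDerivAt (fun x => p x + q x) (p' + q') t where
  supp := by
    obtain ⟨S, hS⟩ := hp.supp
    obtain ⟨T, hT⟩ := hq.supp
    refine ⟨S ∪ T, fun x j hj => ?_⟩
    by_contra h
    rw [Finset.mem_union, not_or] at h
    refine hj ?_
    rw [AddMonoidAlgebra.coeff_add, Finsupp.add_apply, not_not.1 (mt (hS x j) h.1),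
      not_not.1 (mt (hT x j) h.2), add_zero]
  deriv k := by
    exact (hp.deriv k).add (hq.deriv k)

lemma mul (hp : HasCoeffDerivAt p p' t) (hq : HasCoeffDerivAt q q' t) :
    HasCoeffDerivAt (fun x => p x * q x) (p' * q t + p t * q') t where
  supp := by
    obtain ⟨S, hS⟩ := hp.supp
    obtain ⟨T, hT⟩ := hq.supp
    exact ⟨_, fun x j hj => mem_add_of_coeff_mul_ne_zero (hS x) (hT x) hj⟩
  deriv k := by
    obtain ⟨S, hS⟩ := hp.supp
    -- Outside `S` the coefficients vanish along the whole curve, hence so do their derivatives.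
    have hS' : ∀ j, p'.coeff j ≠ 0 → j ∈ S := by
      intro j hj
      by_contra h
      refine hj ?_
      have h0 : (fun s => (p s).coeff j) = fun _ => 0 :=
        funext fun s => not_not.1 (mt (hS s j) h)
      have h1 := hp.deriv j
      rw [h0] at h1
      exact h1.unique (hasDerivAt_const t 0)
    simp only [fun x => coeff_mul_eq_sum (p x) (q x) S (hS x), AddMonoidAlgebra.coeff_add,
      Finsupp.add_apply, coeff_mul_eq_sum _ _ S hS', coeff_mul_eq_sum (p t) q' S (hS t),
      ← Finset.sum_add_distrib]
    exact HasDerivAt.fun_sum fun j _ => (hp.deriv j).mul (hq.deriv _)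

lemma D (hp : HasCoeffDerivAt p p' t) : HasCoeffDerivAt (fun x => D (p x)) (D p') t where
  supp := by
    obtain ⟨S, hS⟩ := hp.supp
    exact ⟨S, fun x j hj => hS x j (right_ne_zero_of_mul hj)⟩
  deriv k := by
    simpa using (hp.deriv k).const_mul (k : ℂ)

lemma smul (c : ℂ) (hp : HasCoeffDerivAt p p' t) :
    HasCoeffDerivAt (fun x => c • p x) (c • p') t where
  supp := by
    obtain ⟨S, hS⟩ := hp.supp
    refine ⟨S, fun x j hj => hS x j ?_⟩
    rw [AddMonoidAlgebra.coeff_smul_apply, smul_eq_mul] at hj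
    exact right_ne_zero_of_mul hj
  deriv k := by
    simpa using (hp.deriv k).const_mul c

lemma cj (hp : HasCoeffDerivAt p p' t) : HasCoeffDerivAt (fun x => cj (p x)) (cj p') t where
  supp := by
    obtain ⟨S, hS⟩ := hp.supp
    refine ⟨S.map (Equiv.neg ℤ).toEmbedding, fun x j hj => ?_⟩
    simp only [coeff_cj, ne_eq, map_eq_zero] at hj
    simpa using hS x _ hj
  deriv k := by
    simp only [coeff_cj]
    exact Complex.conjCLE.hasFDerivAt.comp_hasDerivAt t (hp.deriv (-k))

lemma sum {ι : Type*} (s : Finset ι) {p : ι → ℝ → TrigPoly} {p' : ι → TrigPoly}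
    (hp : ∀ i ∈ s, HasCoeffDerivAt (p i) (p' i) t) :
    HasCoeffDerivAt (fun x => ∑ i ∈ s, p i x) (∑ i ∈ s, p' i) t := by
  classical
  induction s using Finset.induction_on with
  | empty => simpa using zero
  | insert i s hi ih =>
    simp only [Finset.sum_insert hi]
    exact (hp i (Finset.mem_insert_self i s)).add
      (ih fun j hj => hp j (Finset.mem_insert_of_mem hj))

lemma dens (hp : HasCoeffDerivAt p p' t) (hq : HasCoeffDerivAt q q' t) (m : ℕ) :
    HasCoeffDerivAt (fun x => dens TrigPoly.D (p x) (q x) m)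
      (densLin TrigPoly.D (p t) (q t) p' q' m) t := by
  induction m using Nat.strong_induction_on with
  | _ m ih =>
    match m with
    | 0 => simpa only [dens_zero, densLin_zero] using zero
    | 1 => simpa only [dens_one, densLin_one] using hp
    | n + 2 =>
      simp only [dens_add_two, densLin_add_two]
      exact (ih (n + 1) (by omega)).D.add (hq.mul (sum _ fun k _ =>
        (ih (k + 1) (by omega)).mul (ih (n - k) (by omega))))

lemma hasDerivAt_energy (hp : HasCoeffDerivAt p p' t) (m : ℕ) :
    HasDerivAt (fun s => energy m (p s)) (2 * Real.pi * (energyLin (p t) p' (TrigPoly.cj p') m).re)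
      t := by
  have := ((hp.cj.mul (hp.dens hp.cj m)).deriv 0)
  exact (Complex.reCLM.hasFDerivAt.comp_hasDerivAt t this).const_mul _

end HasCoeffDerivAt

lemma coeff_zero_D (g : TrigPoly) : (TrigPoly.D g).coeff 0 = 0 := by simp

/-- The velocity `D³f + 6|f|²Df` of the full equation, up to the factor `i`. -/
def velocity (f : TrigPoly) : TrigPoly := D (D (D f)) + 6 * (f * cj f * D f)

/-- The time derivative of `E_m` along the flow truncated at frequency `N`. -/
def energyRate (N m : ℕ) (f : TrigPoly) : ℝ :=
  2 * Real.pi * (Complex.I * energyLin f (defectDir N f) (-cj (defectDir N f)) m).re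

lemma energyLin_smul_add (f h k h' k' : TrigPoly) (c : ℂ) (m : ℕ) :
    energyLin f (c • (h + h')) (c • (k + k')) m = c * (energyLin f h k m + energyLin f h' k' m) := by
  rw [energyLin, energyLin, energyLin, densLin_smul, densLin_add]
  simp only [smul_mul_assoc, mul_smul_comm, ← smul_add, AddMonoidAlgebra.coeff_smul_apply,
    smul_eq_mul, add_mul, mul_add, AddMonoidAlgebra.coeff_add, Finsupp.add_apply]
  ring

lemma cj_velocity (f : TrigPoly) :
    cj (velocity f) = -(D (D (D (cj f))) + 6 * (f * cj f * D (cj f))) := by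
  simp only [velocity, map_add, map_mul, cj_D, map_neg, cj_cj, map_ofNat]
  ring

/-- The contribution of the full velocity is the mean of an exact derivative and vanishes, which
leaves only the defect direction. -/
lemma hasDerivAt_energy_of_truncated {p : ℝ → TrigPoly} {t : ℝ} {N : ℕ}
    (hp : HasCoeffDerivAt p (Complex.I • (velocity (p t) + defectDir N (p t))) t) (m : ℕ) :
    HasDerivAt (fun s => energy m (p s)) (energyRate N m (p t)) t := by
  refine (hp.hasDerivAt_energy m).congr_deriv ?_
  set f := p t
  have h1 : cj (Complex.I • (velocity f + defectDir N f)) =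
      Complex.I • ((D (D (D (cj f))) + 6 * (f * cj f * D (cj f))) + -cj (defectDir N f)) := by
    rw [cj_smul, Complex.conj_I, map_add, cj_velocity, neg_smul, ← smul_neg]
    congr 1
    abel
  obtain ⟨g, hg⟩ := exists_densLin_eq_deriv D f (cj f) m
  have h2 : energyLin f (velocity f) (D (D (D (cj f))) + 6 * (f * cj f * D (cj f))) m = 0 := by
    rw [energyLin, velocity, hg, coeff_zero_D]
  rw [energyRate, h1, energyLin_smul_add, h2, zero_add]

lemma energyRate_one {N : ℕ} {f : TrigPoly} (hf : ∀ j : ℤ, f.coeff j ≠ 0 → j.natAbs ≤ N) :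
    energyRate N 1 f = 0 := by
  have hcf : ∀ j : ℤ, (cj f).coeff j ≠ 0 → j.natAbs ≤ N := by
    intro j hj
    simp only [coeff_cj, ne_eq, map_eq_zero] at hj
    simpa using hf _ hj
  have hd : ∀ j : ℤ, (defectDir N f).coeff j ≠ 0 → N < j.natAbs := by
    intro j hj
    rw [defectDir, AddMonoidAlgebra.coeff_smul_apply, smul_eq_mul] at hj
    exact lt_of_high_ne_zero (right_ne_zero_of_mul hj)
  have hcd : ∀ j : ℤ, (-cj (defectDir N f)).coeff j ≠ 0 → N < j.natAbs := by
    intro j hj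
    simp only [AddMonoidAlgebra.coeff_neg, Finsupp.neg_apply, coeff_cj, ne_eq, neg_eq_zero,
      map_eq_zero] at hj
    simpa using hd _ hj
  rw [energyRate, energyLin, dens_one, densLin_one, AddMonoidAlgebra.coeff_add, Finsupp.add_apply,
    mul_coeff_zero_of_disjoint hcf hd,
    mul_comm (-cj (defectDir N f)), mul_coeff_zero_of_disjoint hf hcd]
  simp

end SmoothFamily

/-! ### The finite-dimensional system: conserved mass and zero divergence. -/

section LowModes

open TrigPoly

/-- The frequencies `|k| ≤ N`. -/
abbrev lowFreq (N : ℕ) : Finset ℤ := Finset.Icc (-(N : ℤ)) N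

/-- The space of trigonometric polynomials of degree at most `N`, as coefficient vectors. -/
abbrev LowModes (N : ℕ) := lowFreq N → ℂ

lemma mem_lowFreq {N : ℕ} {k : ℤ} : k ∈ lowFreq N ↔ |k| ≤ (N : ℤ) := by
  rw [Finset.mem_Icc, abs_le]

variable {N : ℕ}

/-- The coefficient vector of a trigonometric polynomial, as a polynomial. -/
def toPoly (x : LowModes N) : TrigPoly :=
  trunc N fun k => if h : k ∈ lowFreq N then x ⟨k, h⟩ else 0

lemma coeff_toPoly (x : LowModes N) (k : ℤ) :
    (toPoly x).coeff k = if h : k ∈ lowFreq N then x ⟨k, h⟩ else 0 := by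
  rw [toPoly, coeff_trunc]
  simp only [← mem_lowFreq]
  split_ifs <;> rfl

@[simp] lemma coeff_toPoly_coe (x : LowModes N) (k : lowFreq N) : (toPoly x).coeff k = x k := by
  rw [coeff_toPoly, dif_pos k.2]

lemma mem_of_coeff_toPoly_ne_zero {x : LowModes N} {k : ℤ} (h : (toPoly x).coeff k ≠ 0) :
    k ∈ lowFreq N := by
  by_contra h0
  rw [coeff_toPoly, dif_neg h0] at h
  exact h rfl

lemma natAbs_le_of_mem_lowFreq {k : ℤ} (h : k ∈ lowFreq N) : k.natAbs ≤ N := by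
  have := Finset.mem_Icc.1 h
  omega

lemma mem_lowFreq_iff_natAbs {k : ℤ} : k ∈ lowFreq N ↔ k.natAbs ≤ N := by
  rw [Finset.mem_Icc]
  omega

lemma toPoly_restrict (u : ℤ → ℂ) : toPoly (fun k : lowFreq N => u k) = trunc N u := by
  ext k
  rw [coeff_toPoly, coeff_trunc]
  simp only [← mem_lowFreq]
  split_ifs <;> rfl

/-- The truncated vector field. -/
def field (N : ℕ) (x : LowModes N) : LowModes N :=
  fun k => Complex.I * (velocity (toPoly x)).coeff k

/-- Truncating the full velocity amounts to subtracting the part of its nonlinearity beyond `N`,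
since the linear part has no such frequencies. -/
lemma toPoly_field (x : LowModes N) :
    toPoly (field N x) = Complex.I • (velocity (toPoly x) + defectDir N (toPoly x)) := by
  ext k
  rw [coeff_toPoly, AddMonoidAlgebra.coeff_smul_apply, AddMonoidAlgebra.coeff_add,
    Finsupp.add_apply, defectDir, AddMonoidAlgebra.coeff_smul_apply, TrigPoly.high_coeff]
  split_ifs with h1 h2 h2
  · rw [field, smul_zero, add_zero, smul_eq_mul]
  · exact absurd (natAbs_le_of_mem_lowFreq h1) h2
  · exact absurd (mem_lowFreq_iff_natAbs.2 h2) h1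
  · have h3 : (toPoly x).coeff k = 0 := by rw [coeff_toPoly, dif_neg h1]
    rw [velocity, nonlin, AddMonoidAlgebra.coeff_add, Finsupp.add_apply]
    have h4 : (6 * (toPoly x * cj (toPoly x) * D (toPoly x))).coeff k =
        6 * (toPoly x * cj (toPoly x) * D (toPoly x)).coeff k := by
      rw [show (6 : TrigPoly) * (toPoly x * cj (toPoly x) * D (toPoly x)) =
        (6 : ℂ) • (toPoly x * cj (toPoly x) * D (toPoly x)) by
          rw [Algebra.smul_def, map_ofNat], AddMonoidAlgebra.coeff_smul_apply, smul_eq_mul]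
    rw [h4]
    simp [h3]

lemma smoothFamily_toPoly : SmoothFamily (toPoly (N := N)) where
  supp := ⟨lowFreq N, fun _ _ h => mem_of_coeff_toPoly_ne_zero h⟩
  smooth k := by
    simp only [coeff_toPoly]
    split_ifs with h
    · exact contDiff_apply ℝ ℂ (⟨k, h⟩ : lowFreq N)
    · exact contDiff_const

lemma hasCoeffDerivAt_toPoly {γ : ℝ → LowModes N} {v : LowModes N} {t : ℝ}
    (h : HasDerivAt γ v t) : HasCoeffDerivAt (fun s => toPoly (γ s)) (toPoly v) t where
  supp := ⟨lowFreq N, fun _ _ h => mem_of_coeff_toPoly_ne_zero h⟩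
  deriv k := by
    simp only [coeff_toPoly]
    split_ifs with h'
    · exact hasDerivAt_pi.1 h ⟨k, h'⟩
    · exact hasDerivAt_const t 0

lemma six_mul_eq (f : TrigPoly) : 6 * f = (6 : ℂ) • f := by
  rw [Algebra.smul_def, map_ofNat]

lemma contDiff_field : ContDiff ℝ ∞ (field N) := by
  have hp := smoothFamily_toPoly (N := N)
  have hv : SmoothFamily fun x : LowModes N => velocity (toPoly x) := by
    simp only [velocity, six_mul_eq]
    exact hp.D.D.D.add (((hp.mul hp.cj).mul hp.D).smul 6)
  exact contDiff_pi.2 fun k => contDiff_const.mul (hv.smooth k)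

/-- The conserved mass. -/
def mass (x : LowModes N) : ℝ := ∑ k, ‖x k‖ ^ 2

lemma energy_one_toPoly (x : LowModes N) : energy 1 (toPoly x) = 2 * Real.pi * mass x := by
  rw [energy, dens_one, coeff_zero_cj_mul _ _ (lowFreq N) fun _ h => mem_of_coeff_toPoly_ne_zero h,
    ← Finset.sum_coe_sort]
  simp only [coeff_toPoly_coe, Complex.conj_mul', mass]
  norm_cast

lemma energyRate_one_toPoly (x : LowModes N) : energyRate N 1 (toPoly x) = 0 :=
  energyRate_one fun _ h => natAbs_le_of_mem_lowFreq (mem_of_coeff_toPoly_ne_zero h)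

lemma hasDerivAt_energy_toPoly {γ : ℝ → LowModes N} {t : ℝ}
    (h : HasDerivAt γ (field N (γ t)) t) (m : ℕ) :
    HasDerivAt (fun s => energy m (toPoly (γ s))) (energyRate N m (toPoly (γ t))) t := by
  have := hasCoeffDerivAt_toPoly h
  rw [toPoly_field] at this
  exact hasDerivAt_energy_of_truncated this m

lemma contDiff_mass : ContDiff ℝ ∞ (mass (N := N)) :=
  ContDiff.sum fun k _ => (contDiff_apply ℝ ℂ k).norm_sq ℝ

lemma hasDerivAt_line (x v : LowModes N) : HasDerivAt (fun s : ℝ => x + s • v) v 0 := by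
  simpa using ((hasDerivAt_id (0 : ℝ)).smul_const v).const_add x

lemma convexOn_mass : ConvexOn ℝ Set.univ (mass (N := N)) := by
  have : ∀ s : Finset (lowFreq N), ConvexOn ℝ Set.univ fun x : LowModes N => ∑ k ∈ s, ‖x k‖ ^ 2 := by
    intro s
    induction s using Finset.induction_on with
    | empty => simpa using convexOn_const (0 : ℝ) convex_univ
    | insert k s hk ih =>
      simp only [Finset.sum_insert hk]
      refine ConvexOn.add ?_ ih
      have h1 : ConvexOn ℝ Set.univ fun x : LowModes N => ‖x k‖ :=
        (convexOn_univ_norm (E := ℂ)).comp_linearMap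
          (LinearMap.proj (R := ℝ) (φ := fun _ : lowFreq N => ℂ) k)
      exact h1.pow (fun _ _ => norm_nonneg _) 2
  exact this Finset.univ

lemma conservedField : ConservedField (field N) mass where
  contDiff_field := contDiff_field
  contDiff_quantity := contDiff_mass
  fderiv_apply x := by
    have h1 := ((contDiff_mass (N := N)).differentiable (by simp) x).hasFDerivAt
    have h2 := HasFDerivAt.comp_hasDerivAt_of_eq (0 : ℝ) h1 (hasDerivAt_line x (field N x))
      (by simp)
    -- A straight line suffices, as only the velocity at the given time enters. Mass is `E_1` up to
    -- the factor `2π`, and `E_1` has zero rate.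
    have h3 := hasDerivAt_energy_toPoly (γ := fun s : ℝ => x + s • field N x) (t := 0)
      (by simpa using hasDerivAt_line x (field N x)) 1
    simp only [energy_one_toPoly, energyRate_one_toPoly] at h3
    have h4 := (h2.const_mul (2 * Real.pi)).unique h3
    have : 2 * Real.pi ≠ 0 := by positivity
    simpa [this] using h4
  bounded c := by
    refine (Metric.isBounded_closedBall (x := (0 : LowModes N)) (r := |c| + 1)).subset ?_
    intro x (hx : mass x ≤ c)
    rw [mem_closedBall_zero_iff, pi_norm_le_iff_of_nonneg (by positivity)]
    intro k
    have h1 : ‖x k‖ ^ 2 ≤ mass x :=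
      Finset.single_le_sum (f := fun k => ‖x k‖ ^ 2) (fun _ _ => by positivity) (Finset.mem_univ k)
    have := le_abs_self c
    nlinarith [norm_nonneg (x k)]
  convex c := by
    simpa using (convexOn_mass (N := N)).convex_le c

lemma conj_coeff_zero (f : TrigPoly) : starRingEnd ℂ (f.coeff 0) = (cj f).coeff 0 := by simp

lemma im_coeff_zero_eq_zero {f : TrigPoly} (h : (cj f).coeff 0 = f.coeff 0) :
    (f.coeff 0).im = 0 := by
  rw [← conj_coeff_zero] at h
  exact Complex.conj_eq_iff_im.1 h

lemma fderiv_field_apply (x v : LowModes N) (k : lowFreq N) :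
    fderiv ℝ (field N) x v k = Complex.I * (D (D (D (toPoly v))) +
      6 * ((toPoly v * cj (toPoly x) + toPoly x * cj (toPoly v)) * D (toPoly x) +
        toPoly x * cj (toPoly x) * D (toPoly v))).coeff k := by
  have h1 := ((contDiff_field (N := N)).differentiable (by simp) x).hasFDerivAt
  have h2 := HasFDerivAt.comp_hasDerivAt_of_eq (0 : ℝ) h1 (hasDerivAt_line x v) (by simp)
  have hp := hasCoeffDerivAt_toPoly (hasDerivAt_line x v)
  have h3 := (((hp.D.D.D).add (((hp.mul hp.cj).mul hp.D).smul 6)).deriv k).const_mul Complex.I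
  simp only [zero_smul, add_zero, ← six_mul_eq] at h3
  exact (hasDerivAt_pi.1 h2 k).unique h3

lemma toPoly_single (k : lowFreq N) (e : ℂ) :
    toPoly (Pi.single k e) = AddMonoidAlgebra.single (k : ℤ) e := by
  ext j
  rw [coeff_toPoly, AddMonoidAlgebra.coeff_single, Finsupp.single_apply]
  split_ifs with h1 h2 h2
  · subst h2
    simp
  · rw [Pi.single_apply, if_neg]
    intro h
    exact h2 (congrArg Subtype.val h).symm
  · subst h2
    exact absurd k.2 h1
  · rfl

lemma D_single (k : ℤ) (a : ℂ) :
    D (AddMonoidAlgebra.single k a) = AddMonoidAlgebra.single k (k * a) := by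
  ext j
  simp only [coeff_D, AddMonoidAlgebra.coeff_single, Finsupp.single_apply]
  split_ifs with h
  · rw [h]
  · simp

/-- What matters is that `c` is real. It is built from `k³` and the means of `|f|²` and `f̄ D f`;
the latter is real by integration by parts. -/
lemma exists_fderiv_field_single (x : LowModes N) (k : lowFreq N) :
    ∃ (c : ℝ) (d : ℂ), ∀ e : ℂ, fderiv ℝ (field N) x (Pi.single k e) k =
      Complex.I * (c * e + d * starRingEnd ℂ e) := by
  set f := toPoly x
  have h1 : ((cj f * D f).coeff 0).im = 0 := by
    refine im_coeff_zero_eq_zero ?_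
    have : cj (cj f * D f) = cj f * D f - D (f * cj f) := by
      rw [map_mul, cj_cj, cj_D, Derivation.leibniz, smul_eq_mul, smul_eq_mul]
      ring
    rw [this, AddMonoidAlgebra.coeff_sub, Finsupp.sub_apply, coeff_zero_D, sub_zero]
  have h2 : ((f * cj f).coeff 0).im = 0 := by
    refine im_coeff_zero_eq_zero ?_
    rw [map_mul, cj_cj, mul_comm]
  refine ⟨(k : ℝ) ^ 3 + 6 * ((cj f * D f).coeff 0).re + 6 * (k * ((f * cj f).coeff 0).re),
    6 * (f * D f).coeff (2 * k), fun e => ?_⟩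
  rw [fderiv_field_apply, toPoly_single, cj_single, D_single, D_single, D_single]
  have e1 : (((cj f * D f).coeff 0).re : ℂ) = (cj f * D f).coeff 0 :=
    Complex.ext rfl (by simpa using h1.symm)
  have e2 : (((f * cj f).coeff 0).re : ℂ) = (f * cj f).coeff 0 :=
    Complex.ext rfl (by simpa using h2.symm)
  have e3 : (AddMonoidAlgebra.single (k : ℤ) e * cj f + f * AddMonoidAlgebra.single (-(k : ℤ))
        (starRingEnd ℂ e)) * D f + f * cj f * AddMonoidAlgebra.single (k : ℤ) (k * e) =
      (cj f * D f) * AddMonoidAlgebra.single (k : ℤ) e +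
      (f * D f) * AddMonoidAlgebra.single (-(k : ℤ)) (starRingEnd ℂ e) +
      (f * cj f) * AddMonoidAlgebra.single (k : ℤ) (k * e) := by ring
  rw [e3, six_mul_eq]
  simp only [AddMonoidAlgebra.coeff_add, Finsupp.add_apply, AddMonoidAlgebra.coeff_smul_apply,
    AddMonoidAlgebra.coeff_mul_single_apply, AddMonoidAlgebra.coeff_single, Finsupp.single_eq_same,
    smul_eq_mul]
  rw [show (k : ℤ) + -(k : ℤ) = 0 by ring, show (k : ℤ) + -(-(k : ℤ)) = 2 * k by ring]
  push_cast
  rw [e1, e2]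
  ring

/-- In the real basis `1, i` of each mode, multiplication by `i c` with `c` real has zero diagonal,
and a conjugate-linear map has opposite diagonal entries. Each diagonal block thus has trace zero.
-/
lemma trace_fderiv_field (x : LowModes N) :
    LinearMap.trace ℝ (LowModes N) (fderiv ℝ (field N) x) = 0 := by
  rw [LinearMap.trace_eq_matrix_trace ℝ (Pi.basis fun _ : lowFreq N => Complex.basisOneI),
    Matrix.trace, Fintype.sum_sigma]
  refine Finset.sum_eq_zero fun k _ => ?_
  obtain ⟨c, d, h⟩ := exists_fderiv_field_single x k
  simp [Fin.sum_univ_two, LinearMap.toMatrix_apply, Pi.basis_apply, Pi.basis_repr, h]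

end LowModes

/-! ### Existence and uniqueness for the truncated equation. -/

section Solution

open TrigPoly

variable {N : ℕ}

/-- The low modes of a distribution. -/
def lowPart (N : ℕ) (u : ℤ → ℂ) : LowModes N := fun k => u k

lemma toPoly_lowPart (u : ℤ → ℂ) : toPoly (lowPart N u) = trunc N u := toPoly_restrict u

lemma proj_eq_ev_toPoly (u : ℤ → ℂ) : proj N u = ev (toPoly (lowPart N u)) := by
  rw [proj_eq_ev, toPoly_lowPart]

lemma rhs_eq (u : ℤ → ℂ) (k : ℤ) :
    (-((Complex.I * k) ^ 3 * u k) +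
        if |k| ≤ (N : ℤ) then
          6 * fourierCoef (fun x => ((‖proj N u x‖ ^ 2 : ℝ) : ℂ) * deriv (proj N u) x) k
        else 0) =
      if h : k ∈ lowFreq N then field N (lowPart N u) ⟨k, h⟩ else Complex.I * k ^ 3 * u k := by
  have hI : (Complex.I * k) ^ 3 * u k = -(Complex.I * k ^ 3 * u k) := by
    rw [mul_pow, Complex.I_pow_three]
    ring
  rw [hI, neg_neg]
  simp only [← mem_lowFreq]
  split_ifs with h
  · rw [fourierCoef_nonlin, field, velocity, six_mul_eq, AddMonoidAlgebra.coeff_add,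
      Finsupp.add_apply, AddMonoidAlgebra.coeff_smul_apply, toPoly_lowPart, nonlin]
    have : (trunc N u).coeff k = u k := by
      rw [coeff_trunc, if_pos (mem_lowFreq.1 h)]
    simp only [coeff_D, this, smul_eq_mul]
    ring
  · rw [add_zero]

/-- The explicit solution of the truncated equation. -/
def solution (N : ℕ) (u₀ : ℤ → ℂ) (t : ℝ) (k : ℤ) : ℂ :=
  if h : k ∈ lowFreq N then conservedField.flowMap t (lowPart N u₀) ⟨k, h⟩
  else Complex.exp (Complex.I * k ^ 3 * t) * u₀ k

lemma lowPart_solution (u₀ : ℤ → ℂ) (t : ℝ) :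
    lowPart N (solution N u₀ t) = conservedField.flowMap t (lowPart N u₀) := by
  funext k
  rw [lowPart, solution, dif_pos k.2]

lemma hasDerivAt_exp_mul (a c : ℂ) (t : ℝ) :
    HasDerivAt (fun t : ℝ => Complex.exp (a * t) * c) (a * (Complex.exp (a * t) * c)) t := by
  have h3 : HasDerivAt (fun x : ℝ => a * (x : ℂ)) (a * 1) t :=
    (Complex.ofRealCLM.hasDerivAt (x := t)).const_mul _
  refine (h3.cexp.mul_const c).congr_deriv ?_
  ring

lemma isSolution_solution (u₀ : ℤ → ℂ) : IsSolution N u₀ (solution N u₀) where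
  initial := by
    funext k
    rw [solution]
    split_ifs with h
    · rw [conservedField.flowMap_zero]; rfl
    · simp
  equation t k := by
    rw [rhs_eq, lowPart_solution]
    simp only [solution]
    split_ifs with h
    · exact hasDerivAt_pi.1 (conservedField.hasDerivAt_flowMap t (lowPart N u₀)) ⟨k, h⟩
    · exact hasDerivAt_exp_mul _ _ t

/-- The low modes form an integral curve of `field`, which is unique. In each high mode the
integrating factor `exp(-i k³ t)` makes the solution constant. -/
lemma IsSolution.eq_solution {u₀ : ℤ → ℂ} {u : ℝ → ℤ → ℂ} (hu : IsSolution N u₀ u) :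
    u = solution N u₀ := by
  have heq : ∀ t k, HasDerivAt (fun τ => u τ k)
      (if h : k ∈ lowFreq N then field N (lowPart N (u t)) ⟨k, h⟩
        else Complex.I * k ^ 3 * u t k) t := fun t k => by
    rw [← rhs_eq]
    exact hu.equation t k
  funext t k
  rw [solution]
  split_ifs with h
  · have h1 : ∀ t, HasDerivAt (fun t => lowPart N (u t)) (field N (lowPart N (u t))) t :=
      fun t => hasDerivAt_pi.2 fun j => by
        have := heq t j
        rw [dif_pos j.2] at this
        exact this
    have h2 := conservedField.eq_flowMap h1 t
    rw [hu.initial] at h2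
    exact congrFun h2 ⟨k, h⟩
  · set a := Complex.I * k ^ 3
    have h1 : ∀ t, HasDerivAt (fun t : ℝ => Complex.exp (-a * t) * 1 * u t k) 0 t := fun t => by
      have h2 := heq t k
      rw [dif_neg h] at h2
      refine ((hasDerivAt_exp_mul (-a) 1 t).mul h2).congr_deriv ?_
      ring
    have h3 := is_const_of_deriv_eq_zero (fun t => (h1 t).differentiableAt)
      (fun t => (h1 t).deriv) t 0
    rw [hu.initial] at h3
    simp only [mul_one, Complex.ofReal_zero, mul_zero, Complex.exp_zero, one_mul] at h3
    rw [← h3, ← mul_assoc, ← Complex.exp_add]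
    simp

lemma existsUnique_isSolution (N : ℕ) (u₀ : ℤ → ℂ) : ∃! u : ℝ → ℤ → ℂ, IsSolution N u₀ u :=
  ⟨solution N u₀, isSolution_solution u₀, fun _ hu => hu.eq_solution⟩

lemma flow_eq (t : ℝ) (u₀ : ℤ → ℂ) : flow N t u₀ = solution N u₀ t := by
  rw [flow, (Classical.epsilon_spec ⟨_, isSolution_solution (N := N) u₀⟩ :
    IsSolution N u₀ (Classical.epsilon (IsSolution N u₀))).eq_solution]

end Solution

/-! ### Gaussian laws of the Fourier coefficients. -/

section Gaussian

lemma pi_withDensity_ofReal {ι : Type*} [Fintype ι] {E : ι → Type*} [∀ i, MeasurableSpace (E i)]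
    (μ : ∀ i, Measure (E i)) [∀ i, SigmaFinite (μ i)] {h : ∀ i, E i → ℝ}
    (hint : ∀ i, Integrable (h i) (μ i)) (hnn : ∀ i x, 0 ≤ h i x)
    [∀ i, IsProbabilityMeasure ((μ i).withDensity fun x => ENNReal.ofReal (h i x))] :
    Measure.pi (fun i => (μ i).withDensity fun x => ENNReal.ofReal (h i x)) =
      (Measure.pi μ).withDensity fun x => ENNReal.ofReal (∏ i, h i (x i)) := by
  refine Measure.pi_eq fun s hs => ?_
  rw [withDensity_apply _ (MeasurableSet.univ_pi hs), Measure.restrict_pi_pi,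
    ← ofReal_integral_eq_lintegral_ofReal (Integrable.fintype_prod_dep
      fun i => (hint i).mono_measure Measure.restrict_le_self)
      (Filter.Eventually.of_forall fun x => Finset.prod_nonneg fun i _ => hnn i _),
    integral_fintype_prod_eq_prod, ENNReal.ofReal_prod_of_nonneg
      fun i _ => integral_nonneg (hnn i)]
  refine Finset.prod_congr rfl fun i _ => ?_
  rw [withDensity_apply _ (hs i), ofReal_integral_eq_lintegral_ofReal
    ((hint i).mono_measure Measure.restrict_le_self) (Filter.Eventually.of_forall (hnn i))]

/-- The centered complex Gaussian law whose real and imaginary parts have variance `v`. -/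
def scaledGaussian (v : NNReal) : Measure ℂ :=
  ((gaussianReal 0 v).prod (gaussianReal 0 v)).map (fun p => (⟨p.1, p.2⟩ : ℂ))

lemma measurable_complex_mk : Measurable fun p : ℝ × ℝ => (⟨p.1, p.2⟩ : ℂ) :=
  Complex.measurableEquivRealProd.symm.measurable

instance (v : NNReal) : IsProbabilityMeasure (scaledGaussian v) :=
  Measure.isProbabilityMeasure_map measurable_complex_mk.aemeasurable

/-- The density of `scaledGaussian v`. -/
def scaledGaussianPDF (v : NNReal) (z : ℂ) : ℝ :=
  (2 * Real.pi * v)⁻¹ * Real.exp (-(‖z‖ ^ 2 / (2 * v)))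

lemma scaledGaussianPDF_nonneg (v : NNReal) (z : ℂ) : 0 ≤ scaledGaussianPDF v z := by
  unfold scaledGaussianPDF
  positivity

lemma continuous_scaledGaussianPDF (v : NNReal) : Continuous (scaledGaussianPDF v) := by
  unfold scaledGaussianPDF
  fun_prop

lemma scaledGaussian_eq_withDensity {v : NNReal} (hv : v ≠ 0) :
    scaledGaussian v = volume.withDensity fun z => ENNReal.ofReal (scaledGaussianPDF v z) := by
  rw [scaledGaussian, gaussianReal_of_var_ne_zero 0 hv,
    prod_withDensity (measurable_gaussianPDF 0 v) (measurable_gaussianPDF 0 v)]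
  have hmp : MeasurePreserving (fun p : ℝ × ℝ => (⟨p.1, p.2⟩ : ℂ)) (volume.prod volume) volume :=
    Complex.volume_preserving_equiv_real_prod.symm
  ext s hs
  have hpdf : Measurable fun z => ENNReal.ofReal (scaledGaussianPDF v z) :=
    (continuous_scaledGaussianPDF v).measurable.ennreal_ofReal
  rw [Measure.map_apply measurable_complex_mk hs,
    withDensity_apply _ (measurable_complex_mk hs), withDensity_apply _ hs,
    ← hmp.setLIntegral_comp_preimage hs hpdf]
  refine lintegral_congr fun p => ?_
  rw [gaussianPDF, gaussianPDF, ← ENNReal.ofReal_mul (gaussianPDFReal_nonneg _ _ _)]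
  congr 1
  rw [gaussianPDFReal, gaussianPDFReal, scaledGaussianPDF, mul_mul_mul_comm, ← Real.exp_add,
    ← mul_inv, Real.mul_self_sqrt (by positivity), ← Complex.normSq_eq_norm_sq,
    Complex.normSq_mk]
  congr 2
  ring

lemma integrable_scaledGaussianPDF {v : NNReal} (hv : v ≠ 0) :
    Integrable (scaledGaussianPDF v) := by
  refine ⟨(continuous_scaledGaussianPDF v).aestronglyMeasurable, ?_⟩
  rw [hasFiniteIntegral_iff_ofReal (Filter.Eventually.of_forall (scaledGaussianPDF_nonneg v))]
  have h1 : scaledGaussian v Set.univ = 1 := measure_univ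
  rw [scaledGaussian_eq_withDensity hv, withDensity_apply _ MeasurableSet.univ,
    Measure.restrict_univ] at h1
  rw [h1]
  exact ENNReal.one_lt_top

/-- Rotations preserve Lebesgue measure on `ℂ`, and the density depends only on `‖z‖`. This gives
invariance of the high modes. -/
lemma scaledGaussian_map_mul {v : NNReal} (hv : v ≠ 0) {c : ℂ} (hc : ‖c‖ = 1) :
    (scaledGaussian v).map (fun z => c * z) = scaledGaussian v := by
  have hmp : MeasurePreserving (fun z : ℂ => c * z) volume volume :=
    (rotation ⟨c, mem_sphere_zero_iff_norm.2 hc⟩).measurePreserving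
  have hpdf : Measurable fun z => ENNReal.ofReal (scaledGaussianPDF v z) :=
    (continuous_scaledGaussianPDF v).measurable.ennreal_ofReal
  rw [scaledGaussian_eq_withDensity hv]
  ext s hs
  rw [Measure.map_apply hmp.measurable hs, withDensity_apply _ (hmp.measurable hs),
    withDensity_apply _ hs, ← hmp.setLIntegral_comp_preimage hs hpdf]
  refine lintegral_congr fun p => ?_
  simp [scaledGaussianPDF, hc]

lemma complexGaussian_map_div (r : NNReal) :
    complexGaussian.map (fun z => z / ((r : ℝ) : ℂ)) = scaledGaussian (1 / 2 / r ^ 2) := by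
  have h1 : (gaussianReal 0 (1 / 2)).map (fun x => x / (r : ℝ)) =
      gaussianReal 0 (1 / 2 / r ^ 2) := by
    rw [gaussianReal_map_div_const, zero_div]
    rfl
  rw [complexGaussian, scaledGaussian, ← h1, Measure.map_prod_map _ _ (by fun_prop) (by fun_prop),
    Measure.map_map (by fun_prop) measurable_complex_mk,
    Measure.map_map measurable_complex_mk (by fun_prop)]
  congr 1
  funext p
  apply Complex.ext <;> simp [Complex.div_re, Complex.div_im, Complex.normSq_ofReal]
  all_goals
    by_cases hr : (r : ℝ) = 0
    · simp [hr]
    · field_simp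

lemma lintegral_enorm_pow_complexGaussian_lt_top (M : ℕ) :
    ∫⁻ z, ‖z‖ₑ ^ M ∂complexGaussian < ⊤ := by
  have h1 : MemLp (id : ℝ → ℝ) M (gaussianReal 0 (1 / 2)) := memLp_id_gaussianReal' _ (by simp)
  have h2 : MemLp (fun p : ℝ × ℝ => p.1) M
      ((gaussianReal 0 (1 / 2)).prod (gaussianReal 0 (1 / 2))) :=
    h1.comp_measurePreserving measurePreserving_fst
  have h3 : MemLp (fun p : ℝ × ℝ => p.2) M
      ((gaussianReal 0 (1 / 2)).prod (gaussianReal 0 (1 / 2))) :=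
    h1.comp_measurePreserving measurePreserving_snd
  have h4 := (h2.norm.add h3.norm)
  rw [complexGaussian, lintegral_map (by fun_prop) measurable_complex_mk]
  rcases Nat.eq_zero_or_pos M with rfl | hM
  · simp
  refine lt_of_le_of_lt (lintegral_mono fun p => ?_)
    (lintegral_rpow_enorm_lt_top_of_eLpNorm_lt_top (by exact_mod_cast hM.ne') (by simp) h4.2)
  simp only [ENNReal.toReal_natCast, ENNReal.rpow_natCast]
  gcongr
  rw [← ofReal_norm, ← ofReal_norm]
  refine ENNReal.ofReal_le_ofReal ?_
  refine (Complex.norm_le_abs_re_add_abs_im _).trans ?_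
  exact le_abs_self _

/-- The standard deviation weight `√(2π(1+k^{2n}))`. -/
def modeWeight (n : ℕ) (k : ℤ) : NNReal :=
  Real.toNNReal (Real.sqrt (2 * Real.pi * (1 + (k : ℝ) ^ (2 * n))))

lemma one_add_pow_pos (n : ℕ) (k : ℤ) : 0 < 1 + (k : ℝ) ^ (2 * n) := by
  have : 0 ≤ (k : ℝ) ^ (2 * n) := (even_two_mul n).pow_nonneg _
  linarith

lemma coe_modeWeight (n : ℕ) (k : ℤ) :
    (modeWeight n k : ℝ) = Real.sqrt (2 * Real.pi * (1 + (k : ℝ) ^ (2 * n))) :=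
  Real.coe_toNNReal _ (Real.sqrt_nonneg _)

lemma modeWeight_sq (n : ℕ) (k : ℤ) :
    (modeWeight n k : ℝ) ^ 2 = 2 * Real.pi * (1 + (k : ℝ) ^ (2 * n)) := by
  have := one_add_pow_pos n k
  rw [coe_modeWeight, Real.sq_sqrt (by positivity)]

lemma modeWeight_pos (n : ℕ) (k : ℤ) : 0 < modeWeight n k := by
  have := one_add_pow_pos n k
  rw [← NNReal.coe_pos, coe_modeWeight]
  positivity

/-- The law of the `k`-th Fourier coefficient under `μ_n`. -/
def modeLaw (n : ℕ) (k : ℤ) : Measure ℂ := scaledGaussian (1 / 2 / modeWeight n k ^ 2)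

instance (n : ℕ) (k : ℤ) : IsProbabilityMeasure (modeLaw n k) := by
  unfold modeLaw; infer_instance

lemma modeVar_ne_zero (n : ℕ) (k : ℤ) : (1 / 2 / modeWeight n k ^ 2 : NNReal) ≠ 0 := by
  have := modeWeight_pos n k
  positivity

lemma modeLaw_eq_map (n : ℕ) (k : ℤ) :
    modeLaw n k = complexGaussian.map (fun z => z / ((modeWeight n k : ℝ) : ℂ)) :=
  (complexGaussian_map_div _).symm

lemma gaussian_eq_infinitePi (n : ℕ) : gaussian n = Measure.infinitePi (modeLaw n) := by
  have h := Measure.infinitePi_map_pi (fun _ : ℤ => complexGaussian)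
    (f := fun k z => z / ((modeWeight n k : ℝ) : ℂ)) (fun k => by fun_prop)
  simp only [← modeLaw_eq_map] at h
  rw [← h, gaussian]
  simp only [coe_modeWeight]

instance (n : ℕ) : IsProbabilityMeasure (gaussian n) := by
  rw [gaussian_eq_infinitePi]; infer_instance

/-- The weight undoes the normalization of the mode, so all modes share the same finite moment. -/
lemma lintegral_modeLaw (n M : ℕ) (k : ℤ) :
    ∫⁻ z, (modeWeight n k * ‖z‖ₑ) ^ M ∂(modeLaw n k) = ∫⁻ z, ‖z‖ₑ ^ M ∂complexGaussian := by
  rw [modeLaw_eq_map, lintegral_map (by fun_prop) (by fun_prop)]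
  refine lintegral_congr fun z => ?_
  congr 1
  rw [enorm_eq_nnnorm, enorm_eq_nnnorm, ← ENNReal.coe_mul, nnnorm_div]
  congr 1
  have h1 : ‖((modeWeight n k : ℝ) : ℂ)‖₊ = modeWeight n k := by
    ext
    simp
  rw [h1, mul_div_cancel₀ _ (modeWeight_pos n k).ne']

/-- Splitting a product measure according to a predicate on the indices. -/
lemma map_symm_prod_infinitePi {ι : Type*} {X : ι → Type*} [∀ i, MeasurableSpace (X i)]
    (μ : ∀ i, Measure (X i)) [∀ i, IsProbabilityMeasure (μ i)] (p : ι → Prop) [DecidablePred p] :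
    ((Measure.infinitePi fun i : {i // p i} => μ i).prod
      (Measure.infinitePi fun i : {i // ¬p i} => μ i)).map
        (MeasurableEquiv.piEquivPiSubtypeProd X p).symm = Measure.infinitePi μ := by
  refine Measure.eq_infinitePi _ fun s t ht => ?_
  rw [Measure.map_apply (MeasurableEquiv.measurable _)
    (MeasurableSet.pi s.countable_toSet fun i _ => ht i)]
  have : (MeasurableEquiv.piEquivPiSubtypeProd X p).symm ⁻¹' (Set.pi s t) =
      (Set.pi (s.subtype p) fun i : {i // p i} => t i) ×ˢ
        (Set.pi (s.subtype fun i => ¬p i) fun i : {i // ¬p i} => t i) := by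
    ext ⟨x, y⟩
    simp only [Set.mem_preimage, Set.mem_pi, Set.mem_prod, Finset.mem_coe, Finset.mem_subtype]
    constructor
    · intro h
      refine ⟨fun i hi => ?_, fun i hi => ?_⟩
      · have := h i hi
        simpa [MeasurableEquiv.piEquivPiSubtypeProd, Equiv.piEquivPiSubtypeProd, i.2] using this
      · have := h i hi
        simpa [MeasurableEquiv.piEquivPiSubtypeProd, Equiv.piEquivPiSubtypeProd, i.2] using this
    · rintro ⟨h1, h2⟩ i hi
      by_cases hp : p i
      · have := h1 ⟨i, hp⟩ hi
        simpa [MeasurableEquiv.piEquivPiSubtypeProd, Equiv.piEquivPiSubtypeProd, hp] using this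
      · have := h2 ⟨i, hp⟩ hi
        simpa [MeasurableEquiv.piEquivPiSubtypeProd, Equiv.piEquivPiSubtypeProd, hp] using this
  rw [this, Measure.prod_prod, Measure.infinitePi_pi _ (t := fun i : {i // p i} => t i) fun i _ => ht i,
    Measure.infinitePi_pi _ (t := fun i : {i // ¬p i} => t i) fun i _ => ht i,
    Finset.prod_subtype_eq_prod_filter (fun i => μ i (t i)),
    Finset.prod_subtype_eq_prod_filter (fun i => μ i (t i)),
    Finset.prod_filter_mul_prod_filter_not]

end Gaussian

/-! ### An invariant reference measure for the flow. -/

section ReferenceMeasure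

open TrigPoly

variable (n N : ℕ)

/-- The law of the low modes. -/
def lowLaw : Measure (LowModes N) := Measure.pi fun k : lowFreq N => modeLaw n k

instance : IsProbabilityMeasure (lowLaw n N) := by unfold lowLaw; infer_instance

/-- The density of the law of the low modes. -/
def lowDensity (x : LowModes N) : ℝ :=
  ∏ k : lowFreq N, scaledGaussianPDF (1 / 2 / modeWeight n k ^ 2) (x k)

lemma lowDensity_nonneg (x : LowModes N) : 0 ≤ lowDensity n N x :=
  Finset.prod_nonneg fun _ _ => scaledGaussianPDF_nonneg _ _

lemma continuous_lowDensity : Continuous (lowDensity n N) :=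
  continuous_finsetProd _ fun k _ => (continuous_scaledGaussianPDF _).comp (continuous_apply k)

lemma lowLaw_eq_withDensity :
    lowLaw n N = volume.withDensity fun x => ENNReal.ofReal (lowDensity n N x) := by
  have h : ∀ k : lowFreq N, modeLaw n k = volume.withDensity fun z =>
      ENNReal.ofReal (scaledGaussianPDF (1 / 2 / modeWeight n k ^ 2) z) :=
    fun k => scaledGaussian_eq_withDensity (modeVar_ne_zero n k)
  have hp : ∀ k : lowFreq N, IsProbabilityMeasure (volume.withDensity fun z =>
      ENNReal.ofReal (scaledGaussianPDF (1 / 2 / modeWeight n k ^ 2) z)) := fun k => by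
    rw [← h]; infer_instance
  rw [lowLaw]
  simp only [h]
  exact pi_withDensity_ofReal _ (fun k => integrable_scaledGaussianPDF (modeVar_ne_zero n k))
    (fun _ _ => scaledGaussianPDF_nonneg _ _)

/-- The frequencies `|k| > N`. -/
abbrev HighModes := {k : ℤ // ¬k ∈ lowFreq N} → ℂ

/-- The law of the high modes. -/
def highLaw : Measure (HighModes N) :=
  Measure.infinitePi fun k : {k : ℤ // ¬k ∈ lowFreq N} => modeLaw n k

instance : IsProbabilityMeasure (highLaw n N) := by unfold highLaw; infer_instance

/-- Splitting a distribution into its low and its high modes. -/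
def split : (ℤ → ℂ) ≃ᵐ LowModes N × HighModes N :=
  MeasurableEquiv.piEquivPiSubtypeProd (fun _ : ℤ => ℂ) (· ∈ lowFreq N)

variable {N}

lemma split_fst (u : ℤ → ℂ) : (split N u).1 = lowPart N u := rfl

lemma split_snd (u : ℤ → ℂ) (k : {k : ℤ // ¬k ∈ lowFreq N}) : (split N u).2 k = u k := rfl

lemma lowPart_split_symm (z : LowModes N × HighModes N) : lowPart N ((split N).symm z) = z.1 := by
  rw [← split_fst, MeasurableEquiv.apply_symm_apply]

lemma measurable_lowPart : Measurable (lowPart N) :=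
  measurable_fst.comp (split N).measurable

variable (N)

/-- The product of Lebesgue measure on the low modes and the Gaussian law of the high modes. -/
def refMeasure : Measure (ℤ → ℂ) :=
  ((volume : Measure (LowModes N)).prod (highLaw n N)).map (split N).symm

/-- Only the finitely many low modes need a density, so `μ_n` becomes absolutely continuous with
respect to a measure that the flow preserves. -/
lemma gaussian_eq_withDensity :
    gaussian n = (refMeasure n N).withDensity
      fun u => ENNReal.ofReal (lowDensity n N (lowPart N u)) := by
  have h1 : gaussian n = ((lowLaw n N).prod (highLaw n N)).map (split N).symm := by
    rw [gaussian_eq_infinitePi, ← map_symm_prod_infinitePi (modeLaw n) (· ∈ lowFreq N),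
      Measure.infinitePi_eq_pi]
    rfl
  have hd : Measurable fun x => ENNReal.ofReal (lowDensity n N x) :=
    (continuous_lowDensity n N).measurable.ennreal_ofReal
  have hd' : Measurable fun u => ENNReal.ofReal (lowDensity n N (lowPart N u)) :=
    hd.comp measurable_lowPart
  rw [h1, lowLaw_eq_withDensity, prod_withDensity_left hd]
  ext s hs
  rw [Measure.map_apply (split N).symm.measurable hs,
    withDensity_apply _ ((split N).symm.measurable hs), withDensity_apply _ hs, refMeasure,
    setLIntegral_map hs hd' (split N).symm.measurable]
  simp only [lowPart_split_symm]

variable {N}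

/-- Lebesgue measure is a multiple of the Hausdorff measure of full dimension, for which Liouville's
theorem was proved. -/
lemma measurePreserving_flowMap_volume (t : ℝ) :
    MeasurePreserving ((conservedField (N := N)).flowMap t) volume volume := by
  have h := (conservedField (N := N)).measurePreserving_flowMap trace_fderiv_field t
  rw [Measure.isAddLeftInvariant_eq_smul (volume : Measure (LowModes N))
    (Measure.hausdorffMeasure (Module.finrank ℝ (LowModes N)))]
  exact h.smul_measure _

/-- The free evolution of the high modes. -/
def rotate (t : ℝ) (y : HighModes N) : HighModes N :=
  fun k => Complex.exp (Complex.I * k ^ 3 * t) * y k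

lemma measurePreserving_rotate (t : ℝ) :
    MeasurePreserving (rotate (N := N) t) (highLaw n N) (highLaw n N) := by
  refine ⟨by unfold rotate; fun_prop, ?_⟩
  have := Measure.infinitePi_map_pi (fun k : {k : ℤ // ¬k ∈ lowFreq N} => modeLaw n k)
    (f := fun k z => Complex.exp (Complex.I * k ^ 3 * t) * z) (fun k => by fun_prop)
  rw [highLaw]
  refine this.trans ?_
  congr 1
  funext k
  refine scaledGaussian_map_mul (modeVar_ne_zero n k) ?_
  rw [show Complex.I * (k : ℂ) ^ 3 * t = ((k ^ 3 * t : ℝ) : ℂ) * Complex.I by push_cast; ring]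
  exact Complex.norm_exp_ofReal_mul_I _

lemma split_flow (t : ℝ) (u : ℤ → ℂ) :
    split N (flow N t u) =
      Prod.map ((conservedField (N := N)).flowMap t) (rotate t) (split N u) := by
  rw [flow_eq]
  refine Prod.ext ?_ ?_
  · exact lowPart_solution u t
  · funext k
    rw [split_snd, solution, dif_neg k.2]
    rfl

lemma lowPart_flow (t : ℝ) (u : ℤ → ℂ) :
    lowPart N (flow N t u) = (conservedField (N := N)).flowMap t (lowPart N u) := by
  rw [flow_eq, lowPart_solution]

lemma flow_eq_conj (t : ℝ) :
    flow N t = (split N).symm ∘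
      Prod.map ((conservedField (N := N)).flowMap t) (rotate t) ∘ split N := by
  funext u
  rw [Function.comp_apply, Function.comp_apply, ← split_flow, MeasurableEquiv.symm_apply_apply]

lemma measurePreserving_flow (t : ℝ) :
    MeasurePreserving (flow N t) (refMeasure n N) (refMeasure n N) := by
  have h1 : MeasurePreserving (split N).symm
      ((volume : Measure (LowModes N)).prod (highLaw n N)) (refMeasure n N) :=
    ⟨(split N).symm.measurable, rfl⟩
  rw [flow_eq_conj]
  exact h1.comp (((measurePreserving_flowMap_volume t).prod (measurePreserving_rotate n t)).comp
    (h1.symm _))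

lemma rotate_neg_rotate (t : ℝ) (y : HighModes N) : rotate (-t) (rotate t y) = y := by
  funext k
  rw [rotate, rotate, ← mul_assoc, ← Complex.exp_add]
  simp

lemma flow_neg_flow (t : ℝ) (u : ℤ → ℂ) : flow N (-t) (flow N t u) = u := by
  refine (split N).injective ?_
  rw [split_flow, split_flow]
  exact Prod.ext (conservedField.flowMap_neg_flowMap t _) (rotate_neg_rotate t _)

variable (N) in
/-- The flow as a measurable equivalence. -/
def flowEquiv (t : ℝ) : (ℤ → ℂ) ≃ᵐ (ℤ → ℂ) where
  toFun := flow N t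
  invFun := flow N (-t)
  left_inv := flow_neg_flow t
  right_inv u := by simpa using flow_neg_flow (N := N) (-t) u
  measurable_toFun := (measurePreserving_flow 0 t).measurable
  measurable_invFun := (measurePreserving_flow 0 (-t)).measurable

lemma measurableEmbedding_flow (t : ℝ) : MeasurableEmbedding (flow N t) :=
  (flowEquiv N t).measurableEmbedding

lemma setIntegral_gaussian_eq {G : LowModes N → ℝ} {B : Set (ℤ → ℂ)} (hB : MeasurableSet B) :
    ∫ u in B, G (lowPart N u) ∂(gaussian n) =
      ∫ u in B, lowDensity n N (lowPart N u) * G (lowPart N u) ∂(refMeasure n N) := by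
  have hd : Measurable fun u => (lowDensity n N (lowPart N u)).toNNReal :=
    ((continuous_lowDensity n N).measurable.comp measurable_lowPart).real_toNNReal
  rw [gaussian_eq_withDensity n N]
  refine (setIntegral_withDensity_eq_setIntegral_smul hd _ hB).trans ?_
  refine integral_congr_ae (Filter.Eventually.of_forall fun u => ?_)
  simp only [NNReal.smul_def, Real.coe_toNNReal _ (lowDensity_nonneg n N _), smul_eq_mul]

lemma integrable_refMeasure {G : LowModes N → ℝ}
    (hG : Integrable (fun u => G (lowPart N u)) (gaussian n)) :
    Integrable (fun u => lowDensity n N (lowPart N u) * G (lowPart N u)) (refMeasure n N) := by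
  have hd : Measurable fun u => (lowDensity n N (lowPart N u)).toNNReal :=
    ((continuous_lowDensity n N).measurable.comp measurable_lowPart).real_toNNReal
  rw [gaussian_eq_withDensity n N] at hG
  have := (integrable_withDensity_iff_integrable_smul hd).1 hG
  refine this.congr (Filter.Eventually.of_forall fun u => ?_)
  simp only [NNReal.smul_def, Real.coe_toNNReal _ (lowDensity_nonneg n N _), smul_eq_mul]

/-- Invariance of `refMeasure` brings both integrals onto the same set `B`. Enlarging `B` to the
whole space makes the bound independent of `B`, and the high modes integrate to one. -/
lemma ofReal_abs_setIntegral_flow_sub_le {G : LowModes N → ℝ} (hGc : Continuous G)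
    (hG : Integrable (fun u => G (lowPart N u)) (gaussian n)) (t : ℝ) {B : Set (ℤ → ℂ)}
    (hB : MeasurableSet B) :
    ENNReal.ofReal |∫ u in flow N t '' B, G (lowPart N u) ∂(gaussian n) -
        ∫ u in B, G (lowPart N u) ∂(gaussian n)| ≤
      ∫⁻ x : LowModes N, ‖lowDensity n N ((conservedField (N := N)).flowMap t x) *
        G ((conservedField (N := N)).flowMap t x) - lowDensity n N x * G x‖ₑ := by
  have hmp := measurePreserving_flow (N := N) n t
  have hemb := measurableEmbedding_flow (N := N) t
  have hint := integrable_refMeasure n hG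
  have hint2 : Integrable (fun u => lowDensity n N (lowPart N (flow N t u)) *
      G (lowPart N (flow N t u))) (refMeasure n N) := (hmp.integrable_comp_emb hemb).2 hint
  rw [setIntegral_gaussian_eq n (hemb.measurableSet_image.2 hB), setIntegral_gaussian_eq n hB,
    hmp.setIntegral_image_emb hemb, ← integral_sub hint2.integrableOn hint.integrableOn,
    ← Real.norm_eq_abs, ofReal_norm]
  refine (enorm_integral_le_lintegral_enorm _).trans ?_
  refine (lintegral_mono' Measure.restrict_le_self le_rfl).trans ?_
  set k : LowModes N → ENNReal := fun x => ‖lowDensity n N ((conservedField (N := N)).flowMap t x) *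
        G ((conservedField (N := N)).flowMap t x) - lowDensity n N x * G x‖ₑ
  have hk : Measurable k := by
    have h1 := (conservedField (N := N)).continuous_flowMap t
    have h2 := continuous_lowDensity n N
    exact (((h2.comp h1).mul (hGc.comp h1)).sub (h2.mul hGc)).enorm.measurable
  have h1 : ∀ u, ‖lowDensity n N (lowPart N (flow N t u)) * G (lowPart N (flow N t u)) -
      lowDensity n N (lowPart N u) * G (lowPart N u)‖ₑ = k (lowPart N u) := fun u => by
    rw [lowPart_flow]
  simp only [h1]
  have hk1 : Measurable fun u => k (lowPart N u) := hk.comp measurable_lowPart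
  have hk2 : Measurable fun z : LowModes N × HighModes N => k z.1 := hk.comp measurable_fst
  rw [refMeasure, lintegral_map hk1 (split N).symm.measurable]
  simp only [lowPart_split_symm]
  rw [lintegral_prod _ hk2.aemeasurable]
  simp

end ReferenceMeasure

/-! ### The weighted density as a function of the energies, and its rate of change. -/

section Cutoff

open TrigPoly

variable {n N : ℕ} {χ : ℝ → ℝ} {R : ℝ}

/-- The exponent of the Gaussian density of the low modes. -/
lemma exists_lowDensity_eq (n N : ℕ) : ∃ c : ℝ, ∀ x : LowModes N, lowDensity n N x =
    c * Real.exp (-(2 * Real.pi * ∑ k : lowFreq N, (1 + (k : ℝ) ^ (2 * n)) * ‖x k‖ ^ 2)) := by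
  refine ⟨∏ k : lowFreq N, (2 * Real.pi * (1 / 2 / modeWeight n k ^ 2 : NNReal))⁻¹, fun x => ?_⟩
  simp only [lowDensity, scaledGaussianPDF]
  rw [Finset.prod_mul_distrib, ← Real.exp_sum, Finset.mul_sum, ← Finset.sum_neg_distrib]
  congr 2
  refine Finset.sum_congr rfl fun k _ => ?_
  have h1 := modeWeight_sq n k
  have h2 : (0 : ℝ) < modeWeight n k := modeWeight_pos n k
  rw [← mul_assoc, ← h1]
  push_cast
  field_simp

lemma rem_toPoly (n : ℕ) (x : LowModes N) : Rem n (ev (toPoly x)) =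
    energy (2 * n + 1) (toPoly x) -
      2 * Real.pi * ∑ k : lowFreq N, (k : ℝ) ^ (2 * n) * ‖x k‖ ^ 2 := by
  rw [Rem, E_ev, integral_norm_iteratedDeriv_sq_ev _ n (lowFreq N)
    fun _ h => mem_of_coeff_toPoly_ne_zero h, ← Finset.sum_coe_sort]
  simp only [coeff_toPoly_coe]

/-- The product of the cut-off functions. -/
def cutoff (χ : ℝ → ℝ) (n : ℕ) (R : ℝ) (f : TrigPoly) : ℝ :=
  ∏ l ∈ Finset.range n, χ (energy (2 * l + 1) f / R)

lemma F_ev (f : TrigPoly) : F χ n R (ev f) = cutoff χ n R f * Real.exp (-Rem n (ev f)) := by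
  simp only [F, cutoff, E_ev]

/-- The Gaussian exponent is `-(E_1 + ‖∂_x^n u‖²)`, and adding `-R_n` completes the second term to
`-E_{2n+1}`. The density thus depends on `x` only through energies. -/
lemma exists_lowDensity_mul_F_eq (χ : ℝ → ℝ) (n N : ℕ) (R : ℝ) : ∃ c : ℝ, ∀ x : LowModes N,
    lowDensity n N x * Real.exp (-Rem n (ev (toPoly x))) =
      c * Real.exp (-(energy (2 * n + 1) (toPoly x) + energy 1 (toPoly x))) ∧
    lowDensity n N x * F χ n R (ev (toPoly x)) = c * (cutoff χ n R (toPoly x) *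
      Real.exp (-(energy (2 * n + 1) (toPoly x) + energy 1 (toPoly x)))) := by
  obtain ⟨c, hc⟩ := exists_lowDensity_eq n N
  have h : ∀ x : LowModes N, lowDensity n N x * Real.exp (-Rem n (ev (toPoly x))) =
      c * Real.exp (-(energy (2 * n + 1) (toPoly x) + energy 1 (toPoly x))) := fun x => by
    rw [hc, mul_assoc, ← Real.exp_add, rem_toPoly, energy_one_toPoly, mass]
    simp only [add_mul, one_mul, Finset.sum_add_distrib]
    congr 2
    ring
  refine ⟨c, fun x => ⟨h x, ?_⟩⟩
  rw [F_ev, mul_left_comm, h]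
  ring

lemma continuous_energy_toPoly (m : ℕ) : Continuous fun x : LowModes N => energy m (toPoly x) :=
  (smoothFamily_toPoly.contDiff_energy m).continuous

lemma continuous_F_toPoly (hχ : Continuous χ) :
    Continuous fun x : LowModes N => F χ n R (ev (toPoly x)) := by
  simp only [F_ev, cutoff, rem_toPoly]
  have h := fun m => continuous_energy_toPoly (N := N) m
  refine Continuous.mul ?_ ?_
  · exact continuous_finsetProd _ fun l _ => hχ.comp ((h _).div_const R)
  · refine Real.continuous_exp.comp (((h _).sub ?_).neg)
    fun_prop

lemma abs_le_of_ne_zero (hR : 0 < R) {K₀ : ℝ} (hK : ∀ y, χ y ≠ 0 → |y| ≤ K₀) {y : ℝ}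
    (h : χ (y / R) ≠ 0) : |y| ≤ K₀ * R := by
  have := hK _ h
  rwa [abs_div, abs_of_pos hR, div_le_iff₀ hR] at this

/-- The density `F_{n,R}` is bounded, uniformly in the degree. -/
lemma exists_abs_F_le (hn : 2 ≤ n) (hχ : Continuous χ) (hχc : HasCompactSupport χ) (hR : 0 < R) :
    ∃ C : ℝ, ∀ f : TrigPoly, |F χ n R (ev f)| ≤ C := by
  obtain ⟨A, hA⟩ := hχc.exists_bound_of_continuous hχ
  obtain ⟨K₀, hK₀⟩ := hχc.isCompact.isBounded.exists_norm_le
  obtain ⟨C, hC⟩ := exists_abs_rem_le hn (K₀ * R)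
  have hA0 : 0 ≤ A := (norm_nonneg _).trans (hA 0)
  refine ⟨A ^ n * Real.exp C, fun f => ?_⟩
  rw [F_ev]
  by_cases h : cutoff χ n R f = 0
  · rw [h, zero_mul, abs_zero]; positivity
  · have h1 : ∀ j < n, |energy (2 * j + 1) f| ≤ K₀ * R := by
      intro j hj
      refine abs_le_of_ne_zero hR (fun y hy => hK₀ y (subset_tsupport χ hy)) ?_
      exact Finset.prod_ne_zero_iff.1 h j (Finset.mem_range.2 hj)
    rw [abs_mul, Real.abs_exp]
    refine mul_le_mul ?_ (Real.exp_le_exp.2 ?_) (Real.exp_pos _).le (by positivity)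
    · rw [cutoff, Finset.abs_prod]
      refine (Finset.prod_le_prod (fun _ _ => abs_nonneg _) (fun i _ => hA _)).trans ?_
      simp
    · linarith [neg_le_of_abs_le (hC f h1)]

/-- By the chain rule the rate is linear in the energy drifts. Where the cut-offs act, `R_n` is
bounded, so the exponential factor is at most a constant times the Gaussian density; the constant
does not depend on `N`. -/
lemma exists_hasDerivAt_lowDensity_mul_F (hn : 2 ≤ n) (hχ : ContDiff ℝ ∞ χ)
    (hχc : HasCompactSupport χ) (hR : 0 < R) :
    ∃ C : ℝ, 0 ≤ C ∧ ∀ (N : ℕ) (γ : ℝ → LowModes N) (t : ℝ), HasDerivAt γ (field N (γ t)) t →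
      ∃ d, HasDerivAt (fun s => lowDensity n N (γ s) * F χ n R (ev (toPoly (γ s)))) d t ∧
        |d| ≤ C * (lowDensity n N (γ t) *
          ∑ l ∈ Finset.range (n + 1), |energyRate N (2 * l + 1) (toPoly (γ t))|) := by
  obtain ⟨A₁, hA₁⟩ := hχc.exists_bound_of_continuous hχ.continuous
  obtain ⟨A₂, hA₂⟩ := hχc.deriv.exists_bound_of_continuous (hχ.continuous_deriv (by simp))
  obtain ⟨K₀, hK₀⟩ := hχc.isCompact.isBounded.exists_norm_le
  obtain ⟨C, hC⟩ := exists_abs_rem_le hn (K₀ * R)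
  set A := max A₁ A₂
  have hA0 : 0 ≤ A := ((norm_nonneg _).trans (hA₁ 0)).trans (le_max_left _ _)
  have hAχ : ∀ y, |χ y| ≤ A := fun y => (hA₁ y).trans (le_max_left _ _)
  have hAχ' : ∀ y, |deriv χ y| ≤ A := fun y => (hA₂ y).trans (le_max_right _ _)
  refine ⟨Real.exp C * (A ^ n * R⁻¹ + A ^ n), by positivity, fun N γ t hγ => ?_⟩
  obtain ⟨c, hc⟩ := exists_lowDensity_mul_F_eq χ n N R
  set e : ℕ → ℝ → ℝ := fun l s => energy (2 * l + 1) (toPoly (γ s))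
  set r : ℕ → ℝ := fun l => energyRate N (2 * l + 1) (toPoly (γ t))
  have he : ∀ l, HasDerivAt (e l) (r l) t := fun l => hasDerivAt_energy_toPoly hγ _
  have hχe : ∀ l, HasDerivAt (fun s => χ (e l s / R)) (deriv χ (e l t / R) * (r l / R)) t := fun l =>
    ((hχ.differentiable (by simp)) _).hasDerivAt.comp t ((he l).div_const R)
  set P' := ∑ i ∈ Finset.range n, (∏ j ∈ (Finset.range n).erase i, χ (e j t / R)) •
    (deriv χ (e i t / R) * (r i / R))
  have hP : HasDerivAt (fun s => cutoff χ n R (toPoly (γ s))) P' t :=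
    HasDerivAt.fun_finsetProd fun l _ => hχe l
  have hr0 : r 0 = 0 := energyRate_one_toPoly _
  have hH : HasDerivAt (fun s => Real.exp (-(e n s + e 0 s))) (Real.exp (-(e n t + e 0 t)) * (-r n))
      t := by
    have := ((he n).add (he 0)).neg.exp
    rw [hr0, add_zero] at this
    exact this
  have hK := (hP.mul hH).const_mul c
  have heq : (fun s => lowDensity n N (γ s) * F χ n R (ev (toPoly (γ s)))) =
      fun s => c * (cutoff χ n R (toPoly (γ s)) * Real.exp (-(e n s + e 0 s))) :=
    funext fun s => (hc (γ s)).2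
  rw [heq]
  refine ⟨_, hK, ?_⟩
  have hsum0 : 0 ≤ ∑ l ∈ Finset.range (n + 1), |r l| := Finset.sum_nonneg fun _ _ => abs_nonneg _
  by_cases hall : ∀ j < n, |e j t| ≤ K₀ * R
  · have h1 : c * Real.exp (-(e n t + e 0 t)) =
        lowDensity n N (γ t) * Real.exp (-Rem n (ev (toPoly (γ t)))) := ((hc (γ t)).1).symm
    have h2 : |c * Real.exp (-(e n t + e 0 t))| ≤ lowDensity n N (γ t) * Real.exp C := by
      rw [h1, abs_mul, Real.abs_exp, abs_of_nonneg (lowDensity_nonneg n N _)]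
      refine mul_le_mul_of_nonneg_left (Real.exp_le_exp.2 ?_) (lowDensity_nonneg n N _)
      linarith [neg_le_of_abs_le (hC (toPoly (γ t)) hall)]
    have h3 : |cutoff χ n R (toPoly (γ t))| ≤ A ^ n := by
      rw [cutoff, Finset.abs_prod]
      refine (Finset.prod_le_prod (fun _ _ => abs_nonneg _) (fun i _ => hAχ _)).trans ?_
      simp
    have h4 : |P'| ≤ A ^ n * R⁻¹ * ∑ l ∈ Finset.range n, |r l| := by
      refine (Finset.abs_sum_le_sum_abs _ _).trans ?_
      rw [Finset.mul_sum]
      refine Finset.sum_le_sum fun i hi => ?_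
      rw [smul_eq_mul, abs_mul, abs_mul, Finset.abs_prod, abs_div, abs_of_pos hR]
      calc (∏ j ∈ (Finset.range n).erase i, |χ (e j t / R)|) *
            (|deriv χ (e i t / R)| * (|r i| / R)) ≤
          (∏ j ∈ (Finset.range n).erase i, A) * (A * (|r i| / R)) := by
            refine mul_le_mul (Finset.prod_le_prod (fun _ _ => abs_nonneg _) fun j _ => hAχ _)
              (mul_le_mul_of_nonneg_right (hAχ' _) (by positivity)) (by positivity)
              (Finset.prod_nonneg fun _ _ => hA0)
        _ = (∏ j ∈ Finset.range n, A) * R⁻¹ * |r i| := by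
            rw [← Finset.prod_erase_mul _ _ hi]; ring
        _ = A ^ n * R⁻¹ * |r i| := by simp
    have h5 : |P' + cutoff χ n R (toPoly (γ t)) * (-r n)| ≤
        (A ^ n * R⁻¹ + A ^ n) * ∑ l ∈ Finset.range (n + 1), |r l| := by
      refine (abs_add_le _ _).trans ?_
      rw [add_mul, abs_mul, abs_neg, Finset.sum_range_succ]
      have h6 : 0 ≤ A ^ n * R⁻¹ * |r n| := by positivity
      have h7 : 0 ≤ A ^ n * ∑ l ∈ Finset.range n, |r l| :=
        mul_nonneg (by positivity) (Finset.sum_nonneg fun _ _ => abs_nonneg _)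
      have h8 := mul_le_mul_of_nonneg_right h3 (abs_nonneg (r n))
      linarith
    have h9 : c * (P' * Real.exp (-(e n t + e 0 t)) +
        cutoff χ n R (toPoly (γ t)) * (Real.exp (-(e n t + e 0 t)) * -r n)) =
        (c * Real.exp (-(e n t + e 0 t))) * (P' + cutoff χ n R (toPoly (γ t)) * (-r n)) := by
      ring
    rw [h9, abs_mul]
    refine (mul_le_mul h2 h5 (abs_nonneg _)
      (mul_nonneg (lowDensity_nonneg n N _) (Real.exp_pos _).le)).trans (le_of_eq ?_)
    ring
  -- Some energy lies off the closed support of its cut-off. There `χ` and its derivative both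
  -- vanish, so each term of the derivative is zero.
  · push Not at hall
    obtain ⟨j, hj, hlt⟩ := hall
    have hnot : e j t / R ∉ tsupport χ := by
      intro h
      have := hK₀ _ h
      rw [Real.norm_eq_abs, abs_div, abs_of_pos hR, div_le_iff₀ hR] at this
      linarith
    have h0 : χ (e j t / R) = 0 := image_eq_zero_of_notMem_tsupport hnot
    have h1 : deriv χ (e j t / R) = 0 :=
      image_eq_zero_of_notMem_tsupport fun h => hnot (tsupport_deriv_subset h)
    have h2 : cutoff χ n R (toPoly (γ t)) = 0 :=
      Finset.prod_eq_zero (Finset.mem_range.2 hj) h0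
    have h3 : P' = 0 := by
      refine Finset.sum_eq_zero fun i _ => ?_
      by_cases hij : i = j
      · rw [hij, h1, zero_mul, smul_zero]
      · rw [Finset.prod_eq_zero (Finset.mem_erase.2 ⟨Ne.symm hij, Finset.mem_range.2 hj⟩) h0,
          zero_smul]
    rw [h2, h3]
    simp only [zero_mul, add_zero, mul_zero, abs_zero]
    exact mul_nonneg (mul_nonneg (Real.exp_pos C).le (by positivity))
      (mul_nonneg (lowDensity_nonneg n N (γ t)) hsum0)

end Cutoff

/-! ### Almost sure decay of the coefficients, in quantitative form. -/

section Moments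

open TrigPoly Maj

variable {N : ℕ}

lemma wt_pow_le_modeWeight (n : ℕ) (k : ℤ) : wt k ^ n ≤ 2 ^ n * modeWeight n k := by
  have h1 : ((wt k : ℝ) ^ n) ^ 2 ≤ (2 ^ n * modeWeight n k : ℝ) ^ 2 := by
    rw [mul_pow, modeWeight_sq, ← pow_mul, mul_comm n 2, ← Even.pow_abs (even_two_mul n) (k : ℝ),
      ← pow_mul, mul_comm n 2]
    have h2 : (wt k : ℝ) = 1 + |(k : ℝ)| := by
      simp [wt]
    rw [h2]
    have h3 : (1 + |(k : ℝ)|) ^ (2 * n) ≤ 2 ^ (2 * n) * (1 + |(k : ℝ)| ^ (2 * n)) := by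
      have h4 : 1 + |(k : ℝ)| ≤ 2 * max 1 |(k : ℝ)| := by
        linarith [le_max_left 1 |(k : ℝ)|, le_max_right 1 |(k : ℝ)|]
      calc (1 + |(k : ℝ)|) ^ (2 * n) ≤ (2 * max 1 |(k : ℝ)|) ^ (2 * n) := by gcongr
        _ = 2 ^ (2 * n) * (max 1 |(k : ℝ)|) ^ (2 * n) := mul_pow _ _ _
        _ ≤ _ := by
            gcongr
            rcases max_choice 1 |(k : ℝ)| with h | h
            · rw [h, one_pow]
              have := abs_nonneg (k : ℝ)
              have : 0 ≤ |(k : ℝ)| ^ (2 * n) := by positivity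
              linarith
            · rw [h]; linarith
    refine h3.trans ?_
    have h5 : 1 ≤ 2 * Real.pi := by linarith [Real.pi_gt_three]
    have h6 : (0 : ℝ) ≤ 1 + |(k : ℝ)| ^ (2 * n) := by positivity
    nlinarith [mul_le_mul_of_nonneg_right h5 h6, show (0 : ℝ) < 2 ^ (2 * n) by positivity]
  have h2 := (pow_le_pow_iff_left₀ (by positivity) (by positivity) two_ne_zero).1 h1
  exact_mod_cast h2

/-- A weighted sum of the `M`-th powers of the normalized low modes. -/
def modeSum (n M : ℕ) (x : LowModes N) : NNReal :=
  ∑ k : lowFreq N, (modeWeight n k * ‖x k‖₊) ^ M * wt k ^ (-2 : ℝ)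

lemma continuous_modeSum (n M : ℕ) : Continuous (modeSum (N := N) n M) := by
  unfold modeSum
  fun_prop

/-- One term of a sum is bounded by the sum; taking `M`-th roots turns the summability weight `⟨k⟩²`
into a loss of only `⟨k⟩^{2/M}`. -/
lemma nnnorm_le_modeSum {n M : ℕ} (hM : M ≠ 0) (x : LowModes N) (k : lowFreq N) :
    ‖x k‖₊ ≤ 2 ^ n * modeSum n M x ^ (1 / M : ℝ) * wt k ^ (-(n - 2 / M : ℝ)) := by
  have hw : (wt k : NNReal) ≠ 0 := (zero_lt_one.trans_le (one_le_wt k)).ne'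
  have h1 : (modeWeight n k * ‖x k‖₊) ^ M * wt k ^ (-2 : ℝ) ≤ modeSum n M x :=
    Finset.single_le_sum (f := fun k : lowFreq N => (modeWeight n k * ‖x k‖₊) ^ M * wt k ^ (-2 : ℝ))
      (fun _ _ => zero_le) (Finset.mem_univ k)
  have hMR : (M : ℝ) ≠ 0 := by exact_mod_cast hM
  have h2 : modeWeight n k * ‖x k‖₊ ≤ modeSum n M x ^ (1 / M : ℝ) * wt k ^ (2 / M : ℝ) := by
    have h3 : (modeWeight n k * ‖x k‖₊) ^ M ≤ modeSum n M x * wt k ^ (2 : ℝ) := by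
      calc (modeWeight n k * ‖x k‖₊) ^ M =
          (modeWeight n k * ‖x k‖₊) ^ M * wt k ^ (-2 : ℝ) * wt k ^ (2 : ℝ) := by
            rw [mul_assoc, ← NNReal.rpow_add hw]
            norm_num
        _ ≤ _ := mul_le_mul_left h1 _
    have h4 := NNReal.rpow_le_rpow h3 (show (0 : ℝ) ≤ 1 / M by positivity)
    rw [NNReal.mul_rpow, ← NNReal.rpow_natCast, ← NNReal.rpow_mul, ← NNReal.rpow_mul,
      mul_one_div_cancel hMR, NNReal.rpow_one, mul_one_div] at h4
    exact h4
  have h5 : ‖x k‖₊ * wt k ^ n ≤ 2 ^ n * modeSum n M x ^ (1 / M : ℝ) * wt k ^ (2 / M : ℝ) := by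
    calc ‖x k‖₊ * wt k ^ n ≤ ‖x k‖₊ * (2 ^ n * modeWeight n k) :=
          mul_le_mul_right (wt_pow_le_modeWeight n k) _
      _ = 2 ^ n * (modeWeight n k * ‖x k‖₊) := by ring
      _ ≤ 2 ^ n * (modeSum n M x ^ (1 / M : ℝ) * wt k ^ (2 / M : ℝ)) := mul_le_mul_right h2 _
      _ = _ := by ring
  calc ‖x k‖₊ = ‖x k‖₊ * wt k ^ n * wt k ^ (-(n : ℝ)) := by
        rw [mul_assoc, ← NNReal.rpow_natCast, ← NNReal.rpow_add hw]
        simp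
    _ ≤ 2 ^ n * modeSum n M x ^ (1 / M : ℝ) * wt k ^ (2 / M : ℝ) * wt k ^ (-(n : ℝ)) :=
        mul_le_mul_left h5 _
    _ = _ := by
        rw [mul_assoc, ← NNReal.rpow_add hw]
        congr 2
        ring

lemma lowMajorizes_majorant_toPoly (x : LowModes N) :
    LowMajorizes N (majorant (toPoly x)) (toPoly x) where
  toMajorizes := majorizes_majorant _
  supp k hk := by
    by_contra h
    refine hk ?_
    have h1 : ∀ j : ℤ, N < j.natAbs → (toPoly x).coeff j = 0 := fun j hj => by
      by_contra h0
      exact absurd (natAbs_le_of_mem_lowFreq (mem_of_coeff_toPoly_ne_zero h0)) (not_le.2 hj)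
    rw [majorant_coeff, h1 k (not_le.1 h), h1 (-k) (by simpa using h), if_neg]
    · simp
    · rintro rfl
      simp at h

lemma majorant_toPoly_le {n M : ℕ} (hM : M ≠ 0) (x : LowModes N) :
    majorant (toPoly x) ≤
      (1 + 2 * (2 ^ n * modeSum n M x ^ (1 / M : ℝ))) • decay (n - 2 / M : ℝ) N := by
  set B := 2 ^ n * modeSum n M x ^ (1 / M : ℝ)
  have hc : ∀ k : ℤ, ‖(toPoly x).coeff k‖₊ ≤ B * (decay (n - 2 / M : ℝ) N).coeff k := by
    intro k
    rw [decay_coeff, coeff_toPoly]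
    split_ifs with h1 h2 h2
    · exact nnnorm_le_modeSum hM x ⟨k, h1⟩
    · exact absurd (natAbs_le_of_mem_lowFreq h1) h2
    · simp
    · simp
  refine le_def.2 fun k => ?_
  rw [AddMonoidAlgebra.coeff_smul_apply, majorant_coeff, smul_eq_mul, add_mul, one_mul, two_mul,
    add_mul, add_assoc]
  have h1 : (if k = 0 then 1 else 0 : NNReal) ≤ (decay (n - 2 / M : ℝ) N).coeff k := by
    split_ifs with h
    · subst h
      rw [decay_coeff]
      simp [wt]
    · exact zero_le
  have h2 : (decay (n - 2 / M : ℝ) N).coeff (-k) = (decay (n - 2 / M : ℝ) N).coeff k := by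
    simp only [decay_coeff, Int.natAbs_neg, wt_neg]
  have h3 := hc (-k)
  rw [h2] at h3
  exact add_le_add h1 (add_le_add (hc k) h3)

/-- Bound for the rate of change of the energies in terms of `modeSum`. -/
lemma exists_sum_abs_energyRate_le {n : ℕ} (hn : 2 ≤ n) : ∃ C : ℝ, 0 ≤ C ∧
    ∀ (N : ℕ) (x : LowModes N),
      ∑ l ∈ Finset.range (n + 1), |energyRate N (2 * l + 1) (toPoly x)| ≤
        C * (1 + modeSum n (4 * n + 6) x) * (N + 1 : ℝ) ^ (-(3 / 14) : ℝ) := by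
  -- `M` is the degree of the drift bound in `Λ`, and `Λ` is affine in the `M`-th root of `modeSum`.
  -- The drift is therefore controlled by the first power of `modeSum`, whose expectation is finite.
  set M := 4 * n + 6 with hMdef
  have hM : M ≠ 0 := by omega
  have hn' : (2 : ℝ) ≤ n := by exact_mod_cast hn
  have hM14 : (14 : ℝ) ≤ M := by
    rw [hMdef]; push_cast; linarith
  have h2M : 2 / (M : ℝ) ≤ 1 / 7 := by
    rw [div_le_div_iff₀ (by linarith) (by norm_num)]
    linarith
  set s : ℝ := n - 2 / M
  have hs : 3 / 2 < s := by simp only [s]; linarith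
  have hl : ∀ l : ℕ, ∃ C : NNReal, l ≤ n → ∀ (N : ℕ) (f : TrigPoly) (a : Maj) (Λ : NNReal),
      LowMajorizes N a f → a ≤ Λ • decay s N →
      ‖energyLin f (defectDir N f) (-cj (defectDir N f)) (2 * l + 1)‖₊ ≤
        C * Λ ^ M * (N + 1 : NNReal) ^ (2 * n - 1 / 2 - 2 * s) := by
    intro l
    by_cases h : l ≤ n
    · obtain ⟨C, hC⟩ := exists_nnnorm_energyLin_defect_le (by omega) hs h
      exact ⟨C, fun _ => hC⟩
    · exact ⟨0, fun h' => absurd h' h⟩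
  choose C hC using hl
  refine ⟨∑ l ∈ Finset.range (n + 1), 2 * Real.pi * (C l * (2 ^ M * (1 + (2 * 2 ^ n) ^ M))),
    Finset.sum_nonneg fun _ _ => by positivity, fun N x => ?_⟩
  set S := modeSum n M x
  set Λ : NNReal := 1 + 2 * (2 ^ n * S ^ (1 / M : ℝ))
  have hΛ : Λ ^ M ≤ 2 ^ M * (1 + (2 * 2 ^ n) ^ M) * (1 + S) := by
    have h1 : (2 * (2 ^ n * S ^ (1 / M : ℝ))) ^ M = (2 * 2 ^ n) ^ M * S := by
      rw [← mul_assoc, mul_pow, ← NNReal.rpow_natCast (S ^ (1 / M : ℝ)), ← NNReal.rpow_mul,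
        one_div_mul_cancel (by exact_mod_cast hM), NNReal.rpow_one]
    calc Λ ^ M ≤ 2 ^ M * (1 ^ M + (2 * (2 ^ n * S ^ (1 / M : ℝ))) ^ M) := by
          refine (add_pow_le (by simp) (by simp) M).trans ?_
          exact mul_le_mul_left (pow_le_pow_right₀ (by norm_num) (Nat.sub_le _ _)) _
      _ = 2 ^ M * (1 + (2 * 2 ^ n) ^ M * S) := by rw [h1, one_pow]
      _ ≤ 2 ^ M * ((1 + (2 * 2 ^ n) ^ M) * (1 + S)) := by
          refine mul_le_mul_right ?_ _
          rw [add_mul, one_mul, mul_add, mul_one, add_assoc]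
          refine add_le_add le_rfl ?_
          exact (le_add_of_nonneg_left zero_le).trans (le_add_of_nonneg_left zero_le)
      _ = _ := by ring
  rw [Finset.sum_mul, Finset.sum_mul]
  refine Finset.sum_le_sum fun l hl => ?_
  have hb := hC l (Nat.lt_succ_iff.1 (Finset.mem_range.1 hl)) N (toPoly x) _ Λ
    (lowMajorizes_majorant_toPoly x) (majorant_toPoly_le hM x)
  -- The exponent is `-1/2 + 4/M`, and `M ≥ 14` makes it at most `-1/2 + 2/7 = -3/14`.
  have hexp : (N + 1 : NNReal) ^ (2 * n - 1 / 2 - 2 * s) ≤ (N + 1 : NNReal) ^ (-(3 / 14) : ℝ) := by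
    refine NNReal.rpow_le_rpow_of_exponent_le (by simp) ?_
    have : (2 * n - 1 / 2 - 2 * s : ℝ) = -(1 / 2) + 2 * (2 / M) := by
      simp only [s]; ring
    rw [this]
    linarith
  have hb2 : ‖energyLin (toPoly x) (defectDir N (toPoly x)) (-cj (defectDir N (toPoly x)))
      (2 * l + 1)‖₊ ≤ C l * (2 ^ M * (1 + (2 * 2 ^ n) ^ M) * (1 + S)) *
        (N + 1 : NNReal) ^ (-(3 / 14) : ℝ) :=
    hb.trans (mul_le_mul' (mul_le_mul_right hΛ _) hexp)
  have hb3 : ‖energyLin (toPoly x) (defectDir N (toPoly x)) (-cj (defectDir N (toPoly x)))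
      (2 * l + 1)‖ ≤ C l * (2 ^ M * (1 + (2 * 2 ^ n) ^ M) * (1 + S)) *
        (N + 1 : ℝ) ^ (-(3 / 14) : ℝ) := by
    have := NNReal.coe_le_coe.2 hb2
    push_cast at this
    exact this
  rw [energyRate, abs_mul, abs_of_pos (by positivity : 0 < 2 * Real.pi)]
  have hre : |(Complex.I * energyLin (toPoly x) (defectDir N (toPoly x))
      (-cj (defectDir N (toPoly x))) (2 * l + 1)).re| ≤ ‖energyLin (toPoly x)
        (defectDir N (toPoly x)) (-cj (defectDir N (toPoly x))) (2 * l + 1)‖ := by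
    refine (Complex.abs_re_le_norm _).trans ?_
    simp
  calc 2 * Real.pi * _ ≤ 2 * Real.pi * (C l * (2 ^ M * (1 + (2 * 2 ^ n) ^ M) * (1 + S)) *
        (N + 1 : ℝ) ^ (-(3 / 14) : ℝ)) :=
        mul_le_mul_of_nonneg_left (hre.trans hb3) (by positivity)
    _ = _ := by ring

/-- Normalized modes have a common moment, and the weights `⟨k⟩^{-2}` are summable over all of `ℤ`;
hence uniformity in `N`. -/
lemma lintegral_modeSum_le (n M : ℕ) : ∃ C : ENNReal, C ≠ ⊤ ∧ ∀ N : ℕ,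
    ∫⁻ x : LowModes N, (modeSum n M x : ENNReal) ∂(lowLaw n N) ≤ C := by
  refine ⟨(∫⁻ z, ‖z‖ₑ ^ M ∂complexGaussian) * zeta 2,
    ENNReal.mul_ne_top (lintegral_enorm_pow_complexGaussian_lt_top M).ne (by simp), fun N => ?_⟩
  have h1 : ∀ x : LowModes N, (modeSum n M x : ENNReal) =
      ∑ k : lowFreq N, (modeWeight n k * ‖x k‖ₑ) ^ M * (wt k ^ (-2 : ℝ) : NNReal) := fun x => by
    rw [modeSum]
    push_cast
    rfl
  simp only [h1]
  rw [lintegral_finsetSum' _ fun k _ => Measurable.aemeasurable (by fun_prop)]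
  have h2 : ∀ k : lowFreq N, ∫⁻ x : LowModes N, (modeWeight n k * ‖x k‖ₑ) ^ M *
      (wt k ^ (-2 : ℝ) : NNReal) ∂(lowLaw n N) =
        (∫⁻ z, ‖z‖ₑ ^ M ∂complexGaussian) * (wt k ^ (-2 : ℝ) : NNReal) := fun k => by
    rw [lintegral_mul_const _ (by fun_prop)]
    congr 1
    have h3 := (measurePreserving_eval (fun k : lowFreq N => modeLaw n k) k).lintegral_comp
      (f := fun z => (modeWeight n k * ‖z‖ₑ) ^ M) (by fun_prop)
    rw [lintegral_modeLaw] at h3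
    exact h3
  simp only [h2]
  rw [← Finset.mul_sum]
  refine mul_le_mul_right ?_ _
  rw [← ENNReal.ofNNReal_finsetSum, Finset.sum_coe_sort (lowFreq N) fun k => wt k ^ (-2 : ℝ)]
  exact ENNReal.coe_le_coe.2 (sum_le_zeta (by norm_num) (lowFreq N))

end Moments

/-! ### Borel sets of `H^s` as measurable sets of coefficient sequences. -/

section SobolevSpace

lemma separableSpace_ell2 : TopologicalSpace.SeparableSpace (lp (fun _ : ℤ => ℂ) 2) := by
  rw [← TopologicalSpace.isSeparable_univ_iff]
  have h1 : TopologicalSpace.IsSeparable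
      (Set.range fun i : ℤ => (lp.single 2 i (1 : ℂ) : lp (fun _ : ℤ => ℂ) 2)) :=
    (Set.countable_range _).isSeparable
  refine (h1.span (R := ℂ)).closure.mono fun f _ => ?_
  have h2 := lp.hasSum_single (by simp : (2 : ENNReal) ≠ ⊤) f
  refine mem_closure_of_tendsto h2 (Filter.Eventually.of_forall fun s => ?_)
  refine Submodule.sum_mem _ fun i _ => ?_
  have h3 : (lp.single 2 i (f i) : lp (fun _ : ℤ => ℂ) 2) = f i • lp.single 2 i (1 : ℂ) := by
    rw [← lp.single_smul, smul_eq_mul, mul_one]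
  rw [h3]
  exact Submodule.smul_mem _ _ (Submodule.subset_span ⟨i, rfl⟩)

lemma one_add_sq_rpow_pos (s : ℝ) (k : ℤ) : 0 < (1 + (k : ℝ) ^ 2) ^ (s / 2) := by positivity

lemma Sobolev.coeff_eq {s : ℝ} (u : Sobolev s) (k : ℤ) :
    u.coeff k = (((1 + (k : ℝ) ^ 2) ^ (s / 2) : ℝ) : ℂ)⁻¹ * u.bessel k := by
  have h : (((1 + (k : ℝ) ^ 2) ^ (s / 2) : ℝ) : ℂ) ≠ 0 :=
    Complex.ofReal_ne_zero.2 (one_add_sq_rpow_pos s k).ne'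
  have : u.bessel k = (((1 + (k : ℝ) ^ 2) ^ (s / 2) : ℝ) : ℂ) * u.coeff k := rfl
  rw [this, inv_mul_cancel_left₀ h]

lemma Sobolev.coeff_injective {s : ℝ} : Function.Injective (Sobolev.coeff (s := s)) := by
  rintro ⟨u, hu⟩ ⟨v, hv⟩ h
  cases (show u = v from h)
  rfl

lemma Sobolev.bessel_bijective {s : ℝ} : Function.Bijective (Sobolev.bessel (s := s)) := by
  constructor
  · intro u v h
    refine Sobolev.coeff_injective (funext fun k => ?_)
    rw [u.coeff_eq, v.coeff_eq, h]
  · intro f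
    have hmul : ∀ k : ℤ, (((1 + (k : ℝ) ^ 2) ^ (s / 2) : ℝ) : ℂ) *
        ((((1 + (k : ℝ) ^ 2) ^ (s / 2) : ℝ) : ℂ)⁻¹ * f k) = f k := fun k =>
      mul_inv_cancel_left₀ (Complex.ofReal_ne_zero.2 (one_add_sq_rpow_pos s k).ne') _
    refine ⟨⟨fun k => (((1 + (k : ℝ) ^ 2) ^ (s / 2) : ℝ) : ℂ)⁻¹ * f k, ?_⟩, ?_⟩
    · simp only [hmul]
      exact f.2
    · exact Subtype.ext (funext hmul)

/-- The map `bessel` identifies `H^s` with the separable Hilbert space `ℓ²`. -/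
instance (s : ℝ) : PolishSpace (Sobolev s) := by
  have h1 : Topology.IsInducing (Sobolev.bessel (s := s)) := ⟨rfl⟩
  have h2 : Topology.IsClosedEmbedding (Sobolev.bessel (s := s)) :=
    ⟨⟨h1, Sobolev.bessel_bijective.1⟩, by
      rw [Sobolev.bessel_bijective.2.range_eq]; exact isClosed_univ⟩
  have := separableSpace_ell2
  have : PolishSpace (lp (fun _ : ℤ => ℂ) 2) := inferInstance
  exact h2.polishSpace

lemma Sobolev.measurable_coeff {s : ℝ} : Measurable (Sobolev.coeff (s := s)) := by
  refine measurable_pi_iff.2 fun k => Continuous.measurable ?_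
  have h1 : Continuous (Sobolev.bessel (s := s)) := continuous_induced_dom
  have h2 : Continuous fun u : Sobolev s => u.bessel k :=
    (lp.evalCLM ℂ (fun _ : ℤ => ℂ) 2 k).continuous.comp h1
  simp only [fun u : Sobolev s => u.coeff_eq k]
  exact continuous_const.mul h2

/-- Lusin–Souslin: an injective measurable image of a Borel subset of a Polish space is measurable.
-/
lemma Sobolev.measurableSet_image_coeff {s : ℝ} {A : Set (Sobolev s)} (hA : MeasurableSet A) :
    MeasurableSet (Sobolev.coeff '' A) :=
  hA.image_of_measurable_injOn Sobolev.measurable_coeff Sobolev.coeff_injective.injOn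

end SobolevSpace

/-! ### Almost invariance of the weighted measures. -/

section AlmostInvariance

open TrigPoly

variable {n : ℕ} {χ : ℝ → ℝ} {R : ℝ}

lemma rho_eq (N : ℕ) (A : Set (ℤ → ℂ)) :
    rho χ n R N A = ∫ u in A, F χ n R (ev (toPoly (lowPart N u))) ∂(gaussian n) := by
  simp only [rho, proj_eq_ev_toPoly]

lemma integrable_F_lowPart (hn : 2 ≤ n) (hχ : Continuous χ) (hχc : HasCompactSupport χ)
    (hR : 0 < R) (N : ℕ) :
    Integrable (fun u => F χ n R (ev (toPoly (lowPart N u)))) (gaussian n) := by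
  obtain ⟨C, hC⟩ := exists_abs_F_le hn hχ hχc hR
  refine Integrable.of_bound (C := C) ?_ (Filter.Eventually.of_forall fun u => hC _)
  exact ((continuous_F_toPoly hχ).measurable.comp measurable_lowPart).aestronglyMeasurable

/-- If `K` changes along a volume preserving flow at rate at most `b`, then it changes by at most
`t ∫ b` in `L¹` up to time `t`. -/
lemma lintegral_flowMap_sub_le {N : ℕ} {K b : LowModes N → ℝ} (hb : Continuous b)
    (hb0 : ∀ x, 0 ≤ b x)
    (hK : ∀ (γ : ℝ → LowModes N) (t : ℝ), HasDerivAt γ (field N (γ t)) t →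
      ∃ d, HasDerivAt (fun s => K (γ s)) d t ∧ |d| ≤ b (γ t)) {t : ℝ} (ht : 0 ≤ t) :
    ∫⁻ x, ‖K ((conservedField (N := N)).flowMap t x) - K x‖ₑ ≤
      ENNReal.ofReal t * ∫⁻ x, ENNReal.ofReal (b x) := by
  set φ := (conservedField (N := N)).flowMap
  have hφ : ∀ x, Continuous fun s => φ s x := fun x => conservedField.continuous_flowMap_left x
  have hpt : ∀ x, ‖K (φ t x) - K x‖ₑ ≤ ∫⁻ s in Set.Ioc 0 t, ENNReal.ofReal (b (φ s x)) := by
    intro x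
    have hbc : Continuous fun s => b (φ s x) := hb.comp (hφ x)
    choose d hd hdb using fun s => hK (fun s => φ s x) s (conservedField.hasDerivAt_flowMap s x)
    -- Along each trajectory, the change of `K` is compared with a primitive of `s ↦ b (φ s x)`.
    -- Tonelli and invariance of volume then remove the flow from the integral.
    have h1 := image_norm_le_of_norm_deriv_right_le_deriv_boundary (a := 0) (b := t)
      (f := fun s => K (φ s x) - K x) (f' := d) (B := fun s => ∫ r in (0 : ℝ)..s, b (φ r x))
      (B' := fun s => b (φ s x))
      (fun s _ => ((hd s).sub_const _).continuousAt.continuousWithinAt)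
      (fun s _ => ((hd s).sub_const _).hasDerivWithinAt)
      (by simp [φ, conservedField.flowMap_zero])
      (fun s => intervalIntegral.integral_hasDerivAt_right (hbc.intervalIntegrable _ _)
        (hbc.stronglyMeasurableAtFilter _ _) hbc.continuousAt)
      (fun s _ => hdb s) (Set.right_mem_Icc.2 ht)
    rw [← ofReal_norm]
    refine (ENNReal.ofReal_le_ofReal h1).trans (le_of_eq ?_)
    rw [intervalIntegral.integral_of_le ht, ofReal_integral_eq_lintegral_ofReal
      (hbc.integrableOn_Ioc) (Filter.Eventually.of_forall fun s => hb0 _)]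
  have hmeas : Measurable (Function.uncurry fun (s : ℝ) (x : LowModes N) => φ s x) :=
    measurable_uncurry_of_continuous_of_measurable hφ
      fun s => (conservedField.continuous_flowMap s).measurable
  calc ∫⁻ x, ‖K (φ t x) - K x‖ₑ ≤ ∫⁻ x, ∫⁻ s in Set.Ioc 0 t, ENNReal.ofReal (b (φ s x)) :=
        lintegral_mono hpt
    _ = ∫⁻ s in Set.Ioc 0 t, ∫⁻ x, ENNReal.ofReal (b (φ s x)) := by
        refine lintegral_lintegral_swap ?_
        have : Measurable fun p : LowModes N × ℝ => ENNReal.ofReal (b (φ p.2 p.1)) :=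
          (hb.measurable.comp (hmeas.comp measurable_swap)).ennreal_ofReal
        exact this.aemeasurable
    _ = ∫⁻ _ in Set.Ioc 0 t, ∫⁻ x, ENNReal.ofReal (b x) := by
        refine lintegral_congr fun s => ?_
        exact (measurePreserving_flowMap_volume s).lintegral_comp hb.measurable.ennreal_ofReal
    _ = _ := by
        rw [setLIntegral_const, Real.volume_Ioc, sub_zero, mul_comm]

/-- The rate is dominated by the Gaussian density times `1 + modeSum` times the power of `N`. Its
integral is a Gaussian expectation bounded uniformly in `N`. -/
lemma exists_lintegral_flowMap_sub_le (hn : 2 ≤ n) (hχ : ContDiff ℝ ∞ χ)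
    (hχc : HasCompactSupport χ) (hR : 0 < R) :
    ∃ C : ENNReal, C ≠ ⊤ ∧ ∀ (N : ℕ) (t : ℝ), 0 ≤ t →
      ∫⁻ x : LowModes N, ‖lowDensity n N ((conservedField (N := N)).flowMap t x) *
        F χ n R (ev (toPoly ((conservedField (N := N)).flowMap t x))) -
          lowDensity n N x * F χ n R (ev (toPoly x))‖ₑ ≤
        ENNReal.ofReal t * (C * ENNReal.ofReal ((N + 1 : ℝ) ^ (-(3 / 14) : ℝ))) := by
  obtain ⟨C₁, hC₁, h1⟩ := exists_hasDerivAt_lowDensity_mul_F hn hχ hχc hR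
  obtain ⟨C₂, hC₂, h2⟩ := exists_sum_abs_energyRate_le hn
  obtain ⟨C₃, hC₃, h3⟩ := lintegral_modeSum_le n (4 * n + 6)
  refine ⟨ENNReal.ofReal (C₁ * C₂) * (1 + C₃),
    ENNReal.mul_ne_top ENNReal.ofReal_ne_top (by simp [hC₃]), fun N t ht => ?_⟩
  set δ : ℝ := (N + 1 : ℝ) ^ (-(3 / 14) : ℝ)
  have hδ : 0 ≤ δ := by positivity
  set S : LowModes N → NNReal := modeSum n (4 * n + 6)
  have hSc : Continuous S := continuous_modeSum n (4 * n + 6)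
  set b : LowModes N → ℝ := fun x => C₁ * C₂ * δ * (lowDensity n N x * (1 + S x))
  have hld := continuous_lowDensity n N
  have hbc : Continuous b := by
    have : Continuous fun x => (S x : ℝ) := NNReal.continuous_coe.comp hSc
    exact continuous_const.mul (hld.mul (continuous_const.add this))
  have hb0 : ∀ x, 0 ≤ b x := fun x => by
    have := lowDensity_nonneg n N x
    positivity
  refine (lintegral_flowMap_sub_le
    (K := fun x => lowDensity n N x * F χ n R (ev (toPoly x))) hbc hb0 ?_ ht).trans ?_
  · intro γ t hγ
    obtain ⟨d, hd, hdb⟩ := h1 N γ t hγ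
    refine ⟨d, hd, hdb.trans ?_⟩
    calc C₁ * (lowDensity n N (γ t) * _) ≤
        C₁ * (lowDensity n N (γ t) * (C₂ * (1 + S (γ t)) * δ)) :=
          mul_le_mul_of_nonneg_left (mul_le_mul_of_nonneg_left (h2 N (γ t))
            (lowDensity_nonneg n N _)) hC₁
      _ = b (γ t) := by simp only [b]; ring
  · refine mul_le_mul_right ?_ _
    have hb : ∀ x, ENNReal.ofReal (b x) =
        ENNReal.ofReal (C₁ * C₂ * δ) * (ENNReal.ofReal (lowDensity n N x) * (1 + S x)) := fun x => by
      rw [ENNReal.ofReal_mul (by positivity), ENNReal.ofReal_mul (lowDensity_nonneg n N x),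
        ENNReal.ofReal_add zero_le_one (S x).coe_nonneg, ENNReal.ofReal_one, ENNReal.ofReal_coe_nnreal]
    have hSm : Measurable fun x => (1 + S x : ENNReal) :=
      measurable_const.add hSc.measurable.coe_nnreal_ennreal
    have hint : ∫⁻ x, ENNReal.ofReal (lowDensity n N x) * (1 + S x) ≤ 1 + C₃ := by
      have h4 := lintegral_withDensity_eq_lintegral_mul volume
        hld.measurable.ennreal_ofReal hSm
      rw [← lowLaw_eq_withDensity] at h4
      refine (le_of_eq h4.symm).trans ?_
      rw [lintegral_add_left measurable_const, lintegral_const, measure_univ, one_mul]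
      exact add_le_add le_rfl (h3 N)
    simp only [hb]
    have hm : Measurable fun x => ENNReal.ofReal (lowDensity n N x) * (1 + S x : ENNReal) :=
      hld.measurable.ennreal_ofReal.mul hSm
    rw [lintegral_const_mul _ hm,
      ENNReal.ofReal_mul (by positivity)]
    calc ENNReal.ofReal (C₁ * C₂) * ENNReal.ofReal δ * _ ≤
        ENNReal.ofReal (C₁ * C₂) * ENNReal.ofReal δ * (1 + C₃) := mul_le_mul_right hint _
      _ = _ := by ring

lemma tendsto_iSup_abs_rho_sub (hn : 2 ≤ n) (hχ : ContDiff ℝ ∞ χ)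
    (hχc : HasCompactSupport χ) (hR : 0 < R) (T : ℝ) :
    Filter.Tendsto
      (fun N : ℕ =>
        ⨆ (t : ℝ) (_ : t ∈ Set.Icc 0 T) (σ : ℝ) (_ : σ < (2 * (n : ℝ) - 1) / 2)
          (A : Set (Sobolev σ)) (_ : MeasurableSet A),
          ENNReal.ofReal
            |rho χ n R N (flow N t '' (Sobolev.coeff '' A)) - rho χ n R N (Sobolev.coeff '' A)|)
      Filter.atTop (𝓝 0) := by
  obtain ⟨C, hC, h⟩ := exists_lintegral_flowMap_sub_le hn hχ hχc hR
  have hlim : Filter.Tendsto (fun N : ℕ => ENNReal.ofReal T *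
      (C * ENNReal.ofReal ((N + 1 : ℝ) ^ (-(3 / 14) : ℝ)))) Filter.atTop (𝓝 0) := by
    have h1 : Filter.Tendsto (fun N : ℕ => ((N + 1 : ℝ)) ^ (-(3 / 14) : ℝ)) Filter.atTop (𝓝 0) :=
      (tendsto_rpow_neg_atTop (by norm_num : (0 : ℝ) < 3 / 14)).comp
        (Filter.tendsto_atTop_add_const_right _ 1 tendsto_natCast_atTop_atTop)
    have h2 := ENNReal.tendsto_ofReal h1
    rw [ENNReal.ofReal_zero] at h2
    have h3 := ENNReal.Tendsto.const_mul (ENNReal.Tendsto.const_mul h2 (Or.inr hC))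
      (Or.inr (ENNReal.ofReal_ne_top (r := T)))
    simpa using h3
  refine tendsto_of_tendsto_of_tendsto_of_le_of_le tendsto_const_nhds hlim (fun _ => zero_le)
    fun N => ?_
  refine iSup₂_le fun t ht => iSup₂_le fun σ _ => iSup₂_le fun A hA => ?_
  rw [rho_eq, rho_eq]
  refine (ofReal_abs_setIntegral_flow_sub_le n (continuous_F_toPoly hχ.continuous)
    (integrable_F_lowPart hn hχ.continuous hχc hR N) t
    (Sobolev.measurableSet_image_coeff hA)).trans ((h N t ht.1).trans ?_)
  exact mul_le_mul_left (ENNReal.ofReal_le_ofReal ht.2) _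

end AlmostInvariance

end CmKdV

end

theorem proposition4p1 (n : ℕ) (hn : 2 ≤ n)
    (χ : ℝ → ℝ) (hχ : ContDiff ℝ ∞ χ) (hχc : HasCompactSupport χ)
    (hχ1 : ∀ x : ℝ, |x| < 1 → χ x = 1)
    (R T : ℝ) (hR : 0 < R) (hT : 0 < T) :
    (∀ (N : ℕ) (u₀ : ℤ → ℂ), ∃! u : ℝ → ℤ → ℂ, CmKdV.IsSolution N u₀ u) ∧
    (∀ N : ℕ, MeasureTheory.Integrable (fun u => CmKdV.F χ n R (CmKdV.proj N u))
      (CmKdV.gaussian n)) ∧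
    Filter.Tendsto
      (fun N : ℕ =>
        ⨆ (t : ℝ) (_ : t ∈ Set.Icc 0 T) (σ : ℝ) (_ : σ < (2 * (n : ℝ) - 1) / 2)
          (A : Set (CmKdV.Sobolev σ)) (_ : MeasurableSet A),
          ENNReal.ofReal
            |CmKdV.rho χ n R N (CmKdV.flow N t '' (CmKdV.Sobolev.coeff '' A)) -
              CmKdV.rho χ n R N (CmKdV.Sobolev.coeff '' A)|)
      Filter.atTop (𝓝 0) := by
  refine ⟨CmKdV.existsUnique_isSolution, fun N => ?_,
    CmKdV.tendsto_iSup_abs_rho_sub hn hχ hχc hR T⟩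
  simp only [CmKdV.proj_eq_ev_toPoly]
  exact CmKdV.integrable_F_lowPart hn hχ.continuous hχc hR N
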